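/- Let $\varphi:\mathbb{R}\to\mathbb{R}$ be a strictly increasing $C^\infty$ diffeomorphism, and write $\dot\varphi$ for its derivative and $\vec e_1=(1,0,0)$, $\vec e_3=(0,0,1)$. Let $\Sigma$ be a connected smooth surface without boundary and $\psi:\Sigma\to\mathbb{R}^3$ a smooth immersion whose induced metric is complete. Call $\psi$ flat if its Gauss curvature vanishes identically, and $[\varphi,\vec e_3]$-minimal if at every $p\in\Sigma$ its mean curvature vector $\mathbf{H}$ (the trace of the normal-valued second fundamental form) satisfies $$\mathbf{H}(p)=\dot\varphi\big(\langle\psi(p),\vec e_3\rangle\big)\,\vec e_3^{\,\perp},$$ where $\perp$ is the orthogonal projection onto the normal line of $\psi$ at $p$. For $u_0\in\mathbb{R}$ let $u:I\to\mathbb{R}$, with $I$ an open interval containing $0$, be the maximal solution of $$u''=\dot\varphi(u)\,(1+u'^2),\qquad u(0)=u_0,\quad u'(0)=0,$$ and let $\mathcal{G}^{u_0}=\{(x,y,u(x)) : x\in I,\ y\in\mathbb{R}\}$. A *horizontal motion* is a rotation about the vertical axis followed by a horizontal translation. A *$[\varphi,\vec e_3]$-catenary cylinder* is the image of some $\mathcal{G}^{u_0}$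 under a horizontal motion. A *tilted $[\varphi,\vec e_3]$-catenary cylinder* is the image under a horizontal motion of the surface obtained from some $\mathcal{G}^{u_0}$ by rotating it by an angle $\theta\in\,]0,\pi/2[$ about the $x$-axis $\mathbb{R}\vec e_1$ and then dilating it by the factor $1/\cos\theta$ from the origin. A *vertical plane* is an affine plane parallel to $\vec e_3$. **Theorem.** If $\psi$ is complete, flat and $[\varphi,\vec e_3]$-minimal, then $\psi$ is an embedding and $\psi(\Sigma)$ is a vertical plane, a $[\varphi,\vec e_3]$-catenary cylinder, or a tilted $[\varphi,\vec e_3]$-catenary cylinder. -/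

import Mathlib

open Set Filter Topology
open scoped Manifold ContDiff ENNReal

noncomputable section

namespace PhiMinimal

/-- The Euclidean plane. -/
abbrev E2 : Type := EuclideanSpace ℝ (Fin 2)

/-- Euclidean three-space; the vertical direction is the coordinate with index `2`. -/
abbrev E3 : Type := EuclideanSpace ℝ (Fin 3)

/-- The vertical unit vector. -/
def e₃ : E3 := !₂[0, 0, 1]

section Surface

variable {M : Type*} [TopologicalSpace M] [ChartedSpace E2 M]

/-- `ψ` is a smooth immersion of the surface `M` into three-space. -/
def IsSmoothImmersion (ψ : M → E3) : Prop :=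
  ContMDiff (𝓡 2) 𝓘(ℝ, E3) ∞ ψ ∧
    ∀ p : M, Function.Injective (mfderiv (𝓡 2) 𝓘(ℝ, E3) ψ p)

/-- The norm of the induced metric: the length of `v` is the Euclidean length of `dψ v`. -/
@[reducible] def inducedENorm (ψ : M → E3) (p : M) : ENorm (TangentSpace (𝓡 2) p) :=
  ⟨fun v => enorm (E := E3) (mfderiv (𝓡 2) 𝓘(ℝ, E3) ψ p v)⟩

/-- The intrinsic distance of the induced metric: the infimum of the lengths of the
`C¹` paths joining two points. -/
def intrinsicEDist (ψ : M → E3) (p q : M) : ℝ≥0∞ :=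
  letI : ∀ x : M, ENorm (TangentSpace (𝓡 2) x) := inducedENorm ψ
  Manifold.riemannianEDist (𝓡 2) p q

/-- The induced metric is complete: Cauchy sequences for the intrinsic distance converge. -/
def IsCompleteSurface (ψ : M → E3) : Prop :=
  ∀ s : ℕ → M,
    (∀ ε : ℝ≥0∞, 0 < ε → ∃ N : ℕ, ∀ m ≥ N, ∀ n ≥ N, intrinsicEDist ψ (s m) (s n) < ε) →
      ∃ p : M, Tendsto (fun n => intrinsicEDist ψ (s n) p) atTop (𝓝 0)

/-- The local parametrization of the surface given by the preferred chart at `p`. -/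
def localParam (ψ : M → E3) (p : M) (y : E2) : E3 :=
  ψ ((chartAt E2 p).symm y)

/-- The first partial derivative `f_i` of the local parametrization at the point `p`. -/
def tangentVec (ψ : M → E3) (p : M) (i : Fin 2) : E3 :=
  fderiv ℝ (localParam ψ p) (chartAt E2 p p) (EuclideanSpace.single i 1)

/-- The second partial derivative `f_ij` of the local parametrization at the point `p`. -/
def secondDeriv (ψ : M → E3) (p : M) (i j : Fin 2) : E3 :=
  fderiv ℝ (fun y => fderiv ℝ (localParam ψ p) y (EuclideanSpace.single j 1))
    (chartAt E2 p p) (EuclideanSpace.single i 1)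

/-- The tangent plane of the surface at `p`, as a linear subspace of three-space. -/
def tangentPlane (ψ : M → E3) (p : M) : Submodule ℝ E3 :=
  Submodule.span ℝ (range (tangentVec ψ p))

/-- The orthogonal projection `w ↦ w^⊥` onto the normal line of the surface at `p`. -/
def normalPart (ψ : M → E3) (p : M) (w : E3) : E3 :=
  (tangentPlane ψ p)ᗮ.starProjection w

/-- The coefficients `g_ij = ⟨f_i, f_j⟩` of the first fundamental form. -/
def firstForm (ψ : M → E3) (p : M) (i j : Fin 2) : ℝ :=
  inner ℝ (tangentVec ψ p i) (tangentVec ψ p j)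

/-- The coefficients `(f_ij)^⊥` of the (normal-valued) second fundamental form. -/
def secondForm (ψ : M → E3) (p : M) (i j : Fin 2) : E3 :=
  normalPart ψ p (secondDeriv ψ p i j)

/-- The determinant of the first fundamental form. -/
def firstFormDet (ψ : M → E3) (p : M) : ℝ :=
  firstForm ψ p 0 0 * firstForm ψ p 1 1 - firstForm ψ p 0 1 ^ 2

/-- The Gauss curvature, `det II / det I`. -/
def gaussCurvature (ψ : M → E3) (p : M) : ℝ :=
  (inner ℝ (secondForm ψ p 0 0) (secondForm ψ p 1 1) - ‖secondForm ψ p 0 1‖ ^ 2) /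
    firstFormDet ψ p

/-- The mean curvature vector: the trace `g^ij II_ij` of the second fundamental form
(the sum, not the average, of the principal curvatures, times the unit normal). -/
def meanCurvatureVector (ψ : M → E3) (p : M) : E3 :=
  (firstFormDet ψ p)⁻¹ •
    (firstForm ψ p 1 1 • secondForm ψ p 0 0 - (2 * firstForm ψ p 0 1) • secondForm ψ p 0 1 +
      firstForm ψ p 0 0 • secondForm ψ p 1 1)

/-- The surface is flat: its Gauss curvature vanishes identically. -/
def IsFlat (ψ : M → E3) : Prop :=
  ∀ p : M, gaussCurvature ψ p = 0

/-- The surface is `[φ, e₃]`-minimal: `H = φ'(height) e₃^⊥`. -/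
def IsPhiMinimal (φ : ℝ → ℝ) (ψ : M → E3) : Prop :=
  ∀ p : M, meanCurvatureVector ψ p = deriv φ (ψ p 2) • normalPart ψ p e₃

end Surface

/-- `u` solves `u'' = φ'(u) (1 + u'²)`, `u 0 = u₀`, `u' 0 = 0` on the open interval `I ∋ 0`. -/
structure IsCatenarySolution (φ : ℝ → ℝ) (u₀ : ℝ) (I : Set ℝ) (u : ℝ → ℝ) : Prop where
  isOpen : IsOpen I
  ordConnected : I.OrdConnected
  zero_mem : (0 : ℝ) ∈ I
  init : u 0 = u₀
  init_deriv : deriv u 0 = 0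
  differentiableAt : ∀ x ∈ I, DifferentiableAt ℝ u x
  ode : ∀ x ∈ I, HasDerivAt (deriv u) (deriv φ (u x) * (1 + deriv u x ^ 2)) x

/-- `u` is a solution as above which is maximal: it does not extend to a larger interval. -/
def IsMaximalCatenarySolution (φ : ℝ → ℝ) (u₀ : ℝ) (I : Set ℝ) (u : ℝ → ℝ) : Prop :=
  IsCatenarySolution φ u₀ I u ∧
    ∀ (J : Set ℝ) (v : ℝ → ℝ), IsCatenarySolution φ u₀ J v → I ⊆ J → EqOn u v I → J = I

/-- The cylinder `{(x, y, u x) : x ∈ I, y ∈ ℝ}`. -/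
def graphCylinder (I : Set ℝ) (u : ℝ → ℝ) : Set E3 :=
  {q | ∃ x ∈ I, ∃ y : ℝ, q = !₂[x, y, u x]}

/-- Rotation by the angle `θ` about the first coordinate axis. -/
def rotateX (θ : ℝ) (q : E3) : E3 :=
  !₂[q 0, Real.cos θ * q 1 - Real.sin θ * q 2, Real.sin θ * q 1 + Real.cos θ * q 2]

/-- The rotation by the angle `θ` about the first axis, followed by the dilation by
`1 / cos θ`. -/
def tilt (θ : ℝ) (q : E3) : E3 :=
  (1 / Real.cos θ) • rotateX θ q

/-- The horizontal motion: rotation by `α` about the vertical axis, followed by the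
horizontal translation by `(a, b, 0)`. -/
def horizontalMotion (α a b : ℝ) (q : E3) : E3 :=
  !₂[Real.cos α * q 0 - Real.sin α * q 1 + a, Real.sin α * q 0 + Real.cos α * q 1 + b, q 2]

/-- `S` is a plane parallel to `e₃`. -/
def IsVerticalPlane (S : Set E3) : Prop :=
  ∃ α c : ℝ, S = {q | Real.cos α * q 0 + Real.sin α * q 1 = c}

/-- `S` is a `[φ, e₃]`-catenary cylinder, up to a horizontal motion. -/
def IsCatenaryCylinder (φ : ℝ → ℝ) (S : Set E3) : Prop :=
  ∃ (u₀ : ℝ) (I : Set ℝ) (u : ℝ → ℝ) (α a b : ℝ),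
    IsMaximalCatenarySolution φ u₀ I u ∧ S = horizontalMotion α a b '' graphCylinder I u

/-- `S` is a tilted `[φ, e₃]`-catenary cylinder, with tilting angle `θ ∈ (0, π/2)`, up to a
horizontal motion. -/
def IsTiltedCatenaryCylinder (φ : ℝ → ℝ) (S : Set E3) : Prop :=
  ∃ (u₀ : ℝ) (I : Set ℝ) (u : ℝ → ℝ) (θ α a b : ℝ),
    IsMaximalCatenarySolution φ u₀ I u ∧ θ ∈ Ioo 0 (Real.pi / 2) ∧
      S = horizontalMotion α a b '' (tilt θ '' graphCylinder I u)

end PhiMinimal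

end

noncomputable section

set_option linter.unusedSectionVars false

/-! The tangent plane is either vertical at some point or vertical nowhere, and the two cases lead
to different conclusions.

Suppose it is vertical at `p`. Write the surface near `p` as a graph `W` over that vertical plane.
Flatness says that the Hessian of `W` has determinant zero, and minimality says that an elliptic
combination of its entries is a multiple of the vertical derivative of `W`. A symmetric matrix of
determinant zero is controlled by such a combination (`hessian_bounds`), so the whole Hessian is
bounded by a constant times that vertical derivative. The derivative vanishes at `p`, so a Gronwall
estimate along segments makes it vanish nearby, and the surface coincides with the plane near `p`
(`eventually_isVertAt`). An open-closed argument spreads this over the connected surface, and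
completeness makes the image the entire plane.

Suppose it is nowhere vertical. The horizontal projection is then a local diffeomorphism, and the
height `z` is a smooth function of the two local coordinates. Its Hessian has determinant zero, and
`φ' > 0` makes its trace positive. The kernel direction of the Hessian is constant along the
straight line it spans, and the gradient is constant there too. The lifted line therefore has
constant speed and, by completeness, extends forever. Along it the reciprocal of the nonzero
eigenvalue is affine (`dirE_hA_nonpos`). A positive affine function on a whole line is constant,
hence so is the eigenvalue, and this forces the kernel direction to be the same at every point of
the surface (`exists_kernel`).

So `z` has constant slope `b` along one fixed horizontal direction, and the equation becomes an ODE
in the orthogonal direction. If `b ≠ 0`, the height takes all real values along a ruling while the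
rest of the equation is unchanged, so `φ'` is constant; this is the tilted case, with angle `arctan
b`. If `b = 0` the cylinder is not tilted. The ODE has the first integral `φ(u) - log (1 + u'²) /
2`, and its solutions can be parametrized by their slope, which runs through all of `ℝ`
(`exists_profile`).

In both cases the global conclusion comes from `injective_and_range_eq`: completeness gives path
lifting for the local diffeomorphism, which makes it a bijection onto the plane domain in question.
-/

namespace PhiMinimal

/-! ### Projections of the surface to a plane as local diffeomorphisms -/

section Etale

variable {M : Type*} [TopologicalSpace M] [ChartedSpace E2 M]

/-- `κ` is a local diffeomorphism on the open set `U`, with chosen local inverses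
`(e m).symm`. -/
structure IsEtaleOn (κ : M → E2) (e : M → OpenPartialHomeomorph M E2) (U : Set M) : Prop where
  isOpen : IsOpen U
  mem : ∀ m ∈ U, m ∈ (e m).source
  eqOn : ∀ m ∈ U, EqOn κ (e m) (e m).source
  smooth : ∀ m ∈ U, ContMDiffAt (𝓡 2) (𝓡 2) ∞ (e m).symm (κ m)

/-- The differential of `ψ` at `p`, in the preferred chart at `p`. -/
def dMap (ψ : M → E3) (p : M) : E2 →L[ℝ] E3 :=
  fderiv ℝ (localParam ψ p) (chartAt E2 p p)

/-- The derivative of `f` in the direction `v`, with respect to the local coordinates `κ`. -/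
def dirD {F : Type*} [NormedAddCommGroup F] [NormedSpace ℝ F] (κ : M → E2)
    (e : M → OpenPartialHomeomorph M E2) (v : E2) (f : M → F) (m : M) : F :=
  fderiv ℝ (f ∘ (e m).symm) (κ m) v

lemma mfderiv_eq_dMap {ψ : M → E3} {p : M} (h : MDifferentiableAt (𝓡 2) 𝓘(ℝ, E3) ψ p) :
    mfderiv (𝓡 2) 𝓘(ℝ, E3) ψ p = dMap ψ p := by
  simp only [mfderiv, h, mfld_simps, fderivWithin_univ]
  rfl

lemma hasMFDerivAt_dMap {ψ : M → E3} {p : M} (h : MDifferentiableAt (𝓡 2) 𝓘(ℝ, E3) ψ p) :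
    HasMFDerivAt (𝓡 2) 𝓘(ℝ, E3) ψ p (dMap ψ p) := by
  have := h.hasMFDerivAt
  rwa [mfderiv_eq_dMap h] at this

variable [IsManifold (𝓡 2) ∞ M] {ψ : M → E3}

lemma contDiffAt_localParam (hψ : ContMDiff (𝓡 2) 𝓘(ℝ, E3) ∞ ψ) (p : M) :
    ContDiffAt ℝ ∞ (localParam ψ p) (chartAt E2 p p) := by
  have h1 : ContMDiffAt (𝓡 2) (𝓡 2) ∞ (chartAt E2 p).symm (chartAt E2 p p) :=
    contMDiffOn_chart_symm.contMDiffAt ((chartAt E2 p).open_target.mem_nhds (mem_chart_target E2 p))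
  exact (hψ.contMDiffAt.comp _ h1).contDiffAt

/-- This is the inverse function theorem for `L ∘ ψ` in the preferred chart at `p`. It yields
smoothness of the local inverse at the one point `L (ψ p)`, which is why `IsEtaleOn` asks for no
more. -/
lemma exists_localDiffeo (hψ : ContMDiff (𝓡 2) 𝓘(ℝ, E3) ∞ ψ) (L : E3 →L[ℝ] E2) (p : M)
    (hinj : ∀ v, L (dMap ψ p v) = 0 → v = 0) :
    ∃ e : OpenPartialHomeomorph M E2, p ∈ e.source ∧ EqOn (fun m => L (ψ m)) e e.source ∧
      ContMDiffAt (𝓡 2) (𝓡 2) ∞ e.symm (L (ψ p)) := by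
  set y0 := chartAt E2 p p with hy0
  have hF := contDiffAt_localParam hψ p
  have hk : ContDiffAt ℝ ∞ (fun y => L (localParam ψ p y)) y0 := L.contDiff.contDiffAt.comp _ hF
  have hd : HasFDerivAt (fun y => L (localParam ψ p y))
      (L.comp (fderiv ℝ (localParam ψ p) y0)) y0 :=
    L.hasFDerivAt.comp y0 (hF.differentiableAt (by simp)).hasFDerivAt
  have hi : Function.Injective (L.comp (fderiv ℝ (localParam ψ p) y0)) := by
    rw [injective_iff_map_eq_zero]
    intro v hv
    apply hinj v
    exact hv
  let g : E2 ≃L[ℝ] E2 := (LinearEquiv.ofInjectiveEndo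
    (L.comp (fderiv ℝ (localParam ψ p) y0)).toLinearMap hi).toContinuousLinearEquiv
  have hg : (g : E2 →L[ℝ] E2) = L.comp (fderiv ℝ (localParam ψ p) y0) := by
    ext v; rfl
  have hd' : HasFDerivAt (fun y => L (localParam ψ p y)) (g : E2 →L[ℝ] E2) y0 := by
    rw [hg]; exact hd
  let t := hk.toOpenPartialHomeomorph _ hd' (by simp)
  have htc : (t : E2 → E2) = fun y => L (localParam ψ p y) := rfl
  have hp : localParam ψ p y0 = ψ p := by simp [localParam, hy0]
  refine ⟨(chartAt E2 p).trans t, ?_, ?_, ?_⟩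
  · rw [OpenPartialHomeomorph.trans_source]
    exact ⟨mem_chart_source E2 p, hk.mem_toOpenPartialHomeomorph_source hd' (by simp)⟩
  · intro m hm
    rw [OpenPartialHomeomorph.trans_source] at hm
    simp [htc, localParam, (chartAt E2 p).left_inv hm.1]
  · have h1 : ContDiffAt ℝ ∞ t.symm (L (ψ p)) := by
      have := hk.to_localInverse hd' (by simp)
      rw [hp] at this
      exact this
    have h2 : t.symm (L (ψ p)) = y0 := by
      have := t.left_inv (hk.mem_toOpenPartialHomeomorph_source hd' (by simp))
      rw [htc] at this
      simpa [hp] using this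
    have h3 : ContMDiffAt (𝓡 2) (𝓡 2) ∞ (chartAt E2 p).symm (t.symm (L (ψ p))) := by
      rw [h2]
      exact contMDiffOn_chart_symm.contMDiffAt
        ((chartAt E2 p).open_target.mem_nhds (mem_chart_target E2 p))
    exact h3.comp _ h1.contMDiffAt

/-- The part to prove is that the set of immersive points is open. Near `p` the local inverse at `p`
is still differentiable. By the chain rule its derivative is a right inverse of `L ∘ dψ`, and
surjectivity is the same as injectivity between planes. -/
lemma exists_isEtaleOn (hψ : ContMDiff (𝓡 2) 𝓘(ℝ, E3) ∞ ψ) (L : E3 →L[ℝ] E2) :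
    ∃ e : M → OpenPartialHomeomorph M E2, IsEtaleOn (fun m => L (ψ m)) e
      {p | ∀ v, L (dMap ψ p v) = 0 → v = 0} := by
  have key : ∀ p : M, ∃ e : OpenPartialHomeomorph M E2,
      (∀ v, L (dMap ψ p v) = 0 → v = 0) →
        p ∈ e.source ∧ EqOn (fun m => L (ψ m)) e e.source ∧
          ContMDiffAt (𝓡 2) (𝓡 2) ∞ e.symm (L (ψ p)) := by
    intro p
    by_cases h : ∀ v, L (dMap ψ p v) = 0 → v = 0
    · obtain ⟨e, he⟩ := exists_localDiffeo hψ L p h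
      exact ⟨e, fun _ => he⟩
    · exact ⟨chartAt E2 p, fun h' => absurd h' h⟩
  choose e he using key
  refine ⟨e, ?_, fun m hm => (he m hm).1, fun m hm => (he m hm).2.1, fun m hm => (he m hm).2.2⟩
  rw [isOpen_iff_mem_nhds]
  intro p hp
  obtain ⟨h1, h2, h3⟩ := he p hp
  have hc : ContinuousAt (fun m => L (ψ m)) p := (L.continuous.comp hψ.continuous).continuousAt
  have h4 : ∀ᶠ y in 𝓝 (L (ψ p)), ContMDiffAt (𝓡 2) (𝓡 2) 1 (e p).symm y :=
    (contMDiffAt_iff_contMDiffAt_nhds (by simp)).1 (h3.of_le (by norm_cast))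
  have h5 : ∀ᶠ y in 𝓝 (L (ψ p)), y ∈ (e p).target := by
    apply (e p).open_target.mem_nhds
    have := (e p).map_source h1
    rwa [← h2 h1] at this
  filter_upwards [hc.eventually (h4.and h5), (e p).open_source.mem_nhds h1] with m hm hms
  have hlin : Function.Injective (L.comp (dMap ψ m)).toLinearMap := by
    rw [LinearMap.injective_iff_surjective]
    intro v
    have hs : (e p).symm (L (ψ m)) = m := by
      rw [show L (ψ m) = e p m from h2 hms]; exact (e p).left_inv hms
    have d1 : HasMFDerivAt (𝓡 2) (𝓡 2) (e p).symm (L (ψ m))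
      (mfderiv (𝓡 2) (𝓡 2) (e p).symm (L (ψ m))) := (hm.1.mdifferentiableAt (by simp)).hasMFDerivAt
    have d2 : HasMFDerivAt (𝓡 2) 𝓘(ℝ, E3) ψ ((e p).symm (L (ψ m))) (dMap ψ m) := by
      have := hasMFDerivAt_dMap ((hψ m).mdifferentiableAt (by simp))
      rw [hs]; exact this
    have d4 := (hasMFDerivAt_iff_hasFDerivAt.1 (d2.comp _ d1))
    have d5 := L.hasFDerivAt.comp _ d4
    have d6 : (fun y => L ((ψ ∘ (e p).symm) y)) =ᶠ[𝓝 (L (ψ m))] id := by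
      filter_upwards [(e p).open_target.mem_nhds hm.2] with y hy
      have := h2 ((e p).map_target hy)
      simpa [(e p).right_inv hy] using this
    have d7 := (d5.congr_of_eventuallyEq d6.symm).unique (hasFDerivAt_id _)
    exact ⟨mfderiv (𝓡 2) (𝓡 2) (e p).symm (L (ψ m)) v,
      congrArg (fun T : E2 →L[ℝ] E2 => T v) d7⟩
  exact (injective_iff_map_eq_zero _).1 hlin

end Etale

/-! ### Differential calculus in étale coordinates -/

section Calculus

variable {M : Type*} [TopologicalSpace M] [ChartedSpace E2 M]
  {F : Type*} [NormedAddCommGroup F] [NormedSpace ℝ F]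
  {G : Type*} [NormedAddCommGroup G] [NormedSpace ℝ G]
  {κ : M → E2} {e : M → OpenPartialHomeomorph M E2} {U : Set M}

namespace IsEtaleOn

variable {m : M}

lemma apply_eq (h : IsEtaleOn κ e U) (hm : m ∈ U) : κ m = e m m := h.eqOn m hm (h.mem m hm)

lemma symm_apply (h : IsEtaleOn κ e U) (hm : m ∈ U) : (e m).symm (κ m) = m := by
  rw [h.apply_eq hm, (e m).left_inv (h.mem m hm)]

lemma mem_target (h : IsEtaleOn κ e U) (hm : m ∈ U) : κ m ∈ (e m).target := by
  rw [h.apply_eq hm]; exact (e m).map_source (h.mem m hm)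

lemma eventually_eq (h : IsEtaleOn κ e U) (hm : m ∈ U) : κ =ᶠ[𝓝 m] e m := by
  filter_upwards [(e m).open_source.mem_nhds (h.mem m hm)] with x hx using h.eqOn m hm hx

lemma continuousAt (h : IsEtaleOn κ e U) (hm : m ∈ U) : ContinuousAt κ m :=
  ((e m).continuousAt (h.mem m hm)).congr (h.eventually_eq hm).symm

lemma tendsto_symm (h : IsEtaleOn κ e U) (hm : m ∈ U) : Tendsto (e m).symm (𝓝 (κ m)) (𝓝 m) := by
  have := (e m).continuousAt_symm (h.mem_target hm)
  rwa [ContinuousAt, h.symm_apply hm] at this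

lemma eventually_symm_apply (h : IsEtaleOn κ e U)
    (hm : m ∈ U) : ∀ᶠ x in 𝓝 m, (e m).symm (κ x) = x := by
  filter_upwards [(e m).open_source.mem_nhds (h.mem m hm)] with x hx
  rw [h.eqOn m hm hx, (e m).left_inv hx]

lemma eventually_apply_symm (h : IsEtaleOn κ e U)
    (hm : m ∈ U) : ∀ᶠ y in 𝓝 (κ m), κ ((e m).symm y) = y := by
  filter_upwards [(e m).open_target.mem_nhds (h.mem_target hm)] with y hy
  rw [h.eqOn m hm ((e m).map_target hy), (e m).right_inv hy]

lemma eventually_mem (h : IsEtaleOn κ e U) (hm : m ∈ U) : ∀ᶠ y in 𝓝 (κ m), (e m).symm y ∈ U :=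
  (h.tendsto_symm hm).eventually (h.isOpen.mem_nhds hm)

/-- The local inverse is chosen separately at each point, with no coherence required. Neighbouring
choices still agree as germs, since both invert `κ` near the same point of the surface. Everything
about iterated derivatives depends on this. -/
lemma eventually_germ (h : IsEtaleOn κ e U) (hm : m ∈ U) :
    ∀ᶠ y in 𝓝 (κ m), (e ((e m).symm y)).symm =ᶠ[𝓝 y] (e m).symm := by
  have h1 := (h.tendsto_symm hm).eventually (h.eventually_symm_apply hm).eventually_nhds
  filter_upwards [h1, h.eventually_mem hm, h.eventually_apply_symm hm] with y h1 h2 h3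
  have h4 := (h.tendsto_symm h2).eventually h1
  have h5 := h.eventually_apply_symm h2
  rw [h3] at h4 h5
  filter_upwards [h4, h5] with z h4 h5
  rw [h5] at h4
  exact h4.symm

lemma isLocalHomeomorph (h : IsEtaleOn κ e U) (hU : U = univ) : IsLocalHomeomorph κ :=
  IsLocalHomeomorph.mk κ fun x => ⟨e x, h.mem x (hU ▸ mem_univ x), h.eqOn x (hU ▸ mem_univ x)⟩

end IsEtaleOn

/-- `f` is smooth in the local coordinates `κ` at the points of `U`. -/
def EtaleSmoothOn (κ : M → E2) (e : M → OpenPartialHomeomorph M E2) (U : Set M) (f : M → F) :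
    Prop :=
  ∀ m ∈ U, ContDiffAt ℝ ∞ (f ∘ (e m).symm) (κ m)

section

variable {f g : M → F} {a b : M → ℝ} {m : M} {v w : E2}

lemma EtaleSmoothOn.differentiableAt (hf : EtaleSmoothOn κ e U f) (hm : m ∈ U) :
    DifferentiableAt ℝ (f ∘ (e m).symm) (κ m) := (hf m hm).differentiableAt (by simp)

lemma etaleSmoothOn_const (c : F) : EtaleSmoothOn κ e U fun _ => c :=
  fun _ _ => contDiffAt_const

lemma EtaleSmoothOn.add (hf : EtaleSmoothOn κ e U f) (hg : EtaleSmoothOn κ e U g) :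
    EtaleSmoothOn κ e U fun m => f m + g m := fun m hm => (hf m hm).add (hg m hm)

lemma EtaleSmoothOn.sub (hf : EtaleSmoothOn κ e U f) (hg : EtaleSmoothOn κ e U g) :
    EtaleSmoothOn κ e U fun m => f m - g m := fun m hm => (hf m hm).sub (hg m hm)

lemma EtaleSmoothOn.mul (ha : EtaleSmoothOn κ e U a) (hb : EtaleSmoothOn κ e U b) :
    EtaleSmoothOn κ e U fun m => a m * b m := fun m hm => (ha m hm).mul (hb m hm)

lemma EtaleSmoothOn.const_mul (c : ℝ) (ha : EtaleSmoothOn κ e U a) :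
    EtaleSmoothOn κ e U fun m => c * a m := (etaleSmoothOn_const c).mul ha

lemma EtaleSmoothOn.div (ha : EtaleSmoothOn κ e U a) (hb : EtaleSmoothOn κ e U b)
    (h : IsEtaleOn κ e U) (h0 : ∀ m ∈ U, b m ≠ 0) :
    EtaleSmoothOn κ e U fun m => a m / b m := fun m hm => (ha m hm).div (hb m hm) (by
      simpa [h.symm_apply hm] using h0 m hm)

lemma EtaleSmoothOn.comp {k : F → G} (hk : ContDiff ℝ ∞ k) (hf : EtaleSmoothOn κ e U f) :
    EtaleSmoothOn κ e U fun m => k (f m) := fun m hm => hk.contDiffAt.comp _ (hf m hm)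

lemma EtaleSmoothOn.continuousAt (h : IsEtaleOn κ e U) (hf : EtaleSmoothOn κ e U f)
    (hm : m ∈ U) : ContinuousAt f m := by
  have h1 : ContinuousAt ((f ∘ (e m).symm) ∘ κ) m :=
    ContinuousAt.comp (hf m hm).continuousAt (h.continuousAt hm)
  refine h1.congr ?_
  filter_upwards [h.eventually_symm_apply hm] with x hx
  simp [hx]

lemma etaleSmoothOn_of_contMDiff (h : IsEtaleOn κ e U) (hf : ContMDiff (𝓡 2) 𝓘(ℝ, F) ∞ f) :
    EtaleSmoothOn κ e U f := fun m hm => ((hf _).comp _ (h.smooth m hm)).contDiffAt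

lemma etaleSmoothOn_coord (h : IsEtaleOn κ e U) (l : E2 →L[ℝ] F) :
    EtaleSmoothOn κ e U fun m => l (κ m) := fun m hm => by
  refine l.contDiff.contDiffAt.congr_of_eventuallyEq ?_
  filter_upwards [h.eventually_apply_symm hm] with y hy
  simp [hy]

lemma dirD_coord (h : IsEtaleOn κ e U) (l : E2 →L[ℝ] F) (hm : m ∈ U) :
    dirD κ e v (fun m => l (κ m)) m = l v := by
  have : ((fun m => l (κ m)) ∘ (e m).symm) =ᶠ[𝓝 (κ m)] l := by
    filter_upwards [h.eventually_apply_symm hm] with y hy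
    simp [hy]
  rw [dirD, this.fderiv_eq, l.fderiv]

lemma dirD_congr (h : IsEtaleOn κ e U) (hm : m ∈ U) (hfg : f =ᶠ[𝓝 m] g) :
    dirD κ e v f m = dirD κ e v g m := by
  have : f ∘ (e m).symm =ᶠ[𝓝 (κ m)] g ∘ (e m).symm := (h.tendsto_symm hm).eventually hfg
  rw [dirD, dirD, this.fderiv_eq]

/-- Near `m`, the derivatives taken with varying local inverses are the ordinary derivatives of one
function on the plane. Hence `dirD` can be iterated and the usual theorems apply. -/
lemma dirD_comp_symm (h : IsEtaleOn κ e U) (f : M → F) (v : E2) (hm : m ∈ U) :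
    dirD κ e v f ∘ (e m).symm =ᶠ[𝓝 (κ m)] fun y => fderiv ℝ (f ∘ (e m).symm) y v := by
  filter_upwards [h.eventually_germ hm, h.eventually_apply_symm hm] with y h1 h2
  simp only [Function.comp_apply, dirD, h2]
  rw [(h1.fun_comp f : f ∘ (e ((e m).symm y)).symm =ᶠ[_] f ∘ (e m).symm).fderiv_eq]

lemma EtaleSmoothOn.dirD (h : IsEtaleOn κ e U) (hf : EtaleSmoothOn κ e U f) (v : E2) :
    EtaleSmoothOn κ e U (dirD κ e v f) := fun m hm =>
  (((hf m hm).fderiv_right (m := ∞) (by norm_cast)).clm_apply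
    contDiffAt_const).congr_of_eventuallyEq (dirD_comp_symm h f v hm)

lemma EtaleSmoothOn.eventually (h : IsEtaleOn κ e U) (hf : EtaleSmoothOn κ e U f) (hm : m ∈ U) :
    ∀ᶠ y in 𝓝 (κ m), ContDiffAt ℝ ∞ (f ∘ (e m).symm) y := by
  filter_upwards [h.eventually_germ hm, h.eventually_mem hm, h.eventually_apply_symm hm]
    with y h1 h2 h3
  have := hf _ h2
  rw [h3] at this
  exact this.congr_of_eventuallyEq (h1.fun_comp f).symm

lemma dirD_add_smul (f : M → F) (s t : ℝ) :
    dirD κ e (s • v + t • w) f m = s • dirD κ e v f m + t • dirD κ e w f m := by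
  simp [dirD]

lemma dirD_neg (f : M → F) : dirD κ e (-v) f m = - dirD κ e v f m := by
  simp [dirD]

lemma dirD_const (c : F) : dirD κ e v (fun _ => c) m = 0 := by
  simp [dirD, Function.comp_def]

lemma dirD_add (hf : EtaleSmoothOn κ e U f) (hg : EtaleSmoothOn κ e U g) (hm : m ∈ U) :
    dirD κ e v (fun x => f x + g x) m = dirD κ e v f m + dirD κ e v g m := by
  have := ((hf.differentiableAt hm).hasFDerivAt.add (hg.differentiableAt hm).hasFDerivAt).fderiv
  rw [dirD, show (fun x => f x + g x) ∘ (e m).symm = f ∘ (e m).symm + g ∘ (e m).symm from rfl,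
    this]
  rfl

lemma dirD_sub (hf : EtaleSmoothOn κ e U f) (hg : EtaleSmoothOn κ e U g) (hm : m ∈ U) :
    dirD κ e v (fun x => f x - g x) m = dirD κ e v f m - dirD κ e v g m := by
  have := ((hf.differentiableAt hm).hasFDerivAt.sub (hg.differentiableAt hm).hasFDerivAt).fderiv
  rw [dirD, show (fun x => f x - g x) ∘ (e m).symm = f ∘ (e m).symm - g ∘ (e m).symm from rfl,
    this]
  rfl

lemma dirD_mul (h : IsEtaleOn κ e U) (ha : EtaleSmoothOn κ e U a) (hb : EtaleSmoothOn κ e U b)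
    (hm : m ∈ U) :
    dirD κ e v (fun x => a x * b x) m = a m * dirD κ e v b m + b m * dirD κ e v a m := by
  have := ((ha.differentiableAt hm).hasFDerivAt.mul (hb.differentiableAt hm).hasFDerivAt).fderiv
  rw [dirD, show (fun x => a x * b x) ∘ (e m).symm = (a ∘ (e m).symm) * (b ∘ (e m).symm) from rfl,
    this]
  simp [h.symm_apply hm, dirD]

lemma dirD_const_mul (h : IsEtaleOn κ e U) (c : ℝ) (ha : EtaleSmoothOn κ e U a)
    (hm : m ∈ U) : dirD κ e v (fun x => c * a x) m = c * dirD κ e v a m := by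
  rw [dirD_mul h (etaleSmoothOn_const c) ha hm, dirD_const]; ring

lemma dirD_comp (h : IsEtaleOn κ e U) (ha : EtaleSmoothOn κ e U a) {k : ℝ → ℝ} {k' : ℝ}
    (hm : m ∈ U) (hk : HasDerivAt k k' (a m)) :
    dirD κ e v (fun x => k (a x)) m = k' * dirD κ e v a m := by
  have h1 : HasDerivAt k k' ((a ∘ (e m).symm) (κ m)) := by
    simpa [h.symm_apply hm] using hk
  have := (h1.comp_hasFDerivAt _ (ha.differentiableAt hm).hasFDerivAt).fderiv
  rw [dirD, show (fun x => k (a x)) ∘ (e m).symm = k ∘ (a ∘ (e m).symm) from rfl, this]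
  simp [dirD]

lemma dirD_clm (hf : EtaleSmoothOn κ e U f) (l : F →L[ℝ] G) (hm : m ∈ U) :
    dirD κ e v (fun x => l (f x)) m = l (dirD κ e v f m) := by
  have := (l.hasFDerivAt.comp _ (hf.differentiableAt hm).hasFDerivAt).fderiv
  rw [dirD, show (fun x => l (f x)) ∘ (e m).symm = l ∘ (f ∘ (e m).symm) from rfl, this]
  rfl

lemma dirD_dirD (h : IsEtaleOn κ e U) (hf : EtaleSmoothOn κ e U f) (hm : m ∈ U) (v w : E2) :
    dirD κ e v (dirD κ e w f) m = fderiv ℝ (fderiv ℝ (f ∘ (e m).symm)) (κ m) v w := by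
  have hd : DifferentiableAt ℝ (fderiv ℝ (f ∘ (e m).symm)) (κ m) :=
    ((hf m hm).fderiv_right (m := 1) (by norm_cast)).differentiableAt (by simp)
  rw [dirD, (dirD_comp_symm h f w hm).fderiv_eq, fderiv_clm_apply hd (by simp)]
  simp

lemma dirD_comm (h : IsEtaleOn κ e U) (hf : EtaleSmoothOn κ e U f) (hm : m ∈ U) (v w : E2) :
    dirD κ e v (dirD κ e w f) m = dirD κ e w (dirD κ e v f) m := by
  have h2 : minSmoothness ℝ 2 ≤ (∞ : WithTop ℕ∞) := by
    rw [minSmoothness_of_isRCLikeNormedField]; exact WithTop.coe_le_coe.2 le_top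
  rw [dirD_dirD h hf hm, dirD_dirD h hf hm]
  exact ((hf m hm).isSymmSndFDerivAt h2).eq v w

lemma eventually_eq_of_dirD_eq_zero (h : IsEtaleOn κ e U) (hf : EtaleSmoothOn κ e U f)
    (hm : m ∈ U) (h0 : ∀ᶠ x in 𝓝 m, ∀ v, dirD κ e v f x = 0) : ∀ᶠ x in 𝓝 m, f x = f m := by
  have h1 := (h.tendsto_symm hm).eventually h0
  have h2 : ∀ᶠ y in 𝓝 (κ m), ∀ v, dirD κ e v f ((e m).symm y) =
      fderiv ℝ (f ∘ (e m).symm) y v := by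
    filter_upwards [h.eventually_germ hm, h.eventually_apply_symm hm] with y h1 h2 v
    simp only [dirD, h2]
    rw [(h1.fun_comp f : f ∘ (e ((e m).symm y)).symm =ᶠ[_] f ∘ (e m).symm).fderiv_eq]
  obtain ⟨r, hr, hB⟩ := Metric.eventually_nhds_iff_ball.1 ((h1.and h2).and (hf.eventually h hm))
  have h3 : ∀ y ∈ Metric.ball (κ m) r, (f ∘ (e m).symm) y = (f ∘ (e m).symm) (κ m) := by
    intro y hy
    refine (convex_ball (κ m) r).is_const_of_fderivWithin_eq_zero (𝕜 := ℝ)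
      (fun z hz => ((hB z hz).2.differentiableAt (by simp)).differentiableWithinAt) ?_ hy
      (Metric.mem_ball_self hr)
    intro z hz
    rw [fderivWithin_of_isOpen Metric.isOpen_ball hz]
    ext v
    rw [← (hB z hz).1.2 v, (hB z hz).1.1 v]; rfl
  filter_upwards [h.eventually_symm_apply hm,
    (h.continuousAt hm).eventually (Metric.ball_mem_nhds _ hr)] with x hx1 hx2
  have := h3 _ hx2
  simpa [hx1, h.symm_apply hm] using this

lemma eq_of_dirD_eq_zero [PreconnectedSpace M] (h : IsEtaleOn κ e univ)
    (hf : EtaleSmoothOn κ e univ f) (h0 : ∀ m v, dirD κ e v f m = 0) (x y : M) : f x = f y := by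
  have : IsLocallyConstant f := (IsLocallyConstant.iff_eventually_eq f).2 fun m =>
    eventually_eq_of_dirD_eq_zero h hf (mem_univ m) (Eventually.of_forall fun x => h0 x)
  exact this.apply_eq_of_preconnectedSpace x y

lemma eventually_lift_eq (h : IsEtaleOn κ e U) {γ : ℝ → M} {s : Set ℝ} {t : ℝ} {o : E2}
    (hm : γ t ∈ U) (hγ : ContinuousWithinAt γ s t) (hl : ∀ τ ∈ s, κ (γ τ) = o + τ • v) :
    ∀ᶠ τ in 𝓝[s] t, γ τ = (e (γ t)).symm (o + τ • v) := by
  filter_upwards [hγ.eventually (h.eventually_symm_apply hm), self_mem_nhdsWithin] with τ h1 h2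
  rw [← hl τ h2, h1]

/-- On the curve, `γ` is locally the straight line `o + τ • v` pulled back by one local inverse, so
this is the chain rule. A one-sided version is needed because lifts are continuous on closed
intervals only. -/
lemma hasDerivWithinAt_lift (h : IsEtaleOn κ e U) (hf : EtaleSmoothOn κ e U f) {γ : ℝ → M}
    {s : Set ℝ} {t : ℝ} {o : E2} (ht : t ∈ s) (hm : γ t ∈ U) (hγ : ContinuousWithinAt γ s t)
    (hl : ∀ τ ∈ s, κ (γ τ) = o + τ • v) :
    HasDerivWithinAt (f ∘ γ) (dirD κ e v f (γ t)) s t := by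
  have h1 : HasDerivAt (fun τ : ℝ => o + τ • v) v t := by
    simpa using ((hasDerivAt_id t).smul_const v).const_add o
  have h2 : HasFDerivAt (f ∘ (e (γ t)).symm) (fderiv ℝ (f ∘ (e (γ t)).symm) (κ (γ t)))
    (o + t • v) := by
    rw [← hl t ht]; exact (hf.differentiableAt hm).hasFDerivAt
  have h3 := (h2.comp_hasDerivAt t h1).hasDerivWithinAt (s := s)
  refine h3.congr_of_eventuallyEq ?_ ?_
  · filter_upwards [eventually_lift_eq h hm hγ hl] with τ hτ
    simp [hτ]
  · have := h.symm_apply hm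
    rw [hl t ht] at this
    simp [this]

end

/-- This passes from the preferred chart, in which flatness and minimality are stated, to the
coordinates `κ`, in which all computations are made. -/
lemma dMap_eq_dirD [IsManifold (𝓡 2) ∞ M] {ψ : M → E3} (hψ : ContMDiff (𝓡 2) 𝓘(ℝ, E3) ∞ ψ)
    (L : E3 →L[ℝ] E2) (h : IsEtaleOn (fun m => L (ψ m)) e U) {m : M} (hm : m ∈ U) (v : E2) :
    dMap ψ m v = dirD (fun m => L (ψ m)) e (L (dMap ψ m v)) ψ m := by
  have hF := (contDiffAt_localParam hψ m).differentiableAt (by simp)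
  have hΓ := (etaleSmoothOn_of_contMDiff h hψ).differentiableAt hm
  have hp : localParam ψ m (chartAt E2 m m) = ψ m := by simp [localParam]
  have h1 : HasFDerivAt (fun y => L (localParam ψ m y)) (L.comp (dMap ψ m)) (chartAt E2 m m) :=
    L.hasFDerivAt.comp _ hF.hasFDerivAt
  have h2 : HasFDerivAt (ψ ∘ (e m).symm) (fderiv ℝ (ψ ∘ (e m).symm) (L (ψ m)))
      (L (localParam ψ m (chartAt E2 m m))) := by
    rw [hp]; exact hΓ.hasFDerivAt
  have h3 := HasFDerivAt.comp (chartAt E2 m m) h2 h1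
  have h4 : localParam ψ m =ᶠ[𝓝 (chartAt E2 m m)]
      (ψ ∘ (e m).symm) ∘ fun y => L (localParam ψ m y) := by
    have hc : Tendsto (chartAt E2 m).symm (𝓝 (chartAt E2 m m)) (𝓝 m) := by
      have := (chartAt E2 m).continuousAt_symm (mem_chart_target E2 m)
      rwa [ContinuousAt, (chartAt E2 m).left_inv (mem_chart_source E2 m)] at this
    filter_upwards [hc.eventually (h.eventually_symm_apply hm)] with y hy
    simp only [Function.comp_apply, localParam, hy]
  have h5 := (h3.congr_of_eventuallyEq h4).unique hF.hasFDerivAt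
  exact congrArg (fun T : E2 →L[ℝ] E3 => T v) h5.symm

end Calculus

/-! ### Flatness and minimality as equations for a graph -/

section Pde

/-- The standard basis vectors of the plane. -/
def ε (i : Fin 2) : E2 := EuclideanSpace.single i 1

lemma eq_sum_ε (v : E2) : v = v 0 • ε 0 + v 1 • ε 1 := by
  ext i; fin_cases i <;> simp [ε]

/-- The first two coordinates with respect to an orthonormal basis of three-space. -/
def frameProj (B : OrthonormalBasis (Fin 3) ℝ E3) : E3 →L[ℝ] E2 :=
  LinearMap.toContinuousLinearMap
    { toFun := fun v => !₂[inner ℝ (B 0) v, inner ℝ (B 1) v]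
      map_add' := fun v w => by ext i; fin_cases i <;> simp [inner_add_right]
      map_smul' := fun c v => by ext i; fin_cases i <;> simp [inner_smul_right] }

lemma frameProj_zero (B : OrthonormalBasis (Fin 3) ℝ E3) (v : E3) :
    frameProj B v 0 = inner ℝ (B 0) v := rfl

lemma frameProj_one (B : OrthonormalBasis (Fin 3) ℝ E3) (v : E3) :
    frameProj B v 1 = inner ℝ (B 1) v := rfl

lemma inner_eq_frame (B : OrthonormalBasis (Fin 3) ℝ E3) (v w : E3) :
    inner ℝ v w = inner ℝ (B 0) v * inner ℝ (B 0) w + inner ℝ (B 1) v * inner ℝ (B 1) w +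
      inner ℝ (B 2) v * inner ℝ (B 2) w := by
  rw [← B.sum_inner_mul_inner v w, Fin.sum_univ_three, real_inner_comm v, real_inner_comm v,
    real_inner_comm v]

lemma frame_inner (B : OrthonormalBasis (Fin 3) ℝ E3) (i j : Fin 3) :
    inner ℝ (B i) (B j) = if i = j then (1 : ℝ) else 0 := orthonormal_iff_ite.1 B.orthonormal i j

lemma eq_of_frame_inner (B : OrthonormalBasis (Fin 3) ℝ E3) {v w : E3}
    (h0 : inner ℝ (B 0) v = inner ℝ (B 0) w) (h1 : inner ℝ (B 1) v = inner ℝ (B 1) w)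
    (h2 : inner ℝ (B 2) v = inner ℝ (B 2) w) : v = w := by
  apply B.repr.injective
  ext i
  rw [B.repr_apply_apply, B.repr_apply_apply]
  fin_cases i <;> assumption

variable {M : Type*} [TopologicalSpace M] [ChartedSpace E2 M]
  {e : M → OpenPartialHomeomorph M E2} {U : Set M} {ψ : M → E3}

lemma dirD_eq_sum {F : Type*} [NormedAddCommGroup F] [NormedSpace ℝ F]
    (κ : M → E2) (e : M → OpenPartialHomeomorph M E2) (v : E2) (f : M → F) (m : M) :
    dirD κ e v f m = v 0 • dirD κ e (ε 0) f m + v 1 • dirD κ e (ε 1) f m := by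
  conv_lhs => rw [eq_sum_ε v]
  exact dirD_add_smul f _ _

lemma normalPart_eq {p : M} {n : E3} (hn : (tangentPlane ψ p)ᗮ = Submodule.span ℝ {n}) (w : E3) :
    normalPart ψ p w = (inner ℝ n w / ‖n‖ ^ 2) • n := by
  rw [normalPart]
  have : (tangentPlane ψ p)ᗮ.starProjection w = (Submodule.span ℝ {n}).starProjection w := by
    congr!
  rw [this, Submodule.starProjection_singleton]
  simp

variable [IsManifold (𝓡 2) ∞ M]

/-- Only the shape of the last term matters: `fderiv ℝ Γ (k y) v` is tangent to the surface, so the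
normal projection will remove it and `v` can stay unspecified. -/
lemma exists_fderiv_fderiv_comp {F Γ : E2 → E3} {k : E2 → E2} {y : E2}
    (hΓ : ContDiffAt ℝ 2 Γ (k y)) (hk : ContDiffAt ℝ 2 k y) (hF : F =ᶠ[𝓝 y] Γ ∘ k) (a b : E2) :
    ∃ v : E2, fderiv ℝ (fun x => fderiv ℝ F x b) y a =
      fderiv ℝ (fderiv ℝ Γ) (k y) (fderiv ℝ k y a) (fderiv ℝ k y b) + fderiv ℝ Γ (k y) v := by
  have hΓe : ∀ᶠ x in 𝓝 y, ContDiffAt ℝ 2 Γ (k x) :=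
    hk.continuousAt.eventually (hΓ.eventually (by simp))
  have hke : ∀ᶠ x in 𝓝 y, ContDiffAt ℝ 2 k x := hk.eventually (by simp)
  have h5 : (fun x => fderiv ℝ F x b) =ᶠ[𝓝 y] fun x => fderiv ℝ Γ (k x) (fderiv ℝ k x b) := by
    filter_upwards [hF.eventuallyEq_nhds, hΓe, hke] with x h1 h2 h3
    rw [h1.fderiv_eq, fderiv_comp _ (h2.differentiableAt (by simp)) (h3.differentiableAt (by simp))]
    rfl
  have hΓ2 : HasFDerivAt (fderiv ℝ Γ) (fderiv ℝ (fderiv ℝ Γ) (k y)) (k y) :=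
    ((hΓ.fderiv_right (m := 1) (by norm_cast)).differentiableAt (by simp)).hasFDerivAt
  have hk2 : HasFDerivAt (fderiv ℝ k) (fderiv ℝ (fderiv ℝ k) y) y :=
    ((hk.fderiv_right (m := 1) (by norm_cast)).differentiableAt (by simp)).hasFDerivAt
  have hk1 : HasFDerivAt k (fderiv ℝ k y) y := (hk.differentiableAt (by simp)).hasFDerivAt
  have h6 := (hΓ2.comp y hk1).clm_apply (hk2.clm_apply (hasFDerivAt_const b y))
  refine ⟨fderiv ℝ (fderiv ℝ k) y a b, ?_⟩
  rw [h5.fderiv_eq]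
  refine Eq.trans (congrArg (fun T : E2 →L[ℝ] E3 => T a) h6.fderiv) ?_
  simp [add_comm]

lemma secondDeriv_eq (hψ : ContMDiff (𝓡 2) 𝓘(ℝ, E3) ∞ ψ) (L : E3 →L[ℝ] E2)
    (h : IsEtaleOn (fun m => L (ψ m)) e U) {p : M} (hp : p ∈ U) (i j : Fin 2) :
    ∃ v : E2, secondDeriv ψ p i j =
      dirD (fun m => L (ψ m)) e (L (dMap ψ p (ε i)))
        (dirD (fun m => L (ψ m)) e (L (dMap ψ p (ε j))) ψ) p +
      dirD (fun m => L (ψ m)) e v ψ p := by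
  have hs := etaleSmoothOn_of_contMDiff h hψ
  have hF := contDiffAt_localParam hψ p
  have hky : L (localParam ψ p (chartAt E2 p p)) = L (ψ p) := by simp [localParam]
  have hkc : ContDiffAt ℝ ∞ (fun y => L (localParam ψ p y)) (chartAt E2 p p) :=
    L.contDiff.contDiffAt.comp _ hF
  have hkd : fderiv ℝ (fun y => L (localParam ψ p y)) (chartAt E2 p p) = L.comp (dMap ψ p) :=
    (L.hasFDerivAt.comp _ (hF.differentiableAt (by simp)).hasFDerivAt).fderiv
  have hc : Tendsto (chartAt E2 p).symm (𝓝 (chartAt E2 p p)) (𝓝 p) := by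
    have := (chartAt E2 p).continuousAt_symm (mem_chart_target E2 p)
    rwa [ContinuousAt, (chartAt E2 p).left_inv (mem_chart_source E2 p)] at this
  have h4 : localParam ψ p =ᶠ[𝓝 (chartAt E2 p p)]
      (ψ ∘ (e p).symm) ∘ fun y => L (localParam ψ p y) := by
    filter_upwards [hc.eventually (h.eventually_symm_apply hp)] with y hy
    simp only [Function.comp_apply, localParam, hy]
  have hΓ : ContDiffAt ℝ 2 (ψ ∘ (e p).symm) (L (localParam ψ p (chartAt E2 p p))) := by
    rw [hky]; exact (hs p hp).of_le (by norm_cast)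
  obtain ⟨v, hv⟩ := exists_fderiv_fderiv_comp hΓ (hkc.of_le (by norm_cast)) h4 (ε i) (ε j)
  refine ⟨v, ?_⟩
  rw [dirD_dirD h hs hp]
  rw [hkd, hky] at hv
  exact hv

/-- Over the plane of `B 0` and `B 1` the surface is the graph of `W`, with normal `B 2 - w₁ B 0 -
w₂ B 1`. The two conclusions are `K = 0` and the prescribed mean curvature equation for a graph. The
frame is arbitrary because it is used both with a horizontal base plane and with a vertical one. -/
lemma phiMinimal_pde (hψ : ContMDiff (𝓡 2) 𝓘(ℝ, E3) ∞ ψ) {φ : ℝ → ℝ} (hflat : IsFlat ψ)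
    (hmin : IsPhiMinimal φ ψ) (B : OrthonormalBasis (Fin 3) ℝ E3) {κ : M → E2}
    (hκ : κ = fun m => frameProj B (ψ m))
    (h : IsEtaleOn κ e U) {p : M} (hp : p ∈ U) (hinj : ∀ v, frameProj B (dMap ψ p v) = 0 → v = 0)
    {W : M → ℝ} (hW : W = fun m => inner ℝ (B 2) (ψ m)) {w₁ w₂ r s t : ℝ}
    (hw₁ : dirD κ e (ε 0) W p = w₁) (hw₂ : dirD κ e (ε 1) W p = w₂)
    (hr : dirD κ e (ε 0) (dirD κ e (ε 0) W) p = r)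
    (hs : dirD κ e (ε 0) (dirD κ e (ε 1) W) p = s)
    (ht : dirD κ e (ε 1) (dirD κ e (ε 1) W) p = t) :
    r * t = s ^ 2 ∧
      (1 + w₂ ^ 2) * r - 2 * w₁ * w₂ * s + (1 + w₁ ^ 2) * t =
        deriv φ (ψ p 2) * (B 2 2 - w₁ * B 0 2 - w₂ * B 1 2) * (1 + w₁ ^ 2 + w₂ ^ 2) := by
  have hsm : EtaleSmoothOn κ e U ψ := etaleSmoothOn_of_contMDiff h hψ
  have hWs : EtaleSmoothOn κ e U W := by
    rw [hW]; exact EtaleSmoothOn.comp (innerSL ℝ (B 2)).contDiff hsm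
  -- components of first and second derivatives
  have hcomp : ∀ (i : Fin 3) (v : E2), inner ℝ (B i) (dirD κ e v ψ p) =
      dirD κ e v (fun m => inner ℝ (B i) (ψ m)) p :=
    fun i v => (dirD_clm hsm (innerSL ℝ (B i)) hp).symm
  have hcomp2 : ∀ (i : Fin 3) (v w : E2), inner ℝ (B i) (dirD κ e v (dirD κ e w ψ) p) =
      dirD κ e v (dirD κ e w (fun m => inner ℝ (B i) (ψ m))) p := by
    intro i v w
    have h1 := (dirD_clm (v := v) (hsm.dirD h w) (innerSL ℝ (B i)) hp).symm
    refine Eq.trans h1 (dirD_congr h hp ?_)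
    filter_upwards [h.isOpen.mem_nhds hp] with x hx
    exact (dirD_clm hsm (innerSL ℝ (B i)) hx).symm
  have hx0 : (fun m => inner ℝ (B 0) (ψ m)) = fun m => EuclideanSpace.proj (𝕜 := ℝ) 0 (κ m) := by
    rw [hκ]; rfl
  have hx1 : (fun m => inner ℝ (B 1) (ψ m)) = fun m => EuclideanSpace.proj (𝕜 := ℝ) 1 (κ m) := by
    rw [hκ]; rfl
  have c0 : ∀ v, inner ℝ (B 0) (dirD κ e v ψ p) = v 0 := fun v => by
    rw [hcomp, hx0, dirD_coord h _ hp]; rfl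
  have c1 : ∀ v, inner ℝ (B 1) (dirD κ e v ψ p) = v 1 := fun v => by
    rw [hcomp, hx1, dirD_coord h _ hp]; rfl
  have c2 : ∀ v, inner ℝ (B 2) (dirD κ e v ψ p) = v 0 * w₁ + v 1 * w₂ := fun v => by
    rw [hcomp, ← hW, dirD_eq_sum, hw₁, hw₂]; simp
  have d0 : ∀ (l : E2 →L[ℝ] ℝ) (v w : E2),
      dirD κ e v (dirD κ e w (fun m => l (κ m))) p = 0 := fun l v w => by
    rw [dirD_congr (g := fun _ => l w) h hp, dirD_const]
    filter_upwards [h.isOpen.mem_nhds hp] with x hx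
    exact dirD_coord h _ hx
  have d2 : ∀ v w, inner ℝ (B 2) (dirD κ e v (dirD κ e w ψ) p) =
      v 0 * w 0 * r + (v 0 * w 1 + v 1 * w 0) * s + v 1 * w 1 * t := by
    intro v w
    rw [hcomp2, ← hW]
    have e1 : dirD κ e w W = fun x => w 0 * dirD κ e (ε 0) W x + w 1 * dirD κ e (ε 1) W x := by
      funext x; exact dirD_eq_sum _ _ _ _ _
    have s0 := hWs.dirD h (ε 0)
    have s1 := hWs.dirD h (ε 1)
    rw [e1, dirD_add (s0.const_mul _) (s1.const_mul _) hp, dirD_const_mul h _ s0 hp,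
      dirD_const_mul h _ s1 hp, dirD_eq_sum κ e v, dirD_eq_sum κ e v (dirD κ e (ε 1) W), hr, hs, ht,
      dirD_comm h hWs hp (ε 1) (ε 0), hs]
    simp only [smul_eq_mul]; ring
  -- the normal
  set n : E3 := B 2 - w₁ • B 0 - w₂ • B 1 with hn
  have nin : ∀ v, inner ℝ n v = inner ℝ (B 2) v - w₁ * inner ℝ (B 0) v - w₂ * inner ℝ (B 1) v := by
    intro v; simp [hn, inner_sub_left, inner_smul_left]
  have hnn : ‖n‖ ^ 2 = 1 + w₁ ^ 2 + w₂ ^ 2 := by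
    rw [← real_inner_self_eq_norm_sq, nin]
    simp only [hn, inner_sub_right, inner_smul_right, frame_inner]
    simp; ring
  set Q := 1 + w₁ ^ 2 + w₂ ^ 2 with hQ
  have hQ0 : 0 < Q := by positivity
  -- the coordinate change
  set k : Fin 2 → E2 := fun i => frameProj B (dMap ψ p (ε i)) with hk
  have hF : ∀ i, tangentVec ψ p i = dirD κ e (k i) ψ p := by
    intro i
    subst hκ
    exact dMap_eq_dirD hψ (frameProj B) h hp (ε i)
  -- `k` is the matrix of the change from the preferred chart to `κ`. If its determinant vanished,
  -- the combinations of `ε 0` and `ε 1` read off from its entries would lie in the kernel of the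
  -- projected differential, which is trivial.
  have hdet : k 0 0 * k 1 1 - k 0 1 * k 1 0 ≠ 0 := by
    intro h0
    by_cases hz : k 1 = 0
    · have := congrArg (fun v : E2 => v 1) (hinj _ hz)
      simp [ε] at this
    have e0 : frameProj B (dMap ψ p (k 1 1 • ε 0 - k 0 1 • ε 1)) = 0 := by
      rw [map_sub, map_sub, map_smul, map_smul, map_smul, map_smul]
      ext i; fin_cases i
      · change k 1 1 * k 0 0 - k 0 1 * k 1 0 = 0; linarith
      · change k 1 1 * k 0 1 - k 0 1 * k 1 1 = 0; ring
    have e1 : frameProj B (dMap ψ p (k 1 0 • ε 0 - k 0 0 • ε 1)) = 0 := by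
      rw [map_sub, map_sub, map_smul, map_smul, map_smul, map_smul]
      ext i; fin_cases i
      · change k 1 0 * k 0 0 - k 0 0 * k 1 0 = 0; ring
      · change k 1 0 * k 0 1 - k 0 0 * k 1 1 = 0; linarith
    have f0 := congrArg (fun v : E2 => v 0) (hinj _ e0)
    have f1 := congrArg (fun v : E2 => v 0) (hinj _ e1)
    simp [ε] at f0 f1
    apply hz
    ext i; fin_cases i
    · exact f1
    · exact f0
  have hperp : (tangentPlane ψ p)ᗮ = Submodule.span ℝ {n} := by
    apply le_antisymm
    · intro v hv
      have hv' : ∀ i, inner ℝ (tangentVec ψ p i) v = 0 := fun i =>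
        (Submodule.mem_orthogonal _ _).1 hv _ (Submodule.subset_span ⟨i, rfl⟩)
      have v0 := hv' 0
      have v1 := hv' 1
      rw [hF, inner_eq_frame B, c0, c1, c2] at v0 v1
      set α := inner ℝ (B 0) v
      set β := inner ℝ (B 1) v
      set γ := inner ℝ (B 2) v
      have g0 : α + w₁ * γ = 0 := by
        have : (k 0 0 * k 1 1 - k 0 1 * k 1 0) * (α + w₁ * γ) = 0 := by
          linear_combination k 1 1 * v0 - k 0 1 * v1
        exact (mul_eq_zero.1 this).resolve_left hdet
      have g1 : β + w₂ * γ = 0 := by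
        have : (k 0 0 * k 1 1 - k 0 1 * k 1 0) * (β + w₂ * γ) = 0 := by
          linear_combination k 0 0 * v1 - k 1 0 * v0
        exact (mul_eq_zero.1 this).resolve_left hdet
      rw [Submodule.mem_span_singleton]
      refine ⟨γ, eq_of_frame_inner B ?_ ?_ ?_⟩ <;>
      · simp only [hn, inner_sub_right, inner_smul_right, frame_inner]
        simp
        linarith
    · rw [Submodule.span_singleton_le_iff_mem, Submodule.mem_orthogonal]
      intro u hu
      induction hu using Submodule.span_induction with
      | mem x hx =>
        obtain ⟨i, rfl⟩ := hx
        rw [real_inner_comm, nin, hF, c0, c1, c2]; ring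
      | zero => simp
      | add x y _ _ hx hy => rw [inner_add_left, hx, hy, add_zero]
      | smul a x _ hx => rw [inner_smul_left, hx, mul_zero]
  have hII : ∀ i j, secondForm ψ p i j =
      ((k i 0 * k j 0 * r + (k i 0 * k j 1 + k i 1 * k j 0) * s + k i 1 * k j 1 * t) / Q) • n := by
    intro i j
    obtain ⟨v, hv⟩ : ∃ v : E2, secondDeriv ψ p i j =
        dirD κ e (k i) (dirD κ e (k j) ψ) p + dirD κ e v ψ p := by
      subst hκ
      exact secondDeriv_eq hψ (frameProj B) h hp i j
    -- The unspecified tangential vector drops out here, since `n` is orthogonal to every first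
    -- derivative of `ψ`.
    rw [secondForm, normalPart_eq hperp, hnn, hv, inner_add_right, nin, nin, c0, c1, c2, d2, hcomp2,
      hcomp2, hx0, hx1, d0, d0]
    congr 2; ring
  have hg : ∀ i j, firstForm ψ p i j = k i 0 * k j 0 + k i 1 * k j 1 +
      (k i 0 * w₁ + k i 1 * w₂) * (k j 0 * w₁ + k j 1 * w₂) := by
    intro i j
    rw [firstForm, hF, hF, inner_eq_frame B]
    simp only [c0, c1, c2]
  set D := k 0 0 * k 1 1 - k 0 1 * k 1 0 with hD
  have hgd : firstFormDet ψ p = D ^ 2 * Q := by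
    rw [firstFormDet, hg, hg, hg, hD, hQ]; ring
  have hn0 : n ≠ 0 := by
    intro h0; rw [h0] at hnn; simp at hnn; linarith
  constructor
  · have hK := hflat p
    rw [gaussCurvature, hgd, hII, hII, hII, norm_smul, mul_pow, hnn, inner_smul_left,
      inner_smul_right, real_inner_self_eq_norm_sq, hnn, div_eq_zero_iff] at hK
    have hK := hK.resolve_right (by positivity)
    simp only [Real.norm_eq_abs, sq_abs, conj_trivial] at hK
    have : D ^ 2 * (r * t - s ^ 2) = 0 := by
      field_simp at hK
      rw [hD]; linear_combination hK
    have := (mul_eq_zero.1 this).resolve_left (by positivity)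
    linarith
  · have hH := hmin p
    rw [meanCurvatureVector, hgd, hg, hg, hg, hII, hII, hII, normalPart_eq hperp, hnn, smul_smul,
      smul_smul, smul_smul, smul_smul, ← sub_smul, ← add_smul, smul_smul] at hH
    have hH := smul_left_injective ℝ hn0 hH
    have he : inner ℝ n e₃ = B 2 2 - w₁ * B 0 2 - w₂ * B 1 2 := by
      rw [nin]; simp [e₃, PiLp.inner_apply, Fin.sum_univ_three]
    rw [he] at hH
    set P := B 2 2 - w₁ * B 0 2 - w₂ * B 1 2
    generalize k 0 0 = a₀ at *
    generalize k 0 1 = a₁ at *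
    generalize k 1 0 = b₀ at *
    generalize k 1 1 = b₁ at *
    -- The trace does not depend on the chart, so the squared determinant `D ^ 2` of the coordinate
    -- change factors out and cancels.
    have hX : (D ^ 2 * Q)⁻¹ * (D ^ 2 * (((1 + w₂ ^ 2) * r - 2 * w₁ * w₂ * s +
        (1 + w₁ ^ 2) * t) / Q)) = deriv φ (ψ p 2) * (P / Q) := by
      rw [← hH, hD]; ring
    field_simp at hX
    linarith

end Pde

/-! ### Intrinsic distance and lifts of segments -/

section Complete

variable {M : Type*} [TopologicalSpace M] [ChartedSpace E2 M]
  {κ : M → E2} {e : M → OpenPartialHomeomorph M E2} {U : Set M} {ψ : M → E3}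

open Manifold in
lemma edist_le_lintegral_mfderiv {c : ℝ → E3} {a b : ℝ} (hab : a ≤ b)
    (hc : ContMDiffOn 𝓘(ℝ, ℝ) 𝓘(ℝ, E3) 1 c (Icc a b)) :
    edist (c a) (c b) ≤
      ∫⁻ t in Ioo a b, enorm (E := E3) (mfderiv 𝓘(ℝ, ℝ) 𝓘(ℝ, E3) c t (1 : ℝ)) := by
  rw [edist_comm, edist_eq_enorm_sub]
  refine (enorm_sub_le_lintegral_derivWithin_Icc_of_contDiffOn_Icc
    (contMDiffOn_iff_contDiffOn.1 hc) hab).trans (le_of_eq ?_)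
  rw [← MeasureTheory.restrict_Ioo_eq_restrict_Icc]
  refine MeasureTheory.setLIntegral_congr_fun measurableSet_Ioo fun t ht => ?_
  simp only [mfderiv_eq_fderiv, derivWithin_of_mem_nhds (Icc_mem_nhds ht.1 ht.2)]
  rfl

/-- The norm of the induced metric is homogeneous. -/
lemma enormSMulClass_inducedENorm (ψ : M → E3) (p : M) :
    letI := inducedENorm ψ p
    ENormSMulClass ℝ (TangentSpace (𝓡 2) p) := by
  let _ := inducedENorm ψ p
  refine ⟨fun c v => ?_⟩
  change enorm (E := E3) (mfderiv (𝓡 2) 𝓘(ℝ, E3) ψ p (c • v)) =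
    _ * enorm (E := E3) (mfderiv (𝓡 2) 𝓘(ℝ, E3) ψ p v)
  rw [map_smul]
  exact enorm_smul (β := E3) c _

variable [IsManifold (𝓡 2) ∞ M]

open Manifold in
-- A path of length less than `r` has an image in space of the same length, so the image of each of
-- its points stays within `r` of the image of the start.
lemma exists_path_of_intrinsicEDist_lt (hψ : ContMDiff (𝓡 2) 𝓘(ℝ, E3) ∞ ψ) {p q : M} {r : ℝ≥0∞}
    (h : intrinsicEDist ψ p q < r) :
    ∃ γ : ℝ → M, γ 0 = p ∧ γ 1 = q ∧ ContinuousOn γ (Icc 0 1) ∧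
      ∀ t ∈ Icc (0 : ℝ) 1, edist (ψ p) (ψ (γ t)) < r := by
  let _ : ∀ x : M, ENorm (TangentSpace (𝓡 2) x) := inducedENorm ψ
  obtain ⟨γ, h0, h1, hγ, hl⟩ := exists_lt_of_riemannianEDist_lt (I := 𝓡 2) h
  refine ⟨γ, h0, h1, hγ.continuousOn, fun t ht => ?_⟩
  have hsub : Icc 0 t ⊆ Icc (0 : ℝ) 1 := Icc_subset_Icc_right ht.2
  have hc : ContMDiffOn 𝓘(ℝ, ℝ) 𝓘(ℝ, E3) 1 (ψ ∘ γ) (Icc 0 t) :=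
    (hψ.of_le (by norm_cast)).comp_contMDiffOn (hγ.mono hsub)
  refine lt_of_le_of_lt ?_ hl
  refine le_trans ?_ (pathELength_mono (I := 𝓡 2) (γ := γ) le_rfl ht.2)
  have h2 := edist_le_lintegral_mfderiv ht.1 hc
  rw [Function.comp_apply, h0] at h2
  refine h2.trans (le_of_eq ?_)
  rw [pathELength_eq_lintegral_mfderiv_Ioo]
  refine MeasureTheory.setLIntegral_congr_fun measurableSet_Ioo fun τ hτ => ?_
  have hd : MDifferentiableAt 𝓘(ℝ, ℝ) (𝓡 2) γ τ :=
    ((hγ.mono hsub).contMDiffAt (Icc_mem_nhds hτ.1 hτ.2)).mdifferentiableAt (by simp)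
  have hd2 : MDifferentiableAt (𝓡 2) 𝓘(ℝ, E3) ψ (γ τ) := (hψ _).mdifferentiableAt (by simp)
  change enorm (E := E3) _ = enorm (E := E3) _
  rw [mfderiv_comp τ hd2 hd]
  rfl

lemma intrinsicEDist_comm (p q : M) : intrinsicEDist ψ p q = intrinsicEDist ψ q p := by
  let _ : ∀ x : M, ENorm (TangentSpace (𝓡 2) x) := inducedENorm ψ
  have := enormSMulClass_inducedENorm ψ
  have : IsManifold (𝓡 2) 1 M := .of_le (n := ∞) (by norm_cast)
  exact Manifold.riemannianEDist_comm (I := 𝓡 2)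

/-- Completeness provides limits in the intrinsic distance, whereas lifting needs limits in the
topology of `M`. A short path from `p` projects into a small disc because `L` does not increase
norms. Connectedness then keeps the path in the sheet over that disc that contains `p`. -/
lemma tendsto_of_tendsto_intrinsicEDist [T2Space M] (hψ : ContMDiff (𝓡 2) 𝓘(ℝ, E3) ∞ ψ)
    {L : E3 →L[ℝ] E2} (hL : ∀ v, ‖L v‖ ≤ ‖v‖) (h : IsEtaleOn (fun m => L (ψ m)) e U) {p : M}
    (hp : p ∈ U) {s : ℕ → M} (hs : Tendsto (fun n => intrinsicEDist ψ (s n) p) atTop (𝓝 0)) :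
    Tendsto s atTop (𝓝 p) := by
  rw [tendsto_nhds]
  intro V hV hpV
  have hV' := (h.tendsto_symm hp).eventually (hV.mem_nhds hpV)
  have hT := (e p).open_target.mem_nhds (h.mem_target hp)
  obtain ⟨r, hr, hB⟩ := Metric.eventually_nhds_iff_ball.1 (hV'.and hT)
  have hr2 : 0 < r / 2 := by positivity
  filter_upwards [hs.eventually_lt_const (ENNReal.ofReal_pos.2 hr2)] with n hn
  rw [intrinsicEDist_comm] at hn
  obtain ⟨γ, h0, h1, hγ, hd⟩ := exists_path_of_intrinsicEDist_lt hψ hn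
  set N := (e p).symm '' Metric.ball (L (ψ p)) (r / 2)
  set K := (e p).symm '' Metric.closedBall (L (ψ p)) (r / 2)
  have hbt : Metric.closedBall (L (ψ p)) (r / 2) ⊆ (e p).target := fun y hy =>
    (hB y (Metric.closedBall_subset_ball (by linarith) hy)).2
  have hK : IsClosed K := ((isCompact_closedBall _ _).image_of_continuousOn
    ((e p).continuousOn_symm.mono hbt)).isClosed
  have hN : IsOpen N := (e p).symm.isOpen_image_of_subset_source Metric.isOpen_ball
    (Metric.ball_subset_closedBall.trans hbt)
  have hNK : N ⊆ K := image_mono Metric.ball_subset_closedBall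
  -- `N` and `K` are the sheets over the open and the closed disc. The path meets `K` only in `N`,
  -- so it cannot leave `N`. Compactness of `K` and the Hausdorff property make `K` closed.
  have hsub : γ '' Icc 0 1 ⊆ N := by
    refine (isPreconnected_Icc.image γ hγ).subset_of_closure_inter_subset hN ?_ ?_
    · refine ⟨p, ⟨0, by simp, h0⟩, L (ψ p), Metric.mem_ball_self hr2, h.symm_apply hp⟩
    · rintro x ⟨hx, t, ht, rfl⟩
      obtain ⟨y, hy, hyx⟩ := closure_minimal hNK hK hx
      refine ⟨y, ?_, hyx⟩
      have hy2 : L (ψ (γ t)) = y := by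
        have := h.eqOn p hp ((e p).map_target (hbt hy))
        rw [(e p).right_inv (hbt hy), hyx] at this
        exact this
      have h3 := hd t ht
      rw [edist_dist, ENNReal.ofReal_lt_ofReal_iff hr2] at h3
      rw [Metric.mem_ball, ← hy2, dist_eq_norm, ← map_sub]
      refine (hL _).trans_lt ?_
      rwa [← dist_eq_norm, dist_comm]
  obtain ⟨y, hy, hyx⟩ := hsub ⟨1, by simp, h1⟩
  rw [mem_preimage, ← hyx]
  exact (hB y (Metric.ball_subset_ball (by linarith) hy)).1

/-- `γ` is a lift of the segment `τ ↦ κ m + τ v`, `0 ≤ τ ≤ T`, starting at `m`. -/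
structure IsLift (κ : M → E2) (m : M) (v : E2) (T : ℝ) (γ : ℝ → M) : Prop where
  zero : γ 0 = m
  cont : ContinuousOn γ (Icc 0 T)
  lift : ∀ τ ∈ Icc 0 T, κ (γ τ) = κ m + τ • v

lemma IsLift.mono {m : M} {v : E2} {T T' : ℝ} {γ : ℝ → M} (h : IsLift κ m v T γ) (hT : T' ≤ T) :
    IsLift κ m v T' γ :=
  ⟨h.zero, h.cont.mono (Icc_subset_Icc_right hT), fun τ hτ => h.lift τ ⟨hτ.1, hτ.2.trans hT⟩⟩

lemma IsLift.eqOn [T2Space M] (h : IsEtaleOn κ e univ) {m : M} {v : E2} {T : ℝ}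
    {γ γ' : ℝ → M} (h1 : IsLift κ m v T γ) (h2 : IsLift κ m v T γ') : EqOn γ γ' (Icc 0 T) := by
  rcases lt_or_ge T 0 with hT | hT
  · simp [Icc_eq_empty_of_lt hT]
  · exact (T2Space.isSeparatedMap κ).eqOn_of_comp_eqOn
      (h.isLocalHomeomorph rfl).isLocallyInjective isPreconnected_Icc h1.cont h2.cont
      (fun τ hτ => by simp [h1.lift τ hτ, h2.lift τ hτ]) (a := 0) ⟨le_rfl, hT⟩
      (h1.zero.trans h2.zero.symm)

/-- The lift is continued by a single local inverse, based at `q`. The point `q` need not lie on the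
lift, so a limit point of lifts may serve as the base. -/
lemma IsLift.glue (h : IsEtaleOn κ e univ) {m q : M} {v : E2} {T T' : ℝ} {γ : ℝ → M}
    (hγ : IsLift κ m v T γ) (h0 : 0 ≤ T) (hT : T ≤ T') (hq : γ T ∈ (e q).source)
    (ht : ∀ τ ∈ Icc T T', κ m + τ • v ∈ (e q).target) : ∃ γ', IsLift κ m v T' γ' := by
  have hT0 : (e q).symm (κ m + T • v) = γ T := by
    rw [← hγ.lift T ⟨h0, le_rfl⟩, h.eqOn q (mem_univ q) hq, (e q).left_inv hq]
  let γ' : ℝ → M := fun τ => if τ ≤ T then γ τ else (e q).symm (κ m + τ • v)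
  have e1 : EqOn γ' γ (Icc 0 T) := fun τ hτ => if_pos hτ.2
  have e2 : EqOn γ' (fun τ => (e q).symm (κ m + τ • v)) (Icc T T') := by
    intro τ hτ
    rcases hτ.1.eq_or_lt with rfl | h3
    · simp [γ', hT0]
    · simp [γ', not_le.2 h3]
  have hu : Icc 0 T' = Icc 0 T ∪ Icc T T' := (Icc_union_Icc_eq_Icc h0 hT).symm
  refine ⟨γ', by simp [γ', h0, hγ.zero], ?_, ?_⟩
  · rw [hu]
    refine ContinuousOn.union_of_isClosed (hγ.cont.congr e1) (ContinuousOn.congr ?_ e2)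
      isClosed_Icc isClosed_Icc
    exact (e q).continuousOn_symm.comp (by fun_prop) ht
  · intro τ hτ
    rw [hu] at hτ
    rcases hτ with hτ | hτ
    · rw [e1 hτ, hγ.lift τ hτ]
    · rw [e2 hτ]
      have := h.eqOn q (mem_univ q) ((e q).map_target (ht τ hτ))
      rwa [(e q).right_inv (ht τ hτ)] at this

open Manifold in
-- The length of a lift is the integral of `‖dirD κ e v ψ‖` along it, because `ψ ∘ γ` has that
-- derivative.
lemma intrinsicEDist_le_of_isLift (hψ : ContMDiff (𝓡 2) 𝓘(ℝ, E3) ∞ ψ)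
    (h : IsEtaleOn κ e univ) {m : M} {v : E2} {T C a b : ℝ} {γ : ℝ → M} (hγ : IsLift κ m v T γ)
    (ha : 0 ≤ a) (hab : a ≤ b) (hb : b ≤ T) (hC : ∀ τ ∈ Icc 0 T, ‖dirD κ e v ψ (γ τ)‖ ≤ C) :
    intrinsicEDist ψ (γ a) (γ b) ≤ ENNReal.ofReal (C * (b - a)) := by
  let _ : ∀ x : M, ENorm (TangentSpace (𝓡 2) x) := inducedENorm ψ
  have hsub : Icc a b ⊆ Icc 0 T := Icc_subset_Icc ha hb
  have hs : ContMDiffOn 𝓘(ℝ, ℝ) (𝓡 2) 1 γ (Icc a b) := by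
    intro t ht
    have hev := eventually_lift_eq h (mem_univ _) (hγ.cont t (hsub ht)) hγ.lift
    have hl : ContMDiffAt 𝓘(ℝ, ℝ) (𝓡 2) 1 (fun τ : ℝ => κ m + τ • v) t :=
      ContDiffAt.contMDiffAt (by fun_prop)
    have he : ContMDiffAt (𝓡 2) (𝓡 2) 1 (e (γ t)).symm (κ (γ t)) :=
      (h.smooth (γ t) (mem_univ _)).of_le (by norm_cast)
    rw [hγ.lift t (hsub ht)] at he
    have h3 := (he.comp t hl).contMDiffWithinAt (s := Icc a b)
    refine h3.congr_of_eventuallyEq (hev.filter_mono (nhdsWithin_mono _ hsub)) ?_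
    have := h.symm_apply (mem_univ (γ t))
    rw [hγ.lift t (hsub ht)] at this
    exact this.symm
  have := enormSMulClass_inducedENorm ψ
  have h1 := riemannianEDist_le_pathELength (I := 𝓡 2) hs rfl rfl hab
  refine h1.trans ?_
  rw [pathELength_eq_lintegral_mfderiv_Ioo]
  have h2 : ∀ τ ∈ Ioo a b, ‖mfderiv 𝓘(ℝ, ℝ) (𝓡 2) γ τ (1 : ℝ)‖ₑ ≤ ENNReal.ofReal C := by
    intro τ hτ
    have hτ' := hsub (Ioo_subset_Icc_self hτ)
    have hd : MDifferentiableAt 𝓘(ℝ, ℝ) (𝓡 2) γ τ :=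
      (hs.contMDiffAt (Icc_mem_nhds hτ.1 hτ.2)).mdifferentiableAt (by simp)
    have hd2 : MDifferentiableAt (𝓡 2) 𝓘(ℝ, E3) ψ (γ τ) := (hψ _).mdifferentiableAt (by simp)
    have h4 := hasDerivWithinAt_lift h (etaleSmoothOn_of_contMDiff h hψ) hτ' (mem_univ _)
      (hγ.cont τ hτ') hγ.lift
    have h5 := h4.hasDerivAt (mem_of_superset (Icc_mem_nhds hτ.1 hτ.2) hsub)
    have h8 : (mfderiv (𝓡 2) 𝓘(ℝ, E3) ψ (γ τ)) (mfderiv 𝓘(ℝ, ℝ) (𝓡 2) γ τ (1 : ℝ)) =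
        dirD κ e v ψ (γ τ) := by
      have h6 : mfderiv 𝓘(ℝ, ℝ) 𝓘(ℝ, E3) (ψ ∘ γ) τ (1 : ℝ) = dirD κ e v ψ (γ τ) := by
        rw [mfderiv_eq_fderiv, h5.hasFDerivAt.fderiv]
        exact one_smul ℝ _
      rw [← h6, mfderiv_comp τ hd2 hd]
      rfl
    change enorm (E := E3) _ ≤ _
    rw [h8, ← ofReal_norm]
    exact ENNReal.ofReal_le_ofReal (hC τ hτ')
  refine (MeasureTheory.setLIntegral_mono' measurableSet_Ioo h2).trans ?_
  rw [MeasureTheory.setLIntegral_const, Real.volume_Ioo, ENNReal.ofReal_mul']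
  linarith

end Complete

/-! ### Path lifting on a complete surface -/

section Lifting

variable {M : Type*} [TopologicalSpace M] [ChartedSpace E2 M] [IsManifold (𝓡 2) ∞ M] [T2Space M]
  {e : M → OpenPartialHomeomorph M E2} {ψ : M → E3} {L : E3 →L[ℝ] E2}

lemma isLift_zero (κ : M → E2) (m : M) (v : E2) : IsLift κ m v 0 fun _ => m :=
  ⟨rfl, continuousOn_const, fun τ hτ => by
    have : τ = 0 := le_antisymm hτ.2 hτ.1
    simp [this]⟩

/-- With bounded speed the endpoints of shorter lifts form an intrinsic Cauchy sequence.
Completeness gives a limit `q`, and the local inverse at `q` carries a late lift past the gap. -/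
lemma exists_isLift_of_forall_lt (hψ : ContMDiff (𝓡 2) 𝓘(ℝ, E3) ∞ ψ)
    (hc : IsCompleteSurface ψ) (hL : ∀ v, ‖L v‖ ≤ ‖v‖)
    (h : IsEtaleOn (fun m => L (ψ m)) e univ) {m : M} {v : E2} {T C : ℝ} (hT : 0 < T)
    (hC : ∀ T' γ, 0 ≤ T' → T' ≤ T → IsLift (fun m => L (ψ m)) m v T' γ →
      ‖dirD (fun m => L (ψ m)) e v ψ (γ T')‖ ≤ C)
    (hlt : ∀ T', 0 ≤ T' → T' < T → ∃ γ, IsLift (fun m => L (ψ m)) m v T' γ) :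
    ∃ γ, IsLift (fun m => L (ψ m)) m v T γ := by
  obtain ⟨u, hu, huT, hlim⟩ := exists_seq_strictMono_tendsto' hT
  choose g hg using fun n => hlt (u n) (huT n).1.le (huT n).2
  have hdist : ∀ a b, a ≤ b → intrinsicEDist ψ (g a (u a)) (g b (u b)) ≤
      ENNReal.ofReal (C * (u b - u a)) := by
    intro a b hab
    have hle : u a ≤ u b := hu.monotone hab
    have h1 : g a (u a) = g b (u a) :=
      ((hg b).mono hle).eqOn h (hg a) ⟨(huT a).1.le, le_rfl⟩ |>.symm
    rw [h1]
    exact intrinsicEDist_le_of_isLift hψ h (hg b) (huT a).1.le hle le_rfl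
      fun τ hτ => hC τ (g b) hτ.1 (hτ.2.trans (huT b).2.le) ((hg b).mono hτ.2)
  obtain ⟨q, hq⟩ := hc (fun n => g n (u n)) (by
    intro ε hε
    have ht : Tendsto (fun p : ℕ × ℕ => ENNReal.ofReal (C * |u p.1 - u p.2|)) (atTop ×ˢ atTop)
        (𝓝 0) := by
      have : Tendsto (fun p : ℕ × ℕ => ENNReal.ofReal (C * |u p.1 - u p.2|)) (atTop ×ˢ atTop)
          (𝓝 (ENNReal.ofReal (C * |T - T|))) :=
        ENNReal.tendsto_ofReal ((((hlim.comp tendsto_fst).sub (hlim.comp tendsto_snd)).abs).const_mul C)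
      simpa using this
    have h2 := ht.eventually_lt_const hε
    rw [prod_atTop_atTop_eq, eventually_atTop_prod_self'] at h2
    obtain ⟨N, hN⟩ := h2
    refine ⟨N, fun a ha b hb => ?_⟩
    rcases le_total a b with hab | hab
    · refine (hdist a b hab).trans_lt ?_
      have := hN b hb a ha
      rwa [abs_of_nonneg (sub_nonneg.2 (hu.monotone hab))] at this
    · rw [intrinsicEDist_comm]
      refine (hdist b a hab).trans_lt ?_
      have := hN a ha b hb
      rwa [abs_of_nonneg (sub_nonneg.2 (hu.monotone hab))] at this)
  have hsq := tendsto_of_tendsto_intrinsicEDist hψ hL h (mem_univ q) hq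
  have hκq : L (ψ q) = L (ψ m) + T • v := by
    have h1 : Tendsto (fun n => L (ψ (g n (u n)))) atTop (𝓝 (L (ψ q))) :=
      ((L.continuous.comp hψ.continuous).tendsto q).comp hsq
    have h2 : Tendsto (fun n => L (ψ m) + u n • v) atTop (𝓝 (L (ψ m) + T • v)) :=
      (hlim.smul_const v).const_add _
    refine tendsto_nhds_unique h1 (h2.congr fun n => ?_)
    exact ((hg n).lift (u n) ⟨(huT n).1.le, le_rfl⟩).symm
  have hcont : Tendsto (fun τ : ℝ => L (ψ m) + τ • v) (𝓝 T) (𝓝 (L (ψ q))) := by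
    rw [hκq]
    exact (Continuous.tendsto (by fun_prop) T)
  have hev := hcont.eventually ((e q).open_target.mem_nhds (h.mem_target (mem_univ q)))
  obtain ⟨δ, hδ, hB⟩ := Metric.eventually_nhds_iff_ball.1 hev
  have hs := hsq.eventually ((e q).open_source.mem_nhds (h.mem q (mem_univ q)))
  obtain ⟨n, hn1, hn2⟩ := (hs.and (hlim.eventually_const_lt (sub_lt_self T hδ))).exists
  refine (hg n).glue h (huT n).1.le (huT n).2.le hn1 fun τ hτ => hB τ ?_
  rw [Metric.mem_ball, Real.dist_eq, abs_sub_lt_iff]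
  constructor <;> linarith [hτ.1, hτ.2]

/-- If the lift failed at time `T`, consider the infimum `s` of the failing times. The closing lemma
gives a lift up to `s`, and the local inverse at its end extends it beyond `s`, which contradicts
the infimum. -/
lemma exists_isLift (hψ : ContMDiff (𝓡 2) 𝓘(ℝ, E3) ∞ ψ)
    (hc : IsCompleteSurface ψ) (hL : ∀ v, ‖L v‖ ≤ ‖v‖)
    (h : IsEtaleOn (fun m => L (ψ m)) e univ) {m : M} {v : E2} {T C : ℝ} (hT : 0 ≤ T)
    (hC : ∀ T' γ, 0 ≤ T' → T' ≤ T → IsLift (fun m => L (ψ m)) m v T' γ →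
      ‖dirD (fun m => L (ψ m)) e v ψ (γ T')‖ ≤ C) :
    ∃ γ, IsLift (fun m => L (ψ m)) m v T γ := by
  by_contra hno
  set A := {T' | 0 ≤ T' ∧ T' ≤ T ∧ ¬ ∃ γ, IsLift (fun m => L (ψ m)) m v T' γ} with hA
  have hAT : T ∈ A := ⟨hT, le_rfl, hno⟩
  have hbdd : BddBelow A := ⟨0, fun x hx => hx.1⟩
  set s := sInf A with hs
  have hs0 : 0 ≤ s := le_csInf ⟨T, hAT⟩ fun x hx => hx.1
  have hsT : s ≤ T := csInf_le hbdd hAT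
  have hlt : ∀ T', 0 ≤ T' → T' < s → ∃ γ, IsLift (fun m => L (ψ m)) m v T' γ := by
    intro T' h0 h1
    by_contra h2
    exact (csInf_le hbdd ⟨h0, h1.le.trans hsT, h2⟩).not_gt h1
  obtain ⟨γ, hγ⟩ : ∃ γ, IsLift (fun m => L (ψ m)) m v s γ := by
    rcases hs0.eq_or_lt with h0 | h0
    · rw [← h0]; exact ⟨_, isLift_zero _ m v⟩
    · exact exists_isLift_of_forall_lt hψ hc hL h h0
        (fun T' γ h1 h2 h3 => hC T' γ h1 (h2.trans hsT) h3) hlt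
  have hcont : Tendsto (fun τ : ℝ => L (ψ m) + τ • v) (𝓝 s) (𝓝 (L (ψ (γ s)))) := by
    rw [hγ.lift s ⟨hs0, le_rfl⟩]
    exact (Continuous.tendsto (by fun_prop) s)
  have hev := hcont.eventually ((e (γ s)).open_target.mem_nhds (h.mem_target (mem_univ (γ s))))
  obtain ⟨δ, hδ, hB⟩ := Metric.eventually_nhds_iff_ball.1 hev
  obtain ⟨a, ha, has⟩ := (csInf_lt_iff hbdd ⟨T, hAT⟩).1 (lt_add_of_pos_right s hδ)
  refine ha.2.2 (hγ.glue h hs0 (csInf_le hbdd ha) (h.mem _ (mem_univ _)) fun τ hτ => hB τ ?_)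
  rw [Metric.mem_ball, Real.dist_eq, abs_sub_lt_iff]
  constructor <;> linarith [hτ.1, hτ.2]

/-- A surface whose coordinate map `κ` takes values in `D`, and whose first derivatives
are bounded over the segments that join points of `D`, projects bijectively to `D`. -/
lemma injective_and_range_eq [ConnectedSpace M] (hψ : ContMDiff (𝓡 2) 𝓘(ℝ, E3) ∞ ψ)
    (hc : IsCompleteSurface ψ) (hL : ∀ v, ‖L v‖ ≤ ‖v‖)
    (h : IsEtaleOn (fun m => L (ψ m)) e univ) {D : Set E2} (hD : ∀ m, L (ψ m) ∈ D)
    (hb : ∀ o ∈ D, ∀ w ∈ D, ∃ C, ∀ m, L (ψ m) ∈ segment ℝ o w →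
      ‖dirD (fun m => L (ψ m)) e (w - o) ψ m‖ ≤ C) :
    Function.Injective (fun m => L (ψ m)) ∧ range (fun m => L (ψ m)) = D := by
  set κ : M → E2 := fun m => L (ψ m) with hκ
  obtain ⟨m₀⟩ := (inferInstance : Nonempty M)
  have hlift : ∀ w : D, ∃ γ, IsLift κ m₀ ((w : E2) - κ m₀) 1 γ := by
    rintro ⟨w, hw⟩
    obtain ⟨C, hC⟩ := hb (κ m₀) (hD m₀) w hw
    refine exists_isLift (C := C) hψ hc hL h zero_le_one fun T' γ h0 h1 hγ => hC _ ?_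
    rw [segment_eq_image']
    exact ⟨T', ⟨h0, h1⟩, (hγ.lift T' ⟨h0, le_rfl⟩).symm⟩
  choose γ hγ using hlift
  have hloc := h.isLocalHomeomorph rfl
  have hκc : Continuous κ := L.continuous.comp hψ.continuous
  -- Lifting the segments from `κ m₀` to each `w ∈ D` gives a section of `κ` over `D`. Its
  -- continuity in `w` is the homotopy lifting property of a local homeomorphism.
  let f : C(unitInterval × D, E2) :=
    ⟨fun p => κ m₀ + (p.1 : ℝ) • ((p.2 : E2) - κ m₀), by fun_prop⟩
  have hg : Continuous fun p : unitInterval × D => γ p.2 p.1 := by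
    refine hloc.continuous_lift (T2Space.isSeparatedMap κ) f ?_ ?_ ?_
    · ext1 p
      exact (hγ p.2).lift p.1 p.1.2
    · have : (fun w : D => γ w ((0 : unitInterval) : ℝ)) = fun _ => m₀ := funext fun w => (hγ w).zero
      change Continuous fun w : D => γ w ((0 : unitInterval) : ℝ)
      rw [this]
      exact continuous_const
    · intro a
      exact (hγ a).cont.comp_continuous continuous_subtype_val fun t => t.2
  have hE : Continuous fun w : D => γ w 1 :=
    hg.comp (Continuous.prodMk_right (1 : unitInterval))
  have hE1 : ∀ w : D, κ (γ w 1) = w := fun w => by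
    rw [(hγ w).lift 1 ⟨zero_le_one, le_rfl⟩]; simp
  -- The section composed with `κ` and the identity are two lifts of `κ` itself. They agree at one
  -- point of a connected space, so they agree everywhere; this is the injectivity.
  have hid : (fun m => γ ⟨κ m, hD m⟩ 1) = id := by
    refine (T2Space.isSeparatedMap κ).eq_of_comp_eq hloc.isLocallyInjective
      (hE.comp (hκc.subtype_mk _)) continuous_id ?_ (γ ⟨κ m₀, hD m₀⟩ 1) ?_
    · ext1 m
      exact hE1 _
    · simp only [hE1, id]
  constructor
  · intro x y hxy
    have hx := congrFun hid x
    have hy := congrFun hid y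
    simp only [id] at hx hy
    rw [← hx, ← hy]
    congr 2
  · ext w
    constructor
    · rintro ⟨m, rfl⟩; exact hD m
    · intro hw
      exact ⟨γ ⟨w, hw⟩ 1, hE1 ⟨w, hw⟩⟩

end Lifting

/-! ### Rigidity near a vertical tangent plane -/

section Vertical

lemma exists_cos_sin {x y : ℝ} (h : x ^ 2 + y ^ 2 = 1) :
    ∃ α : ℝ, Real.cos α = x ∧ Real.sin α = y := by
  have hz : ‖(⟨x, y⟩ : ℂ)‖ = 1 := by
    rw [Complex.norm_eq_sqrt_sq_add_sq, h, Real.sqrt_one]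
  have h0 : (⟨x, y⟩ : ℂ) ≠ 0 := fun h => by simp [h] at hz
  exact ⟨Complex.arg ⟨x, y⟩, by rw [Complex.cos_arg h0, hz]; simp,
    by rw [Complex.sin_arg, hz]; simp⟩

/-- A symmetric matrix of determinant zero is semidefinite. The left-hand side is its trace plus the
value of a semidefinite form of the same sign, so `|R|` dominates the trace, and the trace dominates
every entry. -/
lemma hessian_bounds {r s t a b R : ℝ} (h : r * t = s ^ 2)
    (h2 : (1 + b ^ 2) * r - 2 * a * b * s + (1 + a ^ 2) * t = R) :
    |r| ≤ |R| ∧ |s| ≤ |R| ∧ |t| ≤ |R| := by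
  wlog hrt : 0 ≤ r + t generalizing r s t R
  · have := this (r := -r) (s := -s) (t := -t) (R := -R) (by linarith) (by linarith) (by linarith)
    simpa using this
  have hr : 0 ≤ r := by
    by_contra hr
    nlinarith [sq_nonneg s]
  have ht : 0 ≤ t := by
    by_contra ht
    nlinarith [sq_nonneg s]
  have hX : 0 ≤ b ^ 2 * r - 2 * a * b * s + a ^ 2 * t := by
    rcases hr.eq_or_lt with h0 | h0
    · have hs : s = 0 := by rw [← h0, zero_mul] at h; exact pow_eq_zero_iff (two_ne_zero) |>.1 h.symm
      rw [← h0, hs]; nlinarith [mul_nonneg (sq_nonneg a) ht]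
    · have : 0 ≤ r * (b ^ 2 * r - 2 * a * b * s + a ^ 2 * t) := by
        have : r * (b ^ 2 * r - 2 * a * b * s + a ^ 2 * t) = (b * r - a * s) ^ 2 := by
          linear_combination a ^ 2 * h
        rw [this]; positivity
      exact nonneg_of_mul_nonneg_right this h0
  have hR : r + t ≤ R := by linarith
  have hs : |s| ≤ r + t := abs_le_of_sq_le_sq (by nlinarith) hrt
  rw [abs_of_nonneg hr, abs_of_nonneg ht, abs_of_nonneg (hrt.trans hR)]
  exact ⟨by linarith, by linarith, by linarith⟩

/-- The frame consisting of a horizontal direction, the vertical direction, and the horizontal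
direction orthogonal to the first. -/
lemma exists_vertFrame (α : ℝ) : ∃ B : OrthonormalBasis (Fin 3) ℝ E3,
    B 0 = !₂[Real.cos α, Real.sin α, 0] ∧ B 1 = e₃ ∧ B 2 = !₂[-Real.sin α, Real.cos α, 0] := by
  let v : Fin 3 → E3 :=
    ![!₂[Real.cos α, Real.sin α, 0], e₃, !₂[-Real.sin α, Real.cos α, 0]]
  have hv : Orthonormal ℝ v := by
    rw [orthonormal_iff_ite]
    have := Real.sin_sq_add_cos_sq α
    intro i j
    fin_cases i <;> fin_cases j <;>
      simp [v, e₃, PiLp.inner_apply, Fin.sum_univ_three, -inner_self_eq_norm_sq_to_K]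
    all_goals nlinarith
  have hsp : ⊤ ≤ Submodule.span ℝ (range v) := by
    rw [hv.linearIndependent.span_eq_top_of_card_eq_finrank (by simp)]
  refine ⟨OrthonormalBasis.mk hv hsp, ?_, ?_, ?_⟩ <;> simp [v]

variable {M : Type*} [TopologicalSpace M] [ChartedSpace E2 M] {ψ : M → E3} {φ : ℝ → ℝ}

/-- The tangent plane of `ψ` at `p` is orthogonal to the horizontal vector at angle
`α + π / 2`; in particular it is vertical. -/
def IsVertAt (ψ : M → E3) (α : ℝ) (p : M) : Prop :=
  ∀ v, inner ℝ (!₂[-Real.sin α, Real.cos α, 0] : E3) (dMap ψ p v) = 0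

/-- A kernel vector of the horizontal projection gives a nonzero vertical tangent vector. Any normal
is then horizontal, and normalizing it produces the angle. -/
lemma exists_isVertAt {p : M} (hi : Function.Injective (dMap ψ p))
    (h : ¬ ∀ v, frameProj (EuclideanSpace.basisFun (Fin 3) ℝ) (dMap ψ p v) = 0 → v = 0) :
    ∃ α, IsVertAt ψ α p := by
  push Not at h
  obtain ⟨v, hv, hv0⟩ := h
  have hne : dMap ψ p v ≠ 0 := fun h0 => hv0 (hi (by rw [h0, map_zero]))
  have hx0 : dMap ψ p v 0 = 0 := by
    simpa [frameProj_zero, EuclideanSpace.inner_single_left] using congrArg (fun x : E2 => x 0) hv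
  have hx1 : dMap ψ p v 1 = 0 := by
    simpa [frameProj_one, EuclideanSpace.inner_single_left] using congrArg (fun x : E2 => x 1) hv
  have hx2 : dMap ψ p v 2 ≠ 0 := by
    intro h2; apply hne; ext i; fin_cases i <;> assumption
  -- a unit normal
  have hlt : Module.finrank ℝ (dMap ψ p).range < Module.finrank ℝ E3 := by
    refine (LinearMap.finrank_range_le (dMap ψ p).toLinearMap).trans_lt ?_
    simp
  have hbot : (dMap ψ p).rangeᗮ ≠ ⊥ := by
    intro hb
    rw [Submodule.orthogonal_eq_bot_iff] at hb
    rw [hb] at hlt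
    simp at hlt
  obtain ⟨d, hd, hd0⟩ := Submodule.exists_mem_ne_zero_of_ne_bot hbot
  have hdv : ∀ w, inner ℝ d (dMap ψ p w) = 0 := fun w => by
    rw [real_inner_comm]
    exact (Submodule.mem_orthogonal _ _).1 hd _ ⟨w, rfl⟩
  have hd2 : d 2 = 0 := by
    have := hdv v
    simp [PiLp.inner_apply, Fin.sum_univ_three, hx0, hx1] at this
    tauto
  have hnorm : 0 < d 0 ^ 2 + d 1 ^ 2 := by
    by_contra hle
    apply hd0
    have h0 : d 0 = 0 := by nlinarith [sq_nonneg (d 0), sq_nonneg (d 1)]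
    have h1 : d 1 = 0 := by nlinarith [sq_nonneg (d 0), sq_nonneg (d 1)]
    ext i; fin_cases i <;> assumption
  set N := Real.sqrt (d 0 ^ 2 + d 1 ^ 2) with hN
  have hN0 : 0 < N := Real.sqrt_pos.2 hnorm
  have hN2 : N ^ 2 = d 0 ^ 2 + d 1 ^ 2 := Real.sq_sqrt hnorm.le
  obtain ⟨α, hc, hs⟩ := exists_cos_sin (x := d 1 / N) (y := - d 0 / N) (by
    field_simp; linarith)
  refine ⟨α, fun w => ?_⟩
  have := hdv w
  simp [PiLp.inner_apply, Fin.sum_univ_three, hd2] at this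
  simp [PiLp.inner_apply, Fin.sum_univ_three, hc, hs]
  field_simp
  linarith

lemma surjective_of_isVertAt_frame {p : M} {L : E3 →L[ℝ] E2}
    (h : ∀ v, L (dMap ψ p v) = 0 → v = 0) (w : E2) : ∃ v, L (dMap ψ p v) = w := by
  have hi : Function.Injective (L.comp (dMap ψ p)).toLinearMap :=
    (injective_iff_map_eq_zero _).2 h
  exact LinearMap.injective_iff_surjective.1 hi w

lemma not_isVertAt {p : M}
    (h : ∀ v, frameProj (EuclideanSpace.basisFun (Fin 3) ℝ) (dMap ψ p v) = 0 → v = 0) (α : ℝ) :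
    ¬ IsVertAt ψ α p := by
  intro hα
  obtain ⟨v, hv⟩ := surjective_of_isVertAt_frame h !₂[-Real.sin α, Real.cos α]
  have h0 : dMap ψ p v 0 = -Real.sin α := by
    simpa [frameProj_zero, EuclideanSpace.inner_single_left] using congrArg (fun x : E2 => x 0) hv
  have h1 : dMap ψ p v 1 = Real.cos α := by
    simpa [frameProj_one, EuclideanSpace.inner_single_left] using congrArg (fun x : E2 => x 1) hv
  have := hα v
  simp [PiLp.inner_apply, Fin.sum_univ_three, h0, h1] at this
  nlinarith [Real.sin_sq_add_cos_sq α]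

lemma frameProj_injective_of_isVertAt {p : M} {α : ℝ} (hi : Function.Injective (dMap ψ p))
    (hα : IsVertAt ψ α p) {B : OrthonormalBasis (Fin 3) ℝ E3}
    (hB : B 2 = !₂[-Real.sin α, Real.cos α, 0]) (v : E2)
    (hv : frameProj B (dMap ψ p v) = 0) : v = 0 := by
  apply hi
  rw [map_zero]
  apply eq_of_frame_inner B
  · simpa [frameProj_zero, EuclideanSpace.inner_single_left] using congrArg (fun x : E2 => x 0) hv
  · simpa [frameProj_one, EuclideanSpace.inner_single_left] using congrArg (fun x : E2 => x 1) hv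
  · rw [hB, hα v, inner_zero_right]

variable [IsManifold (𝓡 2) ∞ M]

/-- In a frame with `B 1` vertical, the right-hand side of the minimality equation is proportional
to the vertical derivative of `W`. By `hessian_bounds` that derivative satisfies a homogeneous
linear differential inequality, so it vanishes near `p` since it vanishes at `p`. The Hessian then
vanishes, and so do the gradient and the variation of `W`. -/
lemma eventually_isVertAt (hψ : ContMDiff (𝓡 2) 𝓘(ℝ, E3) ∞ ψ)
    (hφ : Continuous (deriv φ)) (hflat : IsFlat ψ) (hmin : IsPhiMinimal φ ψ) {p : M} {α : ℝ}
    (hi : Function.Injective (dMap ψ p)) (hα : IsVertAt ψ α p) :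
    ∀ᶠ q in 𝓝 p, IsVertAt ψ α q ∧ inner ℝ (!₂[-Real.sin α, Real.cos α, 0] : E3) (ψ q) =
      inner ℝ (!₂[-Real.sin α, Real.cos α, 0] : E3) (ψ p) := by
  obtain ⟨B, hB0, hB1, hB2⟩ := exists_vertFrame α
  obtain ⟨e, he⟩ := exists_isEtaleOn hψ (frameProj B)
  set U := {p | ∀ v, frameProj B (dMap ψ p v) = 0 → v = 0} with hU
  have hp : p ∈ U := frameProj_injective_of_isVertAt hi hα hB2
  set κ : M → E2 := fun m => frameProj B (ψ m) with hκ
  set W : M → ℝ := fun m => inner ℝ (B 2) (ψ m) with hW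
  have hsm : EtaleSmoothOn κ e U ψ := etaleSmoothOn_of_contMDiff he hψ
  have hWs : EtaleSmoothOn κ e U W := EtaleSmoothOn.comp (innerSL ℝ (B 2)).contDiff hsm
  have hdW : ∀ q ∈ U, ∀ v, inner ℝ (B 2) (dMap ψ q v) =
      dirD κ e (frameProj B (dMap ψ q v)) W q := by
    intro q hq v
    rw [dMap_eq_dirD hψ (frameProj B) he hq v]
    have := dirD_clm (v := frameProj B (dMap ψ q v)) hsm (innerSL ℝ (B 2)) hq
    rw [← dMap_eq_dirD hψ (frameProj B) he hq v] at this ⊢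
    exact this.symm
  have hdWp : ∀ v, dirD κ e v W p = 0 := by
    intro v
    obtain ⟨w, hw⟩ := surjective_of_isVertAt_frame hp v
    rw [← hw, ← hdW p hp, hB2]
    exact hα w
  have h1s := hWs.dirD he (ε 0)
  have h2s := hWs.dirD he (ε 1)
  have hpde : ∀ q ∈ U,
      |dirD κ e (ε 0) (dirD κ e (ε 0) W) q| ≤ |deriv φ (ψ q 2) * (1 + dirD κ e (ε 0) W q ^ 2 +
        dirD κ e (ε 1) W q ^ 2)| * |dirD κ e (ε 1) W q| ∧
      |dirD κ e (ε 0) (dirD κ e (ε 1) W) q| ≤ |deriv φ (ψ q 2) * (1 + dirD κ e (ε 0) W q ^ 2 +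
        dirD κ e (ε 1) W q ^ 2)| * |dirD κ e (ε 1) W q| ∧
      |dirD κ e (ε 1) (dirD κ e (ε 1) W) q| ≤ |deriv φ (ψ q 2) * (1 + dirD κ e (ε 0) W q ^ 2 +
        dirD κ e (ε 1) W q ^ 2)| * |dirD κ e (ε 1) W q| := by
    intro q hq
    obtain ⟨h1, h2⟩ := phiMinimal_pde hψ hflat hmin B hκ he hq hq hW rfl rfl rfl rfl rfl
    have hR : deriv φ (ψ q 2) * (B 2 2 - dirD κ e (ε 0) W q * B 0 2 - dirD κ e (ε 1) W q * B 1 2) *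
        (1 + dirD κ e (ε 0) W q ^ 2 + dirD κ e (ε 1) W q ^ 2) =
        -(deriv φ (ψ q 2) * (1 + dirD κ e (ε 0) W q ^ 2 + dirD κ e (ε 1) W q ^ 2) *
          dirD κ e (ε 1) W q) := by
      simp [hB0, hB1, hB2, e₃]; ring
    have h3 := hessian_bounds h1 (h2.trans hR)
    rwa [abs_neg, abs_mul] at h3
  -- the derivative in the vertical direction vanishes near `p`
  have hw2 : ∀ᶠ q in 𝓝 p, dirD κ e (ε 1) W q = 0 := by
    have hcont : ContinuousAt (fun q => |deriv φ (ψ q 2) * (1 + dirD κ e (ε 0) W q ^ 2 +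
        dirD κ e (ε 1) W q ^ 2)|) p := by
      have c1 := h1s.continuousAt he hp
      have c2 := h2s.continuousAt he hp
      have c3 : ContinuousAt (fun q => deriv φ (ψ q 2)) p :=
        (hφ.comp ((EuclideanSpace.proj (𝕜 := ℝ) 2).continuous.comp hψ.continuous)).continuousAt
      fun_prop
    obtain ⟨K, hK⟩ : ∃ K, ∀ᶠ q in 𝓝 p, |deriv φ (ψ q 2) * (1 + dirD κ e (ε 0) W q ^ 2 +
        dirD κ e (ε 1) W q ^ 2)| < K :=
      ⟨_, hcont.eventually_lt_const (lt_add_one _)⟩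
    have hK' := (he.tendsto_symm hp).eventually hK
    obtain ⟨ρ, hρ, hball⟩ := Metric.eventually_nhds_iff_ball.1
      ((((hK'.and (he.eventually_mem hp)).and (h2s.eventually he hp)).and
        (dirD_comp_symm he (dirD κ e (ε 1) W) (ε 0) hp)).and
        (dirD_comp_symm he (dirD κ e (ε 1) W) (ε 1) hp))
    set g : E2 → ℝ := dirD κ e (ε 1) W ∘ (e p).symm with hg
    have hzero : ∀ y ∈ Metric.ball (κ p) ρ, g y = 0 := by
      intro y hy
      have hline : ∀ τ ∈ Icc (0 : ℝ) 1, κ p + τ • (y - κ p) ∈ Metric.ball (κ p) ρ := by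
        intro τ hτ
        rw [Metric.mem_ball, dist_eq_norm, add_sub_cancel_left, norm_smul, Real.norm_eq_abs,
          abs_of_nonneg hτ.1]
        rw [Metric.mem_ball, dist_eq_norm] at hy
        exact (mul_le_of_le_one_left (norm_nonneg _) hτ.2).trans_lt hy
      have hd : ∀ τ ∈ Icc (0 : ℝ) 1, HasDerivAt (fun τ : ℝ => g (κ p + τ • (y - κ p)))
          (fderiv ℝ g (κ p + τ • (y - κ p)) (y - κ p)) τ := by
        intro τ hτ
        have h1 : HasDerivAt (fun τ : ℝ => κ p + τ • (y - κ p)) (y - κ p) τ := by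
          simpa using ((hasDerivAt_id τ).smul_const (y - κ p)).const_add (κ p)
        exact (((hball _ (hline τ hτ)).1.1.2.differentiableAt (by simp)).hasFDerivAt).comp_hasDerivAt
          τ h1
      -- Gronwall along the segment from `κ p` to `y`. The constant absorbs the two components of `y
      -- - κ p`, because the derivative along the segment is their combination of the partial
      -- derivatives.
      have := eq_zero_of_abs_deriv_le_mul_abs_self_of_eq_zero_right
        (f := fun τ : ℝ => g (κ p + τ • (y - κ p)))
        (f' := fun τ => fderiv ℝ g (κ p + τ • (y - κ p)) (y - κ p))
        (K := (|(y - κ p) 0| + |(y - κ p) 1|) * K) (a := 0) (b := 1)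
        (fun τ hτ => (hd τ hτ).continuousAt.continuousWithinAt)
        (fun τ hτ => (hd τ (Ico_subset_Icc_self hτ)).hasDerivWithinAt) ?_ ?_ 1 (by simp)
      · simpa using this
      · simp [hg, he.symm_apply hp, hdWp]
      · intro τ hτ
        obtain ⟨⟨⟨⟨hK1, hU1⟩, -⟩, hs⟩, ht⟩ := hball _ (hline τ (Ico_subset_Icc_self hτ))
        obtain ⟨-, b2, b3⟩ := hpde _ hU1
        set z := κ p + τ • (y - κ p)
        simp only [Function.comp_apply] at hs ht
        have hgz : dirD κ e (ε 1) W ((e p).symm z) = g z := rfl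
        have hlin : fderiv ℝ g z (y - κ p) = (y - κ p) 0 * fderiv ℝ g z (ε 0) +
            (y - κ p) 1 * fderiv ℝ g z (ε 1) := by
          conv_lhs => rw [eq_sum_ε (y - κ p), map_add, map_smul, map_smul]
          rfl
        rw [hgz] at b2 b3
        have b2' : |fderiv ℝ g z (ε 0)| ≤ K * |g z| := by
          rw [← hs]; exact b2.trans (mul_le_mul_of_nonneg_right hK1.le (abs_nonneg _))
        have b3' : |fderiv ℝ g z (ε 1)| ≤ K * |g z| := by
          rw [← ht]; exact b3.trans (mul_le_mul_of_nonneg_right hK1.le (abs_nonneg _))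
        rw [hlin, Real.norm_eq_abs, Real.norm_eq_abs]
        refine (abs_add_le _ _).trans ?_
        rw [abs_mul, abs_mul, add_mul, add_mul, mul_assoc, mul_assoc]
        gcongr
    filter_upwards [he.eventually_symm_apply hp,
      (he.continuousAt hp).eventually (Metric.ball_mem_nhds _ hρ)] with q h1 h2
    have := hzero _ h2
    rwa [hg, Function.comp_apply, h1] at this
  have hUn : ∀ᶠ q in 𝓝 p, q ∈ U := he.isOpen.mem_nhds hp
  have hw1 : ∀ᶠ q in 𝓝 p, dirD κ e (ε 0) W q = 0 := by
    have := eventually_eq_of_dirD_eq_zero he h1s hp (by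
      filter_upwards [hw2, hUn] with q h2 hq v
      obtain ⟨b1, b2, -⟩ := hpde q hq
      rw [h2, abs_zero, mul_zero, abs_nonpos_iff] at b1 b2
      rw [dirD_eq_sum, b1, dirD_comm he hWs hq, b2]; simp)
    filter_upwards [this] with q hq
    rw [hq, hdWp]
  have hdW0 : ∀ᶠ q in 𝓝 p, ∀ v, dirD κ e v W q = 0 := by
    filter_upwards [hw1, hw2] with q h1 h2 v
    rw [dirD_eq_sum, h1, h2]; simp
  filter_upwards [eventually_eq_of_dirD_eq_zero he hWs hp hdW0, hdW0, hUn] with q h1 h2 h3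
  rw [hW, hB2] at h1
  refine ⟨fun v => ?_, h1⟩
  rw [← hB2, hdW q h3, h2]

end Vertical

/-! ### The vertical plane -/

section Plane

lemma norm_frameProj_le (B : OrthonormalBasis (Fin 3) ℝ E3) (v : E3) :
    ‖frameProj B v‖ ≤ ‖v‖ := by
  refine le_of_sq_le_sq ?_ (norm_nonneg _)
  rw [EuclideanSpace.norm_sq_eq, Fin.sum_univ_two, frameProj_zero, frameProj_one,
    ← real_inner_self_eq_norm_sq v, inner_eq_frame B v v]
  simp only [Real.norm_eq_abs, sq_abs]
  nlinarith [sq_nonneg (inner ℝ (B 2) v)]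

variable {M : Type*} [TopologicalSpace M] [ChartedSpace E2 M] [IsManifold (𝓡 2) ∞ M] {ψ : M → E3}
  {φ : ℝ → ℝ}

lemma inner_dirD (hψ : ContMDiff (𝓡 2) 𝓘(ℝ, E3) ∞ ψ) {κ : M → E2} {U : Set M}
    {e : M → OpenPartialHomeomorph M E2} (h : IsEtaleOn κ e U) {p : M} (hp : p ∈ U) (w : E3)
    (v : E2) : inner ℝ w (dirD κ e v ψ p) = dirD κ e v (fun m => inner ℝ w (ψ m)) p :=
  (dirD_clm (etaleSmoothOn_of_contMDiff h hψ) (innerSL ℝ w) hp).symm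

lemma frameProj_dirD (hψ : ContMDiff (𝓡 2) 𝓘(ℝ, E3) ∞ ψ) {U : Set M} {L : E3 →L[ℝ] E2}
    {e : M → OpenPartialHomeomorph M E2} (h : IsEtaleOn (fun m => L (ψ m)) e U) {p : M}
    (hp : p ∈ U) (v : E2) : L (dirD (fun m => L (ψ m)) e v ψ p) = v := by
  rw [← dirD_clm (etaleSmoothOn_of_contMDiff h hψ) L hp]
  exact dirD_coord h (ContinuousLinearMap.id ℝ E2) hp

lemma isEmbedding_of_injective (hψ : Continuous ψ) {L : E3 →L[ℝ] E2}
    {e : M → OpenPartialHomeomorph M E2} (h : IsEtaleOn (fun m => L (ψ m)) e univ)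
    (hi : Function.Injective fun m => L (ψ m)) : IsEmbedding ψ :=
  IsEmbedding.of_comp hψ L.continuous
    (((h.isLocalHomeomorph rfl).isOpenEmbedding_of_injective hi).isEmbedding)

/-- A vertical tangent plane determines its angle only modulo `π`, and `sin (β - α) = 0` expresses
this. -/
lemma sin_sub_eq_zero_of_isVertAt {p : M} {α β : ℝ} (hi : Function.Injective (dMap ψ p))
    (hα : IsVertAt ψ α p) (hβ : IsVertAt ψ β p) : Real.sin (β - α) = 0 := by
  obtain ⟨B, hB0, hB1, hB2⟩ := exists_vertFrame β
  obtain ⟨v, hv⟩ := surjective_of_isVertAt_frame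
    (frameProj_injective_of_isVertAt hi hβ hB2) (ε 0)
  have h1 : dMap ψ p v = B 0 := by
    apply eq_of_frame_inner B
    · have := congrArg (fun x : E2 => x 0) hv
      rw [frame_inner]
      simpa [frameProj_zero, ε] using this
    · have := congrArg (fun x : E2 => x 1) hv
      rw [frame_inner]
      simpa [frameProj_one, ε] using this
    · rw [frame_inner, hB2, hβ v]; rfl
  have h2 := hα v
  rw [h1, hB0] at h2
  simp [PiLp.inner_apply, Fin.sum_univ_three] at h2
  rw [Real.sin_sub]; linarith

lemma IsVertAt.of_sin_eq_zero {p : M} {α β : ℝ} (hβ : IsVertAt ψ β p)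
    (h : Real.sin (β - α) = 0) : IsVertAt ψ α p := by
  obtain ⟨B, hB0, hB1, hB2⟩ := exists_vertFrame β
  intro v
  rw [Real.sin_sub] at h
  rw [inner_eq_frame B, hB2, hβ v, hB0, hB1]
  simp [PiLp.inner_apply, Fin.sum_univ_three, e₃]
  left; linarith

/-- The points with this tangent plane and this value of `W` form an open set by local rigidity.
They also form a closed set, so it is everything. The first derivatives in the frame are then
constant vectors, and lifting applies with `D` the full plane. -/
lemma isVerticalPlane_of_isVertAt [T2Space M] [ConnectedSpace M]
    (hψ : ContMDiff (𝓡 2) 𝓘(ℝ, E3) ∞ ψ) (hc : IsCompleteSurface ψ)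
    (hφ : Continuous (deriv φ)) (hflat : IsFlat ψ) (hmin : IsPhiMinimal φ ψ)
    (hi : ∀ p, Function.Injective (dMap ψ p)) {p₀ : M} {α : ℝ} (hα : IsVertAt ψ α p₀) :
    IsEmbedding ψ ∧ IsVerticalPlane (range ψ) := by
  obtain ⟨B, hB0, hB1, hB2⟩ := exists_vertFrame α
  set W : M → ℝ := fun m => inner ℝ (!₂[-Real.sin α, Real.cos α, 0] : E3) (ψ m) with hW
  have hWc : Continuous W := (innerSL ℝ _).continuous.comp hψ.continuous
  set S := {q | IsVertAt ψ α q ∧ W q = W p₀} with hS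
  have hopen : IsOpen S := by
    rw [isOpen_iff_mem_nhds]
    rintro q ⟨h1, h2⟩
    filter_upwards [eventually_isVertAt hψ hφ hflat hmin (hi q) h1] with x hx
    exact ⟨hx.1, hx.2.trans h2⟩
  have hclosed : IsClosed S := by
    rw [← closure_subset_iff_isClosed]
    intro q hq
    have hfr : ∃ᶠ x in 𝓝 q, x ∈ S := mem_closure_iff_frequently.1 hq
    refine ⟨?_, ?_⟩
    · by_cases hst : ∀ v, frameProj (EuclideanSpace.basisFun (Fin 3) ℝ) (dMap ψ q v) = 0 → v = 0
      · exfalso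
        obtain ⟨e, he⟩ := exists_isEtaleOn hψ (frameProj (EuclideanSpace.basisFun (Fin 3) ℝ))
        obtain ⟨x, hx, hx'⟩ := (hfr.and_eventually (he.isOpen.mem_nhds hst)).exists
        exact not_isVertAt hx' α hx.1
      -- The limit point has a vertical tangent plane at some angle `β`, which is then shared by its
      -- neighbours. One of them lies in `S`, so `β` and `α` agree modulo `π`.
      · obtain ⟨β, hβ⟩ := exists_isVertAt (hi q) hst
        obtain ⟨x, hx, hx'⟩ :=
          (hfr.and_eventually (eventually_isVertAt hψ hφ hflat hmin (hi q) hβ)).exists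
        exact hβ.of_sin_eq_zero (sin_sub_eq_zero_of_isVertAt (hi x) hx.1 hx'.1)
    · exact closure_minimal (fun x hx => hx.2) (isClosed_eq hWc continuous_const) hq
  have huniv : S = univ := IsClopen.eq_univ ⟨hclosed, hopen⟩ ⟨p₀, hα, rfl⟩
  have hall : ∀ q, IsVertAt ψ α q ∧ W q = W p₀ := fun q => by
    have : q ∈ S := huniv ▸ mem_univ q
    exact this
  obtain ⟨e, he⟩ := exists_isEtaleOn hψ (frameProj B)
  have hU : {p | ∀ v, frameProj B (dMap ψ p v) = 0 → v = 0} = univ :=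
    eq_univ_of_forall fun p => frameProj_injective_of_isVertAt (hi p) (hall p).1 hB2
  rw [hU] at he
  have hd : ∀ v m, dirD (fun m => frameProj B (ψ m)) e v ψ m = v 0 • B 0 + v 1 • B 1 := by
    intro v m
    have h1 := frameProj_dirD hψ he (mem_univ m) v
    apply eq_of_frame_inner B
    · rw [← frameProj_zero, h1]
      simp [inner_add_right, inner_smul_right]
    · rw [← frameProj_one, h1]
      simp [inner_add_right, inner_smul_right]
    · rw [inner_dirD hψ he (mem_univ m), hB2, ← hW, funext fun q => (hall q).2, dirD_const, ← hB2]
      simp [inner_add_right, inner_smul_right]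
  obtain ⟨hinj, hrange⟩ := injective_and_range_eq hψ hc (norm_frameProj_le B) he
    (D := univ) (fun _ => mem_univ _) (fun o _ w _ => ⟨_, fun m _ => (congrArg norm (hd _ m)).le⟩)
  refine ⟨isEmbedding_of_injective hψ.continuous he hinj, α + Real.pi / 2, W p₀, ?_⟩
  rw [Real.cos_add_pi_div_two, Real.sin_add_pi_div_two]
  have hWq : ∀ q : E3, inner ℝ (!₂[-Real.sin α, Real.cos α, 0] : E3) q =
      -Real.sin α * q 0 + Real.cos α * q 1 := by
    intro q; simp [PiLp.inner_apply, Fin.sum_univ_three]; ring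
  ext q
  simp only [mem_range, mem_ofPred_eq]
  constructor
  · rintro ⟨m, rfl⟩
    rw [← hWq]; exact (hall m).2
  · intro hq
    obtain ⟨m, hm⟩ : frameProj B q ∈ range fun m => frameProj B (ψ m) := hrange ▸ mem_univ _
    refine ⟨m, eq_of_frame_inner B ?_ ?_ ?_⟩
    · exact congrArg (fun x : E2 => x 0) hm
    · exact congrArg (fun x : E2 => x 1) hm
    · rw [hB2, hWq q, hq]; exact (hall m).2

end Plane

/-! ### Straight lines in the kernel of the Hessian -/

section Ruling

/-- The horizontal direction at angle `α`. -/
def dirF (α : ℝ) : E2 := !₂[Real.cos α, Real.sin α]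

/-- The horizontal direction at angle `α + π / 2`. -/
def dirE (α : ℝ) : E2 := !₂[-Real.sin α, Real.cos α]

lemma eq_dirE_dirF (α : ℝ) (v : E2) :
    v = (Real.cos α * v 1 - Real.sin α * v 0) • dirE α +
      (Real.cos α * v 0 + Real.sin α * v 1) • dirF α := by
  have := Real.sin_sq_add_cos_sq α
  ext i; fin_cases i
  · simp [dirE, dirF]; linear_combination (-v 0) * this
  · simp [dirE, dirF]; linear_combination (-v 1) * this

lemma dirE_add_pi (α : ℝ) : dirE (α + Real.pi) = -dirE α := by
  ext i; fin_cases i <;> simp [dirE]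

lemma dirF_add_pi (α : ℝ) : dirF (α + Real.pi) = -dirF α := by
  ext i; fin_cases i <;> simp [dirF]

lemma dirE_eq (α β : ℝ) :
    dirE β = Real.cos (β - α) • dirE α + (-Real.sin (β - α)) • dirF α := by
  have h1 := Real.sin_add (β - α) α
  have h2 := Real.cos_add (β - α) α
  rw [sub_add_cancel] at h1 h2
  ext i; fin_cases i
  · simp [dirE, dirF, h1]
  · simp [dirE, dirF, h2]; ring

variable {M : Type*} [TopologicalSpace M] [ChartedSpace E2 M]
  {κ : M → E2} {e : M → OpenPartialHomeomorph M E2} {z : M → ℝ}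

/-- The function `z` is a smooth function of the local coordinates `κ` whose Hessian is
positive semidefinite of rank one; `(dirE α, dirF α)` runs through the oriented orthonormal
frames. -/
structure HasRankOneHessian (κ : M → E2) (e : M → OpenPartialHomeomorph M E2) (z : M → ℝ) :
    Prop where
  etale : IsEtaleOn κ e univ
  smooth : EtaleSmoothOn κ e univ z
  det : ∀ α m, dirD κ e (dirF α) (dirD κ e (dirF α) z) m * dirD κ e (dirE α) (dirD κ e (dirE α) z) m
    = dirD κ e (dirE α) (dirD κ e (dirF α) z) m ^ 2
  pos : ∀ α m, 0 < dirD κ e (dirF α) (dirD κ e (dirF α) z) m +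
    dirD κ e (dirE α) (dirD κ e (dirE α) z) m

namespace HasRankOneHessian

variable {α : ℝ} {m : M}

lemma smooth_dd (h : HasRankOneHessian κ e z)
    (v w : E2) : EtaleSmoothOn κ e univ (dirD κ e v (dirD κ e w z)) :=
  (h.smooth.dirD h.etale w).dirD h.etale v

lemma dd_comm (h : HasRankOneHessian κ e z)
    (v w : E2) : dirD κ e v (dirD κ e w z) = dirD κ e w (dirD κ e v z) :=
  funext fun m => dirD_comm h.etale h.smooth (mem_univ m) v w

lemma ddd_comm (h : HasRankOneHessian κ e z) (u v w : E2) : dirD κ e u (dirD κ e v (dirD κ e w z)) =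
    dirD κ e v (dirD κ e u (dirD κ e w z)) :=
  funext fun m => dirD_comm h.etale (h.smooth.dirD h.etale w) (mem_univ m) u v

/-- This symmetry of third derivatives and the next one turn derivatives of `S = z_EF` into
derivatives of `T = z_EE` and `A = z_FF`, where `E` and `F` stand for `dirE α` and `dirF α`. -/
lemma dirF_hT (h : HasRankOneHessian κ e z)
    (α : ℝ) : dirD κ e (dirF α) (dirD κ e (dirE α) (dirD κ e (dirE α) z)) =
    dirD κ e (dirE α) (dirD κ e (dirE α) (dirD κ e (dirF α) z)) := by
  rw [h.ddd_comm, h.dd_comm (dirF α)]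

lemma dirF_hS (h : HasRankOneHessian κ e z)
    (α : ℝ) : dirD κ e (dirF α) (dirD κ e (dirE α) (dirD κ e (dirF α) z)) =
    dirD κ e (dirE α) (dirD κ e (dirF α) (dirD κ e (dirF α) z)) := by
  rw [h.ddd_comm]

/-- The derivative of the relation `det = 0`. -/
lemma dirD_det (h : HasRankOneHessian κ e z) (α : ℝ) (v : E2) (m : M) :
    dirD κ e (dirF α) (dirD κ e (dirF α) z) m *
        dirD κ e v (dirD κ e (dirE α) (dirD κ e (dirE α) z)) m +
      dirD κ e (dirE α) (dirD κ e (dirE α) z) m *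
        dirD κ e v (dirD κ e (dirF α) (dirD κ e (dirF α) z)) m =
    2 * dirD κ e (dirE α) (dirD κ e (dirF α) z) m *
      dirD κ e v (dirD κ e (dirE α) (dirD κ e (dirF α) z)) m := by
  have hA := h.smooth_dd (dirF α) (dirF α)
  have hS := h.smooth_dd (dirE α) (dirF α)
  have hT := h.smooth_dd (dirE α) (dirE α)
  have h1 := dirD_mul (v := v) h.etale hA hT (mem_univ m)
  have h2 := dirD_mul (v := v) h.etale hS hS (mem_univ m)
  rw [← h1, funext (h.det α)]
  simp only [pow_two]
  rw [h2]; ring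

/-- In the differentiated relation `A dT + T dA = 2 S dS`, only `A dT` survives where `S = T = 0`,
and `A > 0` there. -/
lemma dirD_hT_eq_zero (h : HasRankOneHessian κ e z)
    (hS : dirD κ e (dirE α) (dirD κ e (dirF α) z) m = 0)
    (hT : dirD κ e (dirE α) (dirD κ e (dirE α) z) m = 0) (v : E2) :
    dirD κ e v (dirD κ e (dirE α) (dirD κ e (dirE α) z)) m = 0 := by
  have h1 := h.dirD_det α v m
  have h2 := h.pos α m
  rw [hS, hT] at h1
  rw [hT, add_zero] at h2
  have : dirD κ e (dirF α) (dirD κ e (dirF α) z) m *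
        dirD κ e v (dirD κ e (dirE α) (dirD κ e (dirE α) z)) m = 0 := by linarith
  exact (mul_eq_zero.1 this).resolve_left h2.ne'

lemma continuousOn_comp_lift (h : HasRankOneHessian κ e z)
    {f : M → ℝ} (hf : EtaleSmoothOn κ e univ f) {γ : ℝ → M} {s : Set ℝ}
    (hγ : ContinuousOn γ s) : ContinuousOn (fun τ => f (γ τ)) s := by
  have : Continuous f := continuous_iff_continuousAt.2 fun x => hf.continuousAt h.etale (mem_univ x)
  exact this.comp_continuousOn hγ

lemma deriv_lift (h : HasRankOneHessian κ e z)
    {f : M → ℝ} (hf : EtaleSmoothOn κ e univ f) {v : E2} {T : ℝ} {γ : ℝ → M}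
    (hγ : IsLift κ m v T γ) {τ : ℝ} (hτ : τ ∈ Icc 0 T) :
    HasDerivWithinAt (fun τ => f (γ τ)) (dirD κ e v f (γ τ)) (Icc 0 T) τ :=
  hasDerivWithinAt_lift h.etale hf hτ (mem_univ _) (hγ.cont τ hτ) hγ.lift

lemma const_lift (h : HasRankOneHessian κ e z)
    {f : M → ℝ} (hf : EtaleSmoothOn κ e univ f) {v : E2} {T : ℝ} {γ : ℝ → M}
    (hγ : IsLift κ m v T γ) (h0 : ∀ τ ∈ Icc 0 T, dirD κ e v f (γ τ) = 0) {τ : ℝ}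
    (hτ : τ ∈ Icc 0 T) : f (γ τ) = f m := by
  have hd : ∀ x ∈ Icc 0 T, HasDerivWithinAt (fun τ => f (γ τ)) 0 (Icc 0 T) x := fun x hx => by
    have := h.deriv_lift hf hγ hx
    rwa [h0 x hx] at this
  have := constant_of_derivWithin_zero (fun x hx => (hd x hx).differentiableWithinAt)
    (fun x hx => (hd x (Ico_subset_Icc_self hx)).derivWithin
      (uniqueDiffOn_Icc (hx.1.trans_lt hx.2) x (Ico_subset_Icc_self hx))) τ hτ
  rw [hγ.zero] at this
  exact this

/-- The kernel direction of the Hessian is preserved along the straight line it spans. -/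
lemma kernel_lift (h : HasRankOneHessian κ e z) (hS : dirD κ e (dirE α) (dirD κ e (dirF α) z) m = 0)
    (hT : dirD κ e (dirE α) (dirD κ e (dirE α) z) m = 0) {T : ℝ} {γ : ℝ → M}
    (hγ : IsLift κ m (dirE α) T γ) {τ : ℝ} (hτ : τ ∈ Icc 0 T) :
    dirD κ e (dirE α) (dirD κ e (dirF α) z) (γ τ) = 0 ∧
      dirD κ e (dirE α) (dirD κ e (dirE α) z) (γ τ) = 0 := by
  set A := dirD κ e (dirF α) (dirD κ e (dirF α) z) with hA
  set S := dirD κ e (dirE α) (dirD κ e (dirF α) z) with hSd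
  set B := dirD κ e (dirE α) (dirD κ e (dirE α) z) with hB
  have sA : EtaleSmoothOn κ e univ A := h.smooth_dd _ _
  have sS : EtaleSmoothOn κ e univ S := h.smooth_dd _ _
  have sB : EtaleSmoothOn κ e univ B := h.smooth_dd _ _
  have hpos : ∀ x, 0 < A x + B x := h.pos α
  -- Here `B` is `z_EE`. The differentiated determinant gives `(A + B) dB = 2 S dS - B dA + B dB`.
  -- All terms on the right carry a factor `S` or `B`, and `A + B` is positive on a compact
  -- interval.
  have key : ∀ v, ∃ K, ∀ τ ∈ Icc 0 T, |dirD κ e v B (γ τ)| ≤ K * max |S (γ τ)| |B (γ τ)| := by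
    intro v
    have c1 := h.continuousOn_comp_lift sA hγ.cont
    have c2 := h.continuousOn_comp_lift sB hγ.cont
    have c3 := h.continuousOn_comp_lift (sA.dirD h.etale v) hγ.cont
    have c4 := h.continuousOn_comp_lift (sB.dirD h.etale v) hγ.cont
    have c5 := h.continuousOn_comp_lift (sS.dirD h.etale v) hγ.cont
    have c6 : ContinuousOn (fun τ => (2 * |dirD κ e v S (γ τ)| + |dirD κ e v A (γ τ)| +
        |dirD κ e v B (γ τ)|) / (A (γ τ) + B (γ τ))) (Icc 0 T) :=
      ContinuousOn.div (by fun_prop) (c1.add c2) fun x _ => (hpos _).ne'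
    obtain ⟨K, hK⟩ := isCompact_Icc.exists_bound_of_continuousOn c6
    refine ⟨K, fun τ hτ => ?_⟩
    have h1 := h.dirD_det α v (γ τ)
    rw [← hA, ← hSd, ← hB] at h1
    have h2 : (A (γ τ) + B (γ τ)) * dirD κ e v B (γ τ) = 2 * S (γ τ) * dirD κ e v S (γ τ) -
      B (γ τ) * dirD κ e v A (γ τ) + B (γ τ) * dirD κ e v B (γ τ) := by linarith
    have h3 := hK τ hτ
    have hp := hpos (γ τ)
    rw [Real.norm_eq_abs, abs_of_nonneg (by positivity), div_le_iff₀ hp] at h3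
    set mx := max |S (γ τ)| |B (γ τ)| with hmx
    have m1 : |S (γ τ)| ≤ mx := le_max_left _ _
    have m2 : |B (γ τ)| ≤ mx := le_max_right _ _
    have m0 : 0 ≤ mx := (abs_nonneg _).trans m1
    have h4 : (A (γ τ) + B (γ τ)) * |dirD κ e v B (γ τ)| ≤ (2 * |dirD κ e v S (γ τ)| +
        |dirD κ e v A (γ τ)| + |dirD κ e v B (γ τ)|) * mx := by
      have h5 : (A (γ τ) + B (γ τ)) * |dirD κ e v B (γ τ)| =
          |(A (γ τ) + B (γ τ)) * dirD κ e v B (γ τ)| := by rw [abs_mul, abs_of_pos hp]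
      rw [h5, h2]
      refine (abs_add_le _ _).trans ((add_le_add_left (abs_sub _ _) _).trans ?_)
      rw [abs_mul, abs_mul, abs_mul, abs_mul, abs_two]
      nlinarith [mul_le_mul_of_nonneg_right m1 (abs_nonneg (dirD κ e v S (γ τ))),
        mul_le_mul_of_nonneg_right m2 (abs_nonneg (dirD κ e v A (γ τ))),
        mul_le_mul_of_nonneg_right m2 (abs_nonneg (dirD κ e v B (γ τ)))]
    have h5 := h4.trans (mul_le_mul_of_nonneg_right h3 m0)
    have h6 : (A (γ τ) + B (γ τ)) * |dirD κ e v B (γ τ)| ≤ (A (γ τ) + B (γ τ)) * (K * mx) := by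
      linarith
    exact le_of_mul_le_mul_left h6 hp
  obtain ⟨K₁, hK₁⟩ := key (dirF α)
  obtain ⟨K₂, hK₂⟩ := key (dirE α)
  -- Gronwall for the pair `(S, B)`. The derivative of `S` along `E` equals the derivative of `B`
  -- along `F`, so `key` bounds both components.
  have hg := eq_zero_of_abs_deriv_le_mul_abs_self_of_eq_zero_right
    (f := fun τ => (S (γ τ), B (γ τ))) (a := 0) (b := T) (K := max K₁ K₂)
    (f' := fun τ => (dirD κ e (dirE α) S (γ τ), dirD κ e (dirE α) B (γ τ)))
    ((h.continuousOn_comp_lift sS hγ.cont).prodMk (h.continuousOn_comp_lift sB hγ.cont))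
    (fun x hx => by
      have hx' := Ico_subset_Icc_self hx
      exact ((h.deriv_lift sS hγ hx').prodMk (h.deriv_lift sB hγ hx')).mono_of_mem_nhdsWithin
        (mem_of_superset (Icc_mem_nhdsGE hx.2) (Icc_subset_Icc_left hx.1)))
    (by simp [hγ.zero, hS, hT])
    (fun x hx => by
      have hx' := Ico_subset_Icc_self hx
      have h0 : 0 ≤ max |S (γ x)| |B (γ x)| := (abs_nonneg _).trans (le_max_left _ _)
      rw [Prod.norm_def, Prod.norm_def]
      simp only [Real.norm_eq_abs]
      rw [hSd, ← h.dirF_hT, ← hB, ← hSd]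
      refine max_le ((hK₁ x hx').trans ?_) ((hK₂ x hx').trans ?_)
      · exact mul_le_mul_of_nonneg_right (le_max_left _ _) h0
      · exact mul_le_mul_of_nonneg_right (le_max_right _ _) h0) τ hτ
  exact ⟨congrArg Prod.fst hg, congrArg Prod.snd hg⟩

/-- If the line spanned by the kernel direction lifts for all positive times, the Hessian cannot
increase along it. -/
lemma dirE_hA_nonpos (h : HasRankOneHessian κ e z)
    (hS : dirD κ e (dirE α) (dirD κ e (dirF α) z) m = 0)
    (hT : dirD κ e (dirE α) (dirD κ e (dirE α) z) m = 0)
    (hlift : ∀ T, 0 ≤ T → ∃ γ, IsLift κ m (dirE α) T γ) :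
    dirD κ e (dirE α) (dirD κ e (dirF α) (dirD κ e (dirF α) z)) m ≤ 0 := by
  set A := dirD κ e (dirF α) (dirD κ e (dirF α) z) with hA
  by_contra! hpos
  have sA : EtaleSmoothOn κ e univ A := h.smooth_dd _ _
  have sA1 := sA.dirD h.etale (dirE α)
  have hA0 : 0 < A m := by simpa [hT] using h.pos α m
  -- At this time the affine function `1 / A`, which starts at `1 / A m` with slope `-A' / A²`,
  -- would reach zero.
  set T := A m / dirD κ e (dirE α) A m with hTd
  have hT0 : 0 < T := by positivity
  obtain ⟨γ, hγ⟩ := hlift T hT0.le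
  have hker := fun τ (hτ : τ ∈ Icc 0 T) => h.kernel_lift hS hT hγ hτ
  have hAp : ∀ τ ∈ Icc 0 T, 0 < A (γ τ) := fun τ hτ => by
    simpa [(hker τ hτ).2] using h.pos α (γ τ)
  -- Differentiating the determinant relation twice along `F` at a point where `S`, `T` and `dT`
  -- vanish leaves `A T_FF = 2 S_F²`. The symmetry of derivatives turns this into `A A_EE = 2 A_E²`,
  -- that is, `(1 / A)'' = 0` along the line.
  have hA2 : ∀ τ ∈ Icc 0 T, A (γ τ) * dirD κ e (dirE α) (dirD κ e (dirE α) A) (γ τ) =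
      2 * dirD κ e (dirE α) A (γ τ) ^ 2 := by
    intro τ hτ
    have sS := h.smooth_dd (dirE α) (dirF α)
    have sB := h.smooth_dd (dirE α) (dirE α)
    obtain ⟨k1, k2⟩ := hker τ hτ
    have k3 := h.dirD_hT_eq_zero k1 k2 (dirF α)
    have e1 : dirD κ e (dirE α) (dirD κ e (dirE α) A) = dirD κ e (dirF α) (dirD κ e (dirF α)
        (dirD κ e (dirE α) (dirD κ e (dirE α) z))) := by
      rw [hA, ← h.dirF_hS, h.dirF_hT]
      exact funext fun x => dirD_comm h.etale sS (mem_univ x) _ _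
    have d1 := funext (h.dirD_det α (dirF α))
    have d2 := congrArg (fun f => dirD κ e (dirF α) f (γ τ)) d1
    have sBF := sB.dirD h.etale (dirF α)
    have sSF := sS.dirD h.etale (dirF α)
    have sAF := sA.dirD h.etale (dirF α)
    rw [dirD_add (sA.mul sBF) (sB.mul sAF) (mem_univ _), dirD_mul h.etale sA sBF (mem_univ _),
      dirD_mul h.etale sB sAF (mem_univ _),
      dirD_mul h.etale (sS.const_mul 2) sSF (mem_univ _), dirD_const_mul h.etale 2 sS (mem_univ _),
      k1, k2, k3, ← e1, h.dirF_hS, ← hA] at d2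
    linarith
  -- This is minus the slope of `1 / A`.
  set k1 : ℝ → ℝ := fun τ => dirD κ e (dirE α) A (γ τ) / A (γ τ) ^ 2 with hk1
  have hk1c : ∀ τ ∈ Icc 0 T, k1 τ = k1 0 := by
    have hd : ∀ x ∈ Icc 0 T, HasDerivWithinAt k1 0 (Icc 0 T) x := fun x hx => by
      have h1 := h.deriv_lift sA hγ hx
      have h2 := h.deriv_lift sA1 hγ hx
      have h3 := h2.div (h1.pow 2) (pow_ne_zero 2 (hAp x hx).ne')
      refine h3.congr_deriv ?_
      have := hAp x hx
      have h4 := hA2 x hx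
      rw [div_eq_zero_iff]
      left
      simp only [Pi.pow_apply, Nat.cast_ofNat]
      norm_num
      linear_combination (A (γ x)) * h4
    exact constant_of_derivWithin_zero (fun x hx => (hd x hx).differentiableWithinAt)
      (fun x hx => (hd x (Ico_subset_Icc_self hx)).derivWithin
        (uniqueDiffOn_Icc (hx.1.trans_lt hx.2) x (Ico_subset_Icc_self hx)))
  have hk : ∀ τ ∈ Icc 0 T, (A (γ τ))⁻¹ + k1 0 * τ = (A (γ 0))⁻¹ + k1 0 * 0 := by
    have hd : ∀ x ∈ Icc 0 T, HasDerivWithinAt (fun τ => (A (γ τ))⁻¹ + k1 0 * τ) 0 (Icc 0 T) x := by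
      intro x hx
      have h1 := h.deriv_lift sA hγ hx
      have h3 := (h1.inv (hAp x hx).ne').add ((hasDerivWithinAt_id x _).const_mul (k1 0))
      refine h3.congr_deriv ?_
      rw [← hk1c x hx, hk1]
      ring
    exact constant_of_derivWithin_zero (fun x hx => (hd x hx).differentiableWithinAt)
      (fun x hx => (hd x (Ico_subset_Icc_self hx)).derivWithin
        (uniqueDiffOn_Icc (hx.1.trans_lt hx.2) x (Ico_subset_Icc_self hx)))
  have hfin := hk T ⟨hT0.le, le_rfl⟩
  have hi := inv_pos.2 (hAp T ⟨hT0.le, le_rfl⟩)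
  have e2 : k1 0 * T = (A m)⁻¹ := by
    simp only [hk1, hγ.zero, hTd]
    field_simp
  rw [e2, hγ.zero] at hfin
  linarith

end HasRankOneHessian

end Ruling

/-! ### Nowhere vertical surfaces: the kernel direction is constant -/

section Graph

/-- The projection of three-space to the horizontal plane. -/
def horProj : E3 →L[ℝ] E2 := frameProj (EuclideanSpace.basisFun (Fin 3) ℝ)

lemma horProj_zero (v : E3) : horProj v 0 = v 0 := by
  simp [horProj, frameProj_zero, EuclideanSpace.inner_single_left]

lemma horProj_one (v : E3) : horProj v 1 = v 1 := by
  simp [horProj, frameProj_one, EuclideanSpace.inner_single_left]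

lemma dirD_dirE {M F : Type*} [TopologicalSpace M] [ChartedSpace E2 M] [NormedAddCommGroup F]
    [NormedSpace ℝ F] (κ : M → E2) (e : M → OpenPartialHomeomorph M E2) (α : ℝ) (f : M → F)
    (m : M) : dirD κ e (dirE α) f m =
      (-Real.sin α) • dirD κ e (ε 0) f m + Real.cos α • dirD κ e (ε 1) f m :=
  dirD_eq_sum κ e _ f m

lemma dirD_dirF {M F : Type*} [TopologicalSpace M] [ChartedSpace E2 M] [NormedAddCommGroup F]
    [NormedSpace ℝ F] (κ : M → E2) (e : M → OpenPartialHomeomorph M E2) (α : ℝ) (f : M → F)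
    (m : M) : dirD κ e (dirF α) f m =
      Real.cos α • dirD κ e (ε 0) f m + Real.sin α • dirD κ e (ε 1) f m :=
  dirD_eq_sum κ e _ f m

variable {M : Type*} [TopologicalSpace M] [ChartedSpace E2 M] [IsManifold (𝓡 2) ∞ M]
  {ψ : M → E3} {φ : ℝ → ℝ} {e : M → OpenPartialHomeomorph M E2}

lemma smooth_height (hψ : ContMDiff (𝓡 2) 𝓘(ℝ, E3) ∞ ψ) {κ : M → E2} {U : Set M}
    (h : IsEtaleOn κ e U) : EtaleSmoothOn κ e U fun m => ψ m 2 :=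
  EtaleSmoothOn.comp (EuclideanSpace.proj (𝕜 := ℝ) 2).contDiff (etaleSmoothOn_of_contMDiff h hψ)

lemma dirD_dirD_frame {κ : M → E2} (h : IsEtaleOn κ e univ) {z : M → ℝ}
    (hz : EtaleSmoothOn κ e univ z) (a b c d : ℝ) (m : M) {v w : E2}
    (hv : ∀ f : M → ℝ, ∀ m, dirD κ e v f m = a * dirD κ e (ε 0) f m + b * dirD κ e (ε 1) f m)
    (hw : ∀ f : M → ℝ, ∀ m, dirD κ e w f m = c * dirD κ e (ε 0) f m + d * dirD κ e (ε 1) f m) :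
    dirD κ e v (dirD κ e w z) m = a * c * dirD κ e (ε 0) (dirD κ e (ε 0) z) m +
      (a * d + b * c) * dirD κ e (ε 0) (dirD κ e (ε 1) z) m +
      b * d * dirD κ e (ε 1) (dirD κ e (ε 1) z) m := by
  have s0 := hz.dirD h (ε 0)
  have s1 := hz.dirD h (ε 1)
  rw [funext (hw z), dirD_add (s0.const_mul c) (s1.const_mul d) (mem_univ m),
    dirD_const_mul h c s0 (mem_univ m), dirD_const_mul h d s1 (mem_univ m), hv, hv,
    dirD_comm h hz (mem_univ m) (ε 1) (ε 0)]
  ring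

/-- The equations are first obtained in the standard basis. They are invariant under rotation of the
horizontal plane, so they hold in every frame `(dirE α, dirF α)`. -/
lemma graph_pde (hψ : ContMDiff (𝓡 2) 𝓘(ℝ, E3) ∞ ψ) (hflat : IsFlat ψ)
    (hmin : IsPhiMinimal φ ψ) {κ : M → E2} (hκ : κ = fun m => horProj (ψ m))
    (h : IsEtaleOn κ e univ) (hinj : ∀ p v, horProj (dMap ψ p v) = 0 → v = 0) {z : M → ℝ}
    (hz : z = fun m => ψ m 2) (α : ℝ) (m : M) :
    dirD κ e (dirF α) (dirD κ e (dirF α) z) m * dirD κ e (dirE α) (dirD κ e (dirE α) z) m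
      = dirD κ e (dirE α) (dirD κ e (dirF α) z) m ^ 2 ∧
    (1 + dirD κ e (dirE α) z m ^ 2) * dirD κ e (dirF α) (dirD κ e (dirF α) z) m -
      2 * dirD κ e (dirF α) z m * dirD κ e (dirE α) z m *
        dirD κ e (dirE α) (dirD κ e (dirF α) z) m +
      (1 + dirD κ e (dirF α) z m ^ 2) * dirD κ e (dirE α) (dirD κ e (dirE α) z) m =
    deriv φ (z m) * (1 + dirD κ e (dirF α) z m ^ 2 + dirD κ e (dirE α) z m ^ 2) := by
  have hzi : z = fun m => inner ℝ ((EuclideanSpace.basisFun (Fin 3) ℝ) 2) (ψ m) := by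
    rw [hz]; funext m; simp [EuclideanSpace.inner_single_left]
  have hzs : EtaleSmoothOn κ e univ z := by rw [hz]; exact smooth_height hψ h
  obtain ⟨h1, h2⟩ := phiMinimal_pde hψ hflat hmin (EuclideanSpace.basisFun (Fin 3) ℝ) hκ h
    (mem_univ m) (hinj m) hzi rfl rfl rfl rfl rfl
  have hE : ∀ f : M → ℝ, ∀ m, dirD κ e (dirE α) f m = (-Real.sin α) * dirD κ e (ε 0) f m +
    Real.cos α * dirD κ e (ε 1) f m := fun f m => dirD_dirE κ e α f m
  have hF : ∀ f : M → ℝ, ∀ m, dirD κ e (dirF α) f m = Real.cos α * dirD κ e (ε 0) f m +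
    Real.sin α * dirD κ e (ε 1) f m := fun f m => dirD_dirF κ e α f m
  rw [dirD_dirD_frame h hzs _ _ _ _ m hF hF, dirD_dirD_frame h hzs _ _ _ _ m hE hE,
    dirD_dirD_frame h hzs _ _ _ _ m hE hF, hE z m, hF z m]
  have hm : z m = ψ m 2 := by rw [hz]
  have hb : (EuclideanSpace.basisFun (Fin 3) ℝ 2 2 - dirD κ e (ε 0) z m *
      EuclideanSpace.basisFun (Fin 3) ℝ 0 2 - dirD κ e (ε 1) z m *
      EuclideanSpace.basisFun (Fin 3) ℝ 1 2) = 1 := by simp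
  rw [hb, mul_one, ← hm] at h2
  have hsc := Real.sin_sq_add_cos_sq α
  set c := Real.cos α
  set s := Real.sin α
  generalize dirD κ e (ε 0) (dirD κ e (ε 0) z) m = r at *
  generalize dirD κ e (ε 0) (dirD κ e (ε 1) z) m = q at *
  generalize dirD κ e (ε 1) (dirD κ e (ε 1) z) m = t at *
  generalize dirD κ e (ε 0) z m = w₁ at *
  generalize dirD κ e (ε 1) z m = w₂ at *
  constructor
  · have : (s ^ 2 + c ^ 2) ^ 2 * (r * t - q ^ 2) = 0 := by rw [h1]; ring
    linear_combination this
  · have e1 : (1 + (-s * w₁ + c * w₂) ^ 2) * (c * c * r + (c * s + s * c) * q + s * s * t) -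
        2 * (c * w₁ + s * w₂) * (-s * w₁ + c * w₂) *
          (-s * c * r + (-s * s + c * c) * q + c * s * t) +
        (1 + (c * w₁ + s * w₂) ^ 2) * (-s * -s * r + (-s * c + c * -s) * q + c * c * t) =
        (s ^ 2 + c ^ 2) * (r + t) +
          (s ^ 2 + c ^ 2) ^ 2 * (w₂ ^ 2 * r - 2 * w₁ * w₂ * q + w₁ ^ 2 * t) := by ring
    have e2 : 1 + (c * w₁ + s * w₂) ^ 2 + (-s * w₁ + c * w₂) ^ 2 =
        1 + (s ^ 2 + c ^ 2) * (w₁ ^ 2 + w₂ ^ 2) := by ring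
    rw [e1, e2, hsc]
    linear_combination h2

/-- With determinant zero the Hessian is semidefinite. If its trace were nonpositive, the left-hand
side of the minimality equation would be nonpositive, against `φ' > 0`. -/
lemma hasRankOneHessian (hψ : ContMDiff (𝓡 2) 𝓘(ℝ, E3) ∞ ψ) (hφ : ∀ x, 0 < deriv φ x)
    (hflat : IsFlat ψ) (hmin : IsPhiMinimal φ ψ) {κ : M → E2}
    (hκ : κ = fun m => horProj (ψ m)) (h : IsEtaleOn κ e univ)
    (hinj : ∀ p v, horProj (dMap ψ p v) = 0 → v = 0) {z : M → ℝ} (hz : z = fun m => ψ m 2) :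
    HasRankOneHessian κ e z := by
  refine ⟨h, by rw [hz]; exact smooth_height hψ h, fun α m =>
    (graph_pde hψ hflat hmin hκ h hinj hz α m).1, fun α m => ?_⟩
  obtain ⟨h1, h2⟩ := graph_pde hψ hflat hmin hκ h hinj hz α m
  have hφm := hφ (z m)
  set A := dirD κ e (dirF α) (dirD κ e (dirF α) z) m
  set S := dirD κ e (dirE α) (dirD κ e (dirF α) z) m
  set T := dirD κ e (dirE α) (dirD κ e (dirE α) z) m
  by_contra! hle
  have hpos : 0 < deriv φ (z m) * (1 + dirD κ e (dirF α) z m ^ 2 + dirD κ e (dirE α) z m ^ 2) := by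
    positivity
  have hA : A ≤ 0 := by
    by_contra hA
    nlinarith [sq_nonneg S]
  have hT : T ≤ 0 := by
    by_contra hT
    nlinarith [sq_nonneg S]
  set p := dirD κ e (dirF α) z m
  set b := dirD κ e (dirE α) z m
  have hX : b ^ 2 * A - 2 * p * b * S + p ^ 2 * T ≤ 0 := by
    rcases hA.eq_or_lt with h0 | h0
    · have hS : S = 0 := by
        rw [h0, zero_mul] at h1; exact pow_eq_zero_iff (two_ne_zero) |>.1 h1.symm
      rw [h0, hS]; nlinarith [mul_nonneg (sq_nonneg p) (neg_nonneg.2 hT)]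
    · have e1 : A * (b ^ 2 * A - 2 * p * b * S + p ^ 2 * T) = (b * A - p * S) ^ 2 := by
        linear_combination p ^ 2 * h1
      by_contra! hX
      nlinarith [sq_nonneg (b * A - p * S)]
  linarith

lemma ext_horProj {v w : E3} (h : horProj v = horProj w) (h2 : v 2 = w 2) : v = w := by
  have h0 := congrArg (fun x : E2 => x 0) h
  have h1 := congrArg (fun x : E2 => x 1) h
  simp only [horProj_zero, horProj_one] at h0 h1
  ext i; fin_cases i <;> assumption

lemma dirD_eq_of_height (hψ : ContMDiff (𝓡 2) 𝓘(ℝ, E3) ∞ ψ)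
    (h : IsEtaleOn (fun m => horProj (ψ m)) e univ) (v : E2) (m : M) :
    dirD (fun m => horProj (ψ m)) e v ψ m =
      !₂[v 0, v 1, dirD (fun m => horProj (ψ m)) e v (fun m => ψ m 2) m] := by
  have h1 := frameProj_dirD hψ h (mem_univ m) v
  have h2 : dirD (fun m => horProj (ψ m)) e v (fun m => ψ m 2) m =
      dirD (fun m => horProj (ψ m)) e v ψ m 2 :=
    dirD_clm (etaleSmoothOn_of_contMDiff h hψ) (EuclideanSpace.proj (𝕜 := ℝ) 2) (mem_univ m)
  refine ext_horProj ?_ ?_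
  · rw [h1]
    ext i; fin_cases i
    · simp [horProj_zero]
    · simp [horProj_one]
  · rw [← h2]; simp

/-- The slope of the height in the kernel direction is constant along the lift, so the lift has
constant speed and completeness extends it to any time. -/
lemma exists_lift_kernel [T2Space M] (hψ : ContMDiff (𝓡 2) 𝓘(ℝ, E3) ∞ ψ)
    (hc : IsCompleteSurface ψ)
    (h : HasRankOneHessian (fun m => horProj (ψ m)) e fun m => ψ m 2) {α : ℝ} {m : M}
    (hS : dirD (fun m => horProj (ψ m)) e (dirE α)
      (dirD (fun m => horProj (ψ m)) e (dirF α) fun m => ψ m 2) m = 0)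
    (hT : dirD (fun m => horProj (ψ m)) e (dirE α)
      (dirD (fun m => horProj (ψ m)) e (dirE α) fun m => ψ m 2) m = 0) (T : ℝ) (hT0 : 0 ≤ T) :
    ∃ γ, IsLift (fun m => horProj (ψ m)) m (dirE α) T γ := by
  refine exists_isLift (L := horProj) hψ hc (norm_frameProj_le _) h.etale hT0
    (C := ‖(!₂[dirE α 0, dirE α 1,
      dirD (fun m => horProj (ψ m)) e (dirE α) (fun m => ψ m 2) m] : E3)‖) ?_
  intro T' γ h0 h1 hγ
  rw [dirD_eq_of_height hψ h.etale, h.const_lift (h.smooth.dirD h.etale _) hγ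
    (fun τ hτ => (h.kernel_lift hS hT hγ hτ).2) ⟨h0, le_rfl⟩]

namespace HasRankOneHessian

variable {κ : M → E2} {z : M → ℝ}

/-- A half turn reverses both frame vectors and keeps the second derivatives, so statements about
positive times also apply to the opposite ray. -/
lemma frame_add_pi (h : HasRankOneHessian κ e z) (α : ℝ) :
    dirD κ e (dirE (α + Real.pi)) (dirD κ e (dirF (α + Real.pi)) z) =
      dirD κ e (dirE α) (dirD κ e (dirF α) z) ∧
    dirD κ e (dirE (α + Real.pi)) (dirD κ e (dirE (α + Real.pi)) z) =
      dirD κ e (dirE α) (dirD κ e (dirE α) z) ∧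
    dirD κ e (dirF (α + Real.pi)) (dirD κ e (dirF (α + Real.pi)) z) =
      dirD κ e (dirF α) (dirD κ e (dirF α) z) := by
  have key : ∀ v w, dirD κ e (-v) (dirD κ e (-w) z) = dirD κ e v (dirD κ e w z) := by
    intro v w
    funext m
    have : dirD κ e (-w) z = fun x => (-1) * dirD κ e w z x := by
      funext x; rw [dirD_neg]; ring
    rw [dirD_neg, this, dirD_const_mul h.etale _ (h.smooth.dirD h.etale w) (mem_univ m)]
    ring
  simp only [dirE_add_pi, dirF_add_pi, key, and_self]

lemma exists_kernel_at (h : HasRankOneHessian κ e z)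
    (m : M) : ∃ α, dirD κ e (dirE α) (dirD κ e (dirF α) z) m = 0 ∧
    dirD κ e (dirE α) (dirD κ e (dirE α) z) m = 0 := by
  have hdet := h.det 0 m
  have hpos := h.pos 0 m
  set A := dirD κ e (dirF 0) (dirD κ e (dirF 0) z) m with hA
  set S := dirD κ e (dirE 0) (dirD κ e (dirF 0) z) m with hS
  set T := dirD κ e (dirE 0) (dirD κ e (dirE 0) z) m with hT
  have e0 : dirE 0 = ε 1 := by ext i; fin_cases i <;> simp [dirE, ε]
  have f0 : dirF 0 = ε 0 := by ext i; fin_cases i <;> simp [dirF, ε]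
  rw [f0] at hA
  rw [e0, f0, h.dd_comm] at hS
  rw [e0] at hT
  -- `(x, y)` is the unit vector along the image of the Hessian, and the kernel is spanned by `(-y,
  -- x)`. The first row `(A, S)` spans the image unless `A = 0`; then `S = 0` and the kernel is the
  -- first axis.
  obtain ⟨x, y, hxy, h1, h2⟩ : ∃ x y : ℝ, x ^ 2 + y ^ 2 = 1 ∧ -y * A + x * S = 0 ∧
      -y * S + x * T = 0 := by
    by_cases h0 : A = 0
    · have : S = 0 := by
        rw [h0, zero_mul] at hdet; exact pow_eq_zero_iff (two_ne_zero) |>.1 hdet.symm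
      exact ⟨0, 1, by simp, by simp [h0], by simp [this]⟩
    · have hN : 0 < A ^ 2 + S ^ 2 := by positivity
      have hN2 := Real.sq_sqrt hN.le
      have hN0 := Real.sqrt_pos.2 hN
      set N := Real.sqrt (A ^ 2 + S ^ 2)
      refine ⟨A / N, S / N, ?_, ?_, ?_⟩
      · field_simp; linarith
      · field_simp; ring
      · field_simp; linarith
  obtain ⟨α, rfl, rfl⟩ := exists_cos_sin hxy
  have hE : ∀ f : M → ℝ, ∀ m, dirD κ e (dirE α) f m = (-Real.sin α) * dirD κ e (ε 0) f m +
    Real.cos α * dirD κ e (ε 1) f m := fun f m => dirD_dirE κ e α f m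
  have hF : ∀ f : M → ℝ, ∀ m, dirD κ e (dirF α) f m = Real.cos α * dirD κ e (ε 0) f m +
    Real.sin α * dirD κ e (ε 1) f m := fun f m => dirD_dirF κ e α f m
  refine ⟨α, ?_, ?_⟩
  · rw [dirD_dirD_frame h.etale h.smooth _ _ _ _ m hE hF, ← hA, ← hS, ← hT]
    linear_combination Real.cos α * h1 + Real.sin α * h2
  · rw [dirD_dirD_frame h.etale h.smooth _ _ _ _ m hE hE, ← hA, ← hS, ← hT]
    linear_combination -Real.sin α * h1 + Real.cos α * h2

/-- The eigenvalue can increase in neither direction of the ruling, since both rays lift for all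
times. -/
lemma dirE_hA_eq_zero (h : HasRankOneHessian κ e z)
  (hl : ∀ α m, dirD κ e (dirE α) (dirD κ e (dirF α) z) m = 0 →
    dirD κ e (dirE α) (dirD κ e (dirE α) z) m = 0 →
    ∀ T, 0 ≤ T → ∃ γ, IsLift κ m (dirE α) T γ)
    {α : ℝ} {m : M} (hS : dirD κ e (dirE α) (dirD κ e (dirF α) z) m = 0)
    (hT : dirD κ e (dirE α) (dirD κ e (dirE α) z) m = 0) :
    dirD κ e (dirE α) (dirD κ e (dirF α) (dirD κ e (dirF α) z)) m = 0 := by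
  refine le_antisymm (h.dirE_hA_nonpos hS hT (hl α m hS hT)) ?_
  obtain ⟨e1, e2, e3⟩ := h.frame_add_pi α
  have := h.dirE_hA_nonpos (α := α + Real.pi) (m := m) (by rw [e1, hS]) (by rw [e2, hT])
    (hl _ m (by rw [e1, hS]) (by rw [e2, hT]))
  rw [e3, dirE_add_pi, dirD_neg] at this
  linarith

/-- The derivatives of `S` along `E` and `F` are those of `T` along `F` and of `A` along `E`, and
both vanish. This is the infinitesimal form of the kernel direction not turning. -/
lemma dirD_hS_eq_zero (h : HasRankOneHessian κ e z)
  (hl : ∀ α m, dirD κ e (dirE α) (dirD κ e (dirF α) z) m = 0 →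
    dirD κ e (dirE α) (dirD κ e (dirE α) z) m = 0 →
    ∀ T, 0 ≤ T → ∃ γ, IsLift κ m (dirE α) T γ)
    {α : ℝ} {m : M} (hS : dirD κ e (dirE α) (dirD κ e (dirF α) z) m = 0)
    (hT : dirD κ e (dirE α) (dirD κ e (dirE α) z) m = 0) (v : E2) :
    dirD κ e v (dirD κ e (dirE α) (dirD κ e (dirF α) z)) m = 0 := by
  rw [eq_dirE_dirF α v, dirD_add_smul, ← h.dirF_hT, h.dirD_hT_eq_zero hS hT, h.dirF_hS,
    h.dirE_hA_eq_zero hl hS hT]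
  simp

/-- The kernel of the Hessian is constant. -/
lemma exists_kernel (h : HasRankOneHessian κ e z)
  (hl : ∀ α m, dirD κ e (dirE α) (dirD κ e (dirF α) z) m = 0 →
    dirD κ e (dirE α) (dirD κ e (dirE α) z) m = 0 →
    ∀ T, 0 ≤ T → ∃ γ, IsLift κ m (dirE α) T γ)
    [ConnectedSpace M] :
    ∃ α, ∀ m v, dirD κ e v (dirD κ e (dirE α) z) m = 0 := by
  obtain ⟨m₀⟩ := (inferInstance : Nonempty M)
  obtain ⟨β, -, hT₀⟩ := h.exists_kernel_at m₀
  set T := dirD κ e (dirE β) (dirD κ e (dirE β) z) with hTd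
  set R : M → ℝ := fun m => dirD κ e (dirF β) (dirD κ e (dirF β) z) m + T m with hR
  have sT : EtaleSmoothOn κ e univ T := h.smooth_dd _ _
  have sR : EtaleSmoothOn κ e univ R := (h.smooth_dd _ _).add sT
  have hR0 : ∀ m, R m ≠ 0 := fun m => (h.pos β m).ne'
  have hRf : ∀ γ, R = fun m => dirD κ e (dirF γ) (dirD κ e (dirF γ) z) m +
      dirD κ e (dirE γ) (dirD κ e (dirE γ) z) m := by
    have : ∀ γ m, dirD κ e (dirF γ) (dirD κ e (dirF γ) z) m +
      dirD κ e (dirE γ) (dirD κ e (dirE γ) z) m = dirD κ e (ε 0) (dirD κ e (ε 0) z) m +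
        dirD κ e (ε 1) (dirD κ e (ε 1) z) m := by
      intro γ m
      rw [dirD_dirD_frame h.etale h.smooth _ _ _ _ m (fun f m => dirD_dirE κ e γ f m)
        (fun f m => dirD_dirE κ e γ f m), dirD_dirD_frame h.etale h.smooth _ _ _ _ m
        (fun f m => dirD_dirF κ e γ f m) (fun f m => dirD_dirF κ e γ f m)]
      have := Real.sin_sq_add_cos_sq γ
      linear_combination (dirD κ e (ε 0) (dirD κ e (ε 0) z) m +
        dirD κ e (ε 1) (dirD κ e (ε 1) z) m) * this
    intro γ
    funext m
    rw [this, ← this β]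
  -- `Q` is the squared sine of the angle between `dirE β` and the kernel at the varying point.
  -- Working with it avoids a smooth choice of the kernel angle. It is shown to have zero derivative
  -- everywhere, and it vanishes at `m₀`.
  set Q : M → ℝ := fun m => T m / R m with hQ
  have sQ : EtaleSmoothOn κ e univ Q := sT.div sR h.etale fun m _ => hR0 m
  have hQ0 : ∀ m v, dirD κ e v Q m = 0 := by
    intro m v
    obtain ⟨α, hS, hT⟩ := h.exists_kernel_at m
    set x := Real.cos (β - α)
    set y := -Real.sin (β - α)
    have sA' := h.smooth_dd (dirF α) (dirF α)
    have sS' := h.smooth_dd (dirE α) (dirF α)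
    have sT' := h.smooth_dd (dirE α) (dirE α)
    -- `α` is the kernel angle at the single point `m` and is then kept fixed. Expanding `T` in this
    -- frame reduces its derivative at `m` to the `A` term.
    have hTf : T = fun m => x * x * dirD κ e (dirE α) (dirD κ e (dirE α) z) m +
        (2 * x * y) * dirD κ e (dirE α) (dirD κ e (dirF α) z) m +
        y * y * dirD κ e (dirF α) (dirD κ e (dirF α) z) m := by
      funext m
      have hw : dirD κ e (dirE β) z = fun m => x * dirD κ e (dirE α) z m +
          y * dirD κ e (dirF α) z m := by
        funext m; rw [dirE_eq α β]; exact dirD_add_smul z x y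
      have s1 := h.smooth.dirD h.etale (dirE α)
      have s2 := h.smooth.dirD h.etale (dirF α)
      rw [hTd, hw, dirE_eq α β, dirD_add_smul,
        dirD_add (s1.const_mul _) (s2.const_mul _) (mem_univ m),
        dirD_add (s1.const_mul _) (s2.const_mul _) (mem_univ m),
        dirD_const_mul h.etale _ s1 (mem_univ m), dirD_const_mul h.etale _ s1 (mem_univ m),
        dirD_const_mul h.etale _ s2 (mem_univ m), dirD_const_mul h.etale _ s2 (mem_univ m),
        h.dd_comm (dirF α) (dirE α)]
      simp only [smul_eq_mul]; ring
    have hdT : dirD κ e v T m = y * y * dirD κ e v (dirD κ e (dirF α) (dirD κ e (dirF α) z)) m := by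
      rw [hTf, dirD_add ((sT'.const_mul _).add (sS'.const_mul _)) (sA'.const_mul _) (mem_univ m),
        dirD_add (sT'.const_mul _) (sS'.const_mul _) (mem_univ m),
        dirD_const_mul h.etale _ sT' (mem_univ m), dirD_const_mul h.etale _ sS' (mem_univ m),
        dirD_const_mul h.etale _ sA' (mem_univ m), h.dirD_hT_eq_zero hS hT,
        h.dirD_hS_eq_zero hl hS hT]
      ring
    have hdR : dirD κ e v R m = dirD κ e v (dirD κ e (dirF α) (dirD κ e (dirF α) z)) m := by
      rw [hRf α, dirD_add sA' sT' (mem_univ m), h.dirD_hT_eq_zero hS hT, add_zero]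
    have hTm : T m = y * y * R m := by
      rw [hTf, hRf α]; simp only [hS, hT]; ring
    have hmul := dirD_mul (v := v) h.etale sQ sR (mem_univ m)
    have hQR : (fun x => Q x * R x) = T := by
      funext x; exact div_mul_cancel₀ _ (hR0 x)
    have hQm : Q m = y * y := by rw [hQ]; simp only [hTm]; exact mul_div_cancel_right₀ _ (hR0 m)
    rw [hQR, hdT, hdR, hQm] at hmul
    have : R m * dirD κ e v Q m = 0 := by linarith
    exact (mul_eq_zero.1 this).resolve_left (hR0 m)
  have hT0 : ∀ m, T m = 0 := by
    intro m
    have h1 := eq_of_dirD_eq_zero h.etale sQ hQ0 m m₀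
    simp only [hQ, hT₀, zero_div] at h1
    exact (div_eq_zero_iff.1 h1).resolve_right (hR0 m)
  refine ⟨β, fun m v => ?_⟩
  have hS0 : dirD κ e (dirF β) (dirD κ e (dirE β) z) m = 0 := by
    have := h.det β m
    rw [← hTd, hT0, mul_zero] at this
    rw [h.dd_comm]
    exact pow_eq_zero_iff (two_ne_zero) |>.1 this.symm
  rw [eq_dirE_dirF β v, dirD_add_smul, ← hTd, hT0, hS0]; simp

end HasRankOneHessian

end Graph

/-! ### The catenary parametrized by its slope -/

section Profile

lemma contDiff_log_one_add_sq : ContDiff ℝ ∞ fun q : ℝ => Real.log (1 + q ^ 2) / 2 := by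
  have : ContDiff ℝ ∞ fun q : ℝ => Real.log (1 + q ^ 2) :=
    ContDiff.log (by fun_prop) fun q => by positivity
  fun_prop

lemma hasDerivAt_log_one_add_sq (q : ℝ) :
    HasDerivAt (fun q : ℝ => Real.log (1 + q ^ 2) / 2) (q / (1 + q ^ 2)) q := by
  have hq : 1 + q ^ 2 ≠ 0 := by positivity
  have := ((((hasDerivAt_id q).pow 2).const_add 1).log hq).div_const 2
  refine this.congr_deriv ?_
  simp only [id, Pi.pow_apply]
  field_simp
  norm_num
  ring

variable (φ : ℝ ≃ₘ^∞⟮𝓘(ℝ, ℝ), 𝓘(ℝ, ℝ)⟯ ℝ)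

lemma contDiff_diffeo : ContDiff ℝ ∞ φ := φ.contMDiff_toFun.contDiff

lemma contDiff_diffeo_symm : ContDiff ℝ ∞ φ.symm := φ.symm.contMDiff_toFun.contDiff

lemma hasDerivAt_diffeo (x : ℝ) : HasDerivAt φ (deriv φ x) x :=
  ((contDiff_diffeo φ).differentiable (by simp) x).hasDerivAt

lemma continuous_deriv_diffeo : Continuous (deriv φ) :=
  (contDiff_diffeo φ).continuous_deriv (by simp)

/-- Monotonicity gives `φ' ≥ 0`, and the chain rule with the differentiable inverse excludes zero.
-/
lemma deriv_diffeo_pos {φ : ℝ ≃ₘ^∞⟮𝓘(ℝ, ℝ), 𝓘(ℝ, ℝ)⟯ ℝ} (hφ : StrictMono φ) (x : ℝ) :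
    0 < deriv φ x := by
  refine lt_of_le_of_ne (hφ.monotone.deriv_nonneg) fun h0 => ?_
  have h1 := hasDerivAt_diffeo φ x
  rw [← h0] at h1
  have h2 : HasDerivAt φ.symm (deriv φ.symm (φ x)) (φ x) :=
    ((contDiff_diffeo_symm φ).differentiable (by simp) _).hasDerivAt
  have h3 := h2.comp x h1
  have h4 : φ.symm ∘ φ = id := funext fun y => φ.symm_apply_apply y
  rw [h4, mul_zero] at h3
  exact one_ne_zero ((hasDerivAt_id x).unique h3)

/-- The height of the catenary as a function of its slope. -/
def slopeHeight (C q : ℝ) : ℝ := φ.symm (Real.log (1 + q ^ 2) / 2 + C)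

/-- This is the first integral `φ(u) - log (1 + u'²) / 2 = C` with `u' = q`. Since `u'' > 0`, the
slope is a valid parameter, and `dx/dq = 1 / u''` gives `slopeAbscissa`. No existence theorem for
ODEs is needed. -/
lemma apply_slopeHeight (C q : ℝ) : φ (slopeHeight φ C q) = Real.log (1 + q ^ 2) / 2 + C :=
  φ.apply_symm_apply _

lemma continuous_slopeHeight (C : ℝ) : Continuous (slopeHeight φ C) := by
  refine φ.symm.continuous.comp ?_
  have : Continuous fun q : ℝ => Real.log (1 + q ^ 2) :=
    Continuous.log (by fun_prop) fun q => by positivity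
  fun_prop

lemma hasDerivAt_slopeHeight {φ : ℝ ≃ₘ^∞⟮𝓘(ℝ, ℝ), 𝓘(ℝ, ℝ)⟯ ℝ} (hφ : StrictMono φ) (C q : ℝ) :
    HasDerivAt (slopeHeight φ C) (q / ((1 + q ^ 2) * deriv φ (slopeHeight φ C q))) q := by
  have hq : 0 < 1 + q ^ 2 := by positivity
  have h1 := (hasDerivAt_log_one_add_sq q).add_const C
  have h2 : HasDerivAt φ.symm (deriv φ (slopeHeight φ C q))⁻¹ (Real.log (1 + q ^ 2) / 2 + C) :=
    HasDerivAt.of_local_left_inverse φ.symm.continuous.continuousAt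
      (hasDerivAt_diffeo φ _) (deriv_diffeo_pos hφ _).ne'
      (Eventually.of_forall fun y => φ.apply_symm_apply y)
  refine (h2.comp q h1).congr_deriv ?_
  have := deriv_diffeo_pos hφ (slopeHeight φ C q)
  field_simp

/-- The abscissa of the catenary as a function of its slope. -/
def slopeAbscissa (C q : ℝ) : ℝ :=
  ∫ t in (0 : ℝ)..q, (deriv φ (slopeHeight φ C t) * (1 + t ^ 2))⁻¹

variable {φ}

lemma hasStrictDerivAt_slopeAbscissa (hφ : StrictMono φ) (C q : ℝ) :
    HasStrictDerivAt (slopeAbscissa φ C) (deriv φ (slopeHeight φ C q) * (1 + q ^ 2))⁻¹ q := by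
  have hc : Continuous fun t : ℝ => (deriv φ (slopeHeight φ C t) * (1 + t ^ 2))⁻¹ := by
    refine Continuous.inv₀ ?_ fun t => ?_
    · exact ((continuous_deriv_diffeo φ).comp (continuous_slopeHeight φ C)).mul (by fun_prop)
    · have := deriv_diffeo_pos hφ (slopeHeight φ C t)
      positivity
  exact hc.integral_hasStrictDerivAt 0 q

lemma slopeAbscissa_deriv_pos (hφ : StrictMono φ) (C q : ℝ) :
    0 < (deriv φ (slopeHeight φ C q) * (1 + q ^ 2))⁻¹ := by
  have := deriv_diffeo_pos hφ (slopeHeight φ C q)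
  positivity

lemma strictMono_slopeAbscissa (hφ : StrictMono φ) (C : ℝ) : StrictMono (slopeAbscissa φ C) :=
  strictMono_of_hasDerivAt_pos (fun q => (hasStrictDerivAt_slopeAbscissa hφ C q).hasDerivAt)
    (slopeAbscissa_deriv_pos hφ C)

/-- The slope of the catenary as a function of the abscissa. -/
def catSlope (φ : ℝ ≃ₘ^∞⟮𝓘(ℝ, ℝ), 𝓘(ℝ, ℝ)⟯ ℝ) (C : ℝ) : ℝ → ℝ :=
  Function.invFun (slopeAbscissa φ C)

/-- The catenary as a graph. -/
def catHeight (φ : ℝ ≃ₘ^∞⟮𝓘(ℝ, ℝ), 𝓘(ℝ, ℝ)⟯ ℝ) (C x : ℝ) : ℝ := slopeHeight φ C (catSlope φ C x)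

lemma catSlope_slopeAbscissa (hφ : StrictMono φ) (C q : ℝ) :
    catSlope φ C (slopeAbscissa φ C q) = q :=
  Function.leftInverse_invFun (strictMono_slopeAbscissa hφ C).injective q

lemma catHeight_slopeAbscissa (hφ : StrictMono φ) (C q : ℝ) :
    catHeight φ C (slopeAbscissa φ C q) = slopeHeight φ C q := by
  rw [catHeight, catSlope_slopeAbscissa hφ]

lemma isOpenMap_slopeAbscissa (hφ : StrictMono φ) (C : ℝ) : IsOpenMap (slopeAbscissa φ C) :=
  isOpenMap_of_hasStrictDerivAt (hasStrictDerivAt_slopeAbscissa hφ C)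
    fun q => (slopeAbscissa_deriv_pos hφ C q).ne'

lemma isOpen_range_slopeAbscissa (hφ : StrictMono φ) (C : ℝ) :
    IsOpen (range (slopeAbscissa φ C)) := (isOpenMap_slopeAbscissa hφ C).isOpen_range

lemma ordConnected_range_slopeAbscissa (hφ : StrictMono φ) (C : ℝ) :
    (range (slopeAbscissa φ C)).OrdConnected :=
  (isPreconnected_range (continuous_iff_continuousAt.2 fun q =>
    (hasStrictDerivAt_slopeAbscissa hφ C q).hasDerivAt.continuousAt)).ordConnected

lemma hasDerivAt_catSlope (hφ : StrictMono φ) (C q : ℝ) :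
    HasDerivAt (catSlope φ C) (deriv φ (slopeHeight φ C q) * (1 + q ^ 2))
      (slopeAbscissa φ C q) := by
  have hc : ContinuousAt (catSlope φ C) (slopeAbscissa φ C q) := by
    intro V hV
    rw [catSlope_slopeAbscissa hφ] at hV
    rw [mem_map]
    refine mem_of_superset ((isOpenMap_slopeAbscissa hφ C).image_mem_nhds hV) ?_
    rintro _ ⟨x, hx, rfl⟩
    rwa [mem_preimage, catSlope_slopeAbscissa hφ]
  have h1 := (hasStrictDerivAt_slopeAbscissa hφ C q).hasDerivAt
  rw [← catSlope_slopeAbscissa hφ C q] at h1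
  have := HasDerivAt.of_local_left_inverse hc h1 (slopeAbscissa_deriv_pos hφ C _).ne' (by
    filter_upwards [(isOpen_range_slopeAbscissa hφ C).mem_nhds ⟨q, rfl⟩] with y hy
    exact Function.invFun_eq hy)
  rw [catSlope_slopeAbscissa hφ, inv_inv] at this
  exact this

lemma hasDerivAt_catHeight (hφ : StrictMono φ) (C q : ℝ) :
    HasDerivAt (catHeight φ C) q (slopeAbscissa φ C q) := by
  have h1 := hasDerivAt_slopeHeight hφ C q
  rw [← catSlope_slopeAbscissa hφ C q] at h1
  have := h1.comp _ (hasDerivAt_catSlope hφ C q)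
  rw [catSlope_slopeAbscissa hφ] at this
  refine this.congr_deriv ?_
  have := deriv_diffeo_pos hφ (slopeHeight φ C q)
  field_simp

lemma deriv_catHeight (hφ : StrictMono φ) (C q : ℝ) :
    deriv (catHeight φ C) (slopeAbscissa φ C q) = q := (hasDerivAt_catHeight hφ C q).deriv

lemma hasDerivAt_deriv_catHeight (hφ : StrictMono φ) (C q : ℝ) :
    HasDerivAt (deriv (catHeight φ C)) (deriv φ (slopeHeight φ C q) * (1 + q ^ 2))
      (slopeAbscissa φ C q) := by
  refine (hasDerivAt_catSlope hφ C q).congr_of_eventuallyEq ?_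
  filter_upwards [(isOpen_range_slopeAbscissa hφ C).mem_nhds ⟨q, rfl⟩] with y hy
  obtain ⟨x, rfl⟩ := hy
  rw [deriv_catHeight hφ, catSlope_slopeAbscissa hφ]

lemma slopeAbscissa_zero (C : ℝ) : slopeAbscissa φ C 0 = 0 := by simp [slopeAbscissa]

lemma isCatenarySolution_catHeight (hφ : StrictMono φ) (C : ℝ) :
    IsCatenarySolution φ (slopeHeight φ C 0) (range (slopeAbscissa φ C)) (catHeight φ C) := by
  have h0 := slopeAbscissa_zero (φ := φ) C
  refine ⟨isOpen_range_slopeAbscissa hφ C, ordConnected_range_slopeAbscissa hφ C, ⟨0, h0⟩, ?_, ?_,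
    ?_, ?_⟩
  · have := catHeight_slopeAbscissa hφ C 0
    rwa [h0] at this
  · have := deriv_catHeight hφ C 0
    rwa [h0] at this
  · rintro _ ⟨q, rfl⟩
    exact (hasDerivAt_catHeight hφ C q).differentiableAt
  · rintro _ ⟨q, rfl⟩
    rw [deriv_catHeight hφ, catHeight_slopeAbscissa hφ]
    exact hasDerivAt_deriv_catHeight hφ C q

/-- On the range of `slopeAbscissa` the slope takes every real value. An extension to a point `x`
outside would have slope bounded by some `K` on the compact interval from `0` to `x`, which contains
the abscissa of slope `|K| + 1` or `-(|K| + 1)`. -/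
lemma isMaximalCatenarySolution_catHeight (hφ : StrictMono φ) (C : ℝ) :
    IsMaximalCatenarySolution φ (slopeHeight φ C 0) (range (slopeAbscissa φ C))
      (catHeight φ C) := by
  refine ⟨isCatenarySolution_catHeight hφ C, fun J v hv hIJ heq => ?_⟩
  refine Subset.antisymm (fun x hx => ?_) hIJ
  by_contra hxI
  have hmono := strictMono_slopeAbscissa hφ C
  have h0 := slopeAbscissa_zero (φ := φ) C
  have hslope : ∀ q, deriv v (slopeAbscissa φ C q) = q := by
    intro q
    have : v =ᶠ[𝓝 (slopeAbscissa φ C q)] catHeight φ C := by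
      filter_upwards [(isOpen_range_slopeAbscissa hφ C).mem_nhds ⟨q, rfl⟩] with y hy
      exact (heq hy).symm
    rw [this.deriv_eq, deriv_catHeight hφ]
  have hsub : uIcc 0 x ⊆ J := hv.ordConnected.uIcc_subset hv.zero_mem hx
  have hcont : ContinuousOn (deriv v) (uIcc 0 x) := fun y hy =>
    (hv.ode y (hsub hy)).continuousAt.continuousWithinAt
  obtain ⟨K, hK⟩ := isCompact_uIcc.exists_bound_of_continuousOn hcont
  have hnot : ∀ q q' : ℝ, slopeAbscissa φ C q ≤ x → x ≤ slopeAbscissa φ C q' → False :=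
    fun q q' h1 h2 => hxI ((ordConnected_range_slopeAbscissa hφ C).out ⟨q, rfl⟩ ⟨q', rfl⟩ ⟨h1, h2⟩)
  rcases le_total 0 x with hx0 | hx0
  · have hq : ∀ q, slopeAbscissa φ C q ≤ x := fun q => by
      by_contra! hlt
      exact hnot 0 q (h0.trans_le hx0) hlt.le
    have hpos : 0 ≤ slopeAbscissa φ C (|K| + 1) := by
      rw [← h0]; exact hmono.monotone (by positivity)
    have := hK (slopeAbscissa φ C (|K| + 1)) (by rw [uIcc_of_le hx0]; exact ⟨hpos, hq _⟩)
    rw [hslope, Real.norm_eq_abs, abs_of_nonneg (by positivity)] at this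
    linarith [le_abs_self K]
  · have hq : ∀ q, x ≤ slopeAbscissa φ C q := fun q => by
      by_contra! hlt
      exact hnot q 0 hlt.le (hx0.trans_eq h0.symm)
    have hneg : slopeAbscissa φ C (-(|K| + 1)) ≤ 0 := by
      rw [← h0]; exact hmono.monotone (neg_nonpos.2 (by positivity))
    have := hK (slopeAbscissa φ C (-(|K| + 1))) (by rw [uIcc_of_ge hx0]; exact ⟨hq _, hneg⟩)
    rw [hslope, Real.norm_eq_abs, abs_neg, abs_of_nonneg (by positivity)] at this
    linarith [le_abs_self K]

end Profile

/-! ### Tilted cylinders as graphs, and the equation along a ruling -/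

section Cylinder

lemma inner_dirF (α : ℝ) (k : E2) :
    inner ℝ (dirF α) k = Real.cos α * k 0 + Real.sin α * k 1 := by
  simp [dirF, PiLp.inner_apply, Fin.sum_univ_two]; ring

lemma inner_dirE (α : ℝ) (k : E2) :
    inner ℝ (dirE α) k = -Real.sin α * k 0 + Real.cos α * k 1 := by
  simp [dirE, PiLp.inner_apply, Fin.sum_univ_two]; ring

lemma inner_dirF_dirF (α : ℝ) : inner ℝ (dirF α) (dirF α) = (1 : ℝ) := by
  rw [inner_dirF]; simp [dirF]; nlinarith [Real.sin_sq_add_cos_sq α]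

lemma inner_dirE_dirE (α : ℝ) : inner ℝ (dirE α) (dirE α) = (1 : ℝ) := by
  rw [inner_dirE]; simp [dirE]; nlinarith [Real.sin_sq_add_cos_sq α]

lemma inner_dirF_dirE (α : ℝ) : inner ℝ (dirF α) (dirE α) = (0 : ℝ) := by
  rw [inner_dirF]; simp [dirE]; ring

lemma inner_dirE_dirF (α : ℝ) : inner ℝ (dirE α) (dirF α) = (0 : ℝ) := by
  rw [inner_dirE]; simp [dirF]; ring

/-- The tilted cylinder over the graph of `u`, as a graph over the horizontal plane. -/
lemma mem_motion_tilt_iff {I : Set ℝ} {u : ℝ → ℝ} {α a b : ℝ} (q : E3) :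
    q ∈ horizontalMotion α (√(1 + b ^ 2) * a * Real.cos α) (√(1 + b ^ 2) * a * Real.sin α) ''
        (tilt (Real.arctan b) '' graphCylinder I u) ↔
      inner ℝ (dirF α) (horProj q) / √(1 + b ^ 2) - a ∈ I ∧
        q 2 = b * inner ℝ (dirE α) (horProj q) +
          (1 + b ^ 2) * u (inner ℝ (dirF α) (horProj q) / √(1 + b ^ 2) - a) := by
  have hpos : 0 < 1 + b ^ 2 := by positivity
  set μ := √(1 + b ^ 2) with hμ
  have hμ0 : 0 < μ := Real.sqrt_pos.2 hpos
  have hμ2 : μ ^ 2 = 1 + b ^ 2 := Real.sq_sqrt hpos.le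
  have hsc := Real.sin_sq_add_cos_sq α
  -- For `θ = arctan b` the factor `1 / cos θ` is `μ` and `tan θ = b`, which makes the tilt
  -- polynomial in `b` and `μ`.
  have htilt : ∀ x y w : ℝ, tilt (Real.arctan b) !₂[x, y, w] = !₂[μ * x, y - b * w, b * y + w] := by
    intro x y w
    rw [tilt, rotateX, Real.cos_arctan, Real.sin_arctan, ← hμ]
    ext i; fin_cases i <;> simp <;> field_simp
  rw [inner_dirF, inner_dirE, horProj_zero, horProj_one]
  constructor
  · rintro ⟨_, ⟨_, ⟨x, hx, y, rfl⟩, rfl⟩, rfl⟩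
    rw [htilt]
    have e1 : Real.cos α * (Real.cos α * (μ * x) - Real.sin α * (y - b * u x) + μ * a * Real.cos α) +
        Real.sin α * (Real.sin α * (μ * x) + Real.cos α * (y - b * u x) + μ * a * Real.sin α) =
        μ * (x + a) := by linear_combination (μ * (x + a)) * hsc
    have e2 : -Real.sin α * (Real.cos α * (μ * x) - Real.sin α * (y - b * u x) +
        μ * a * Real.cos α) + Real.cos α * (Real.sin α * (μ * x) + Real.cos α * (y - b * u x) +
        μ * a * Real.sin α) = y - b * u x := by linear_combination (y - b * u x) * hsc
    have e3 : μ * (x + a) / μ - a = x := by field_simp; ring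
    simp only [horizontalMotion]
    simp only [Matrix.cons_val_zero, Matrix.cons_val_one, Matrix.cons_val]
    rw [e1, e2, e3]
    exact ⟨hx, by ring⟩
  · rintro ⟨hI, hq⟩
    set f := Real.cos α * q 0 + Real.sin α * q 1 with hf
    set g := -Real.sin α * q 0 + Real.cos α * q 1 with hg
    refine ⟨_, ⟨_, ⟨f / μ - a, hI, g + b * u (f / μ - a), rfl⟩, rfl⟩, ?_⟩
    rw [htilt, horizontalMotion]
    have e0 : μ * (f / μ - a) = f - μ * a := by field_simp
    ext i; fin_cases i
    · simp [e0]; rw [hf, hg]; linear_combination (q 0) * hsc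
    · simp [e0]; rw [hf, hg]; linear_combination (q 1) * hsc
    · simp; rw [hq]; ring

variable {M : Type*} [TopologicalSpace M] [ChartedSpace E2 M] [IsManifold (𝓡 2) ∞ M]
  {κ : M → E2} {e : M → OpenPartialHomeomorph M E2} {z : M → ℝ} {φ : ℝ → ℝ}

lemma eq_of_dirE_dirF_eq_zero [PreconnectedSpace M] (h : IsEtaleOn κ e univ) {f : M → ℝ} {α : ℝ}
    (hf : EtaleSmoothOn κ e univ f) (hE : ∀ m, dirD κ e (dirE α) f m = 0)
    (hF : ∀ m, dirD κ e (dirF α) f m = 0) (x y : M) : f x = f y := by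
  refine eq_of_dirD_eq_zero h hf (fun m v => ?_) x y
  rw [eq_dirE_dirF α v, dirD_add_smul, hE, hF]; simp

/-- Along a ruling both slopes and the eigenvalue are constant while `z` is affine. The equation at
the two ends differs only in the factor `φ'`, which must therefore agree. -/
lemma HasRankOneHessian.deriv_eq (h : HasRankOneHessian κ e z)
    (hl : ∀ α m, dirD κ e (dirE α) (dirD κ e (dirF α) z) m = 0 →
      dirD κ e (dirE α) (dirD κ e (dirE α) z) m = 0 →
      ∀ T, 0 ≤ T → ∃ γ, IsLift κ m (dirE α) T γ)
    {α : ℝ} (hS : ∀ m, dirD κ e (dirE α) (dirD κ e (dirF α) z) m = 0)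
    (hT : ∀ m, dirD κ e (dirE α) (dirD κ e (dirE α) z) m = 0)
    (hpde : ∀ m, (1 + dirD κ e (dirE α) z m ^ 2) * dirD κ e (dirF α) (dirD κ e (dirF α) z) m =
      deriv φ (z m) * (1 + dirD κ e (dirF α) z m ^ 2 + dirD κ e (dirE α) z m ^ 2)) (m : M)
    {T : ℝ} (hT0 : 0 ≤ T) : deriv φ (z m + dirD κ e (dirE α) z m * T) = deriv φ (z m) := by
  obtain ⟨γ, hγ⟩ := hl α m (hS m) (hT m) T hT0
  have hTT : T ∈ Icc 0 T := ⟨hT0, le_rfl⟩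
  have h1 := fun {τ} => h.const_lift (h.smooth.dirD h.etale (dirE α)) hγ (fun τ _ => hT _) (τ := τ)
  have h2 := h.const_lift (h.smooth.dirD h.etale (dirF α)) hγ (fun τ _ => hS _) hTT
  have h3 := h.const_lift (h.smooth_dd (dirF α) (dirF α)) hγ
    (fun τ _ => h.dirE_hA_eq_zero hl (hS _) (hT _)) hTT
  have h4 : z (γ T) - dirD κ e (dirE α) z m * T = z (γ 0) - dirD κ e (dirE α) z m * 0 := by
    have hd : ∀ x ∈ Icc 0 T, HasDerivWithinAt (fun τ => z (γ τ) - dirD κ e (dirE α) z m * τ) 0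
        (Icc 0 T) x := fun x hx => by
      have := (h.deriv_lift h.smooth hγ hx).sub
        ((hasDerivWithinAt_id x _).const_mul (dirD κ e (dirE α) z m))
      refine this.congr_deriv ?_
      rw [h1 hx]; ring
    exact constant_of_derivWithin_zero (fun x hx => (hd x hx).differentiableWithinAt)
      (fun x hx => (hd x (Ico_subset_Icc_self hx)).derivWithin
        (uniqueDiffOn_Icc (hx.1.trans_lt hx.2) x (Ico_subset_Icc_self hx))) T hTT
  rw [hγ.zero] at h4
  have h5 : z (γ T) = z m + dirD κ e (dirE α) z m * T := by linarith
  have p1 := hpde m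
  have p2 := hpde (γ T)
  rw [h1 hTT, h2, h3, p1, h5] at p2
  exact (mul_right_cancel₀ (by positivity) p2).symm

end Cylinder

/-! ### Integration of the reduced equation -/

section Classification

lemma contDiff_slopeHeight (φ : ℝ ≃ₘ^∞⟮𝓘(ℝ, ℝ), 𝓘(ℝ, ℝ)⟯ ℝ) (C : ℝ) :
    ContDiff ℝ ∞ (slopeHeight φ C) :=
  (contDiff_diffeo_symm φ).comp (contDiff_log_one_add_sq.add contDiff_const)

lemma contDiff_slopeAbscissa {φ : ℝ ≃ₘ^∞⟮𝓘(ℝ, ℝ), 𝓘(ℝ, ℝ)⟯ ℝ} (hφ : StrictMono φ) (C : ℝ) :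
    ContDiff ℝ ∞ (slopeAbscissa φ C) := by
  have hd := fun q => (hasStrictDerivAt_slopeAbscissa hφ C q).hasDerivAt
  refine contDiff_infty_iff_deriv.2 ⟨fun q => (hd q).differentiableAt, ?_⟩
  rw [funext fun q => (hd q).deriv]
  refine ContDiff.inv (((contDiff_infty_iff_deriv.1 (contDiff_diffeo φ)).2.comp
    (contDiff_slopeHeight φ C)).mul (by fun_prop)) fun q => ?_
  exact (inv_pos.1 (slopeAbscissa_deriv_pos hφ C q)).ne'

variable {M : Type*} [TopologicalSpace M] [ChartedSpace E2 M] [IsManifold (𝓡 2) ∞ M]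
  [ConnectedSpace M]
  {κ : M → E2} {e : M → OpenPartialHomeomorph M E2} {z : M → ℝ}

/-- The kernel direction annihilates the differential of the slope along it, so that slope is
constant. A half turn makes it nonnegative, to match tilting angles in `[0, π/2)`. -/
lemma HasRankOneHessian.exists_ruling (h : HasRankOneHessian κ e z)
    (hl : ∀ α m, dirD κ e (dirE α) (dirD κ e (dirF α) z) m = 0 →
      dirD κ e (dirE α) (dirD κ e (dirE α) z) m = 0 →
      ∀ T, 0 ≤ T → ∃ γ, IsLift κ m (dirE α) T γ) :
    ∃ α b, 0 ≤ b ∧ ∀ m, dirD κ e (dirE α) z m = b := by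
  obtain ⟨α, hα⟩ := h.exists_kernel hl
  obtain ⟨m₀⟩ := (inferInstance : Nonempty M)
  have hc : ∀ m, dirD κ e (dirE α) z m = dirD κ e (dirE α) z m₀ := fun m =>
    eq_of_dirD_eq_zero h.etale (h.smooth.dirD h.etale _) hα m m₀
  rcases le_total 0 (dirD κ e (dirE α) z m₀) with h0 | h0
  · exact ⟨α, _, h0, hc⟩
  · refine ⟨α + Real.pi, -dirD κ e (dirE α) z m₀, by linarith, fun m => ?_⟩
    rw [dirE_add_pi, dirD_neg, hc]

lemma HasRankOneHessian.hST_eq_zero (h : HasRankOneHessian κ e z) {α b : ℝ}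
    (hb : ∀ m, dirD κ e (dirE α) z m = b) (m : M) :
    dirD κ e (dirE α) (dirD κ e (dirF α) z) m = 0 ∧
      dirD κ e (dirE α) (dirD κ e (dirE α) z) m = 0 := by
  rw [h.dd_comm (dirE α) (dirF α), funext hb]
  exact ⟨dirD_const _, dirD_const _⟩

/-- A ruling with nonzero slope, followed in both directions, passes through every height. -/
lemma HasRankOneHessian.deriv_eq_deriv {φ : ℝ → ℝ} (h : HasRankOneHessian κ e z)
    (hl : ∀ α m, dirD κ e (dirE α) (dirD κ e (dirF α) z) m = 0 →
      dirD κ e (dirE α) (dirD κ e (dirE α) z) m = 0 →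
      ∀ T, 0 ≤ T → ∃ γ, IsLift κ m (dirE α) T γ) {α b : ℝ} (hb0 : b ≠ 0)
    (hb : ∀ m, dirD κ e (dirE α) z m = b)
    (hpde : ∀ m, (1 + dirD κ e (dirE α) z m ^ 2) * dirD κ e (dirF α) (dirD κ e (dirF α) z) m =
      deriv φ (z m) * (1 + dirD κ e (dirF α) z m ^ 2 + dirD κ e (dirE α) z m ^ 2)) (m : M)
    (x : ℝ) : deriv φ x = deriv φ (z m) := by
  have hx : x = z m + b * ((x - z m) / b) := by field_simp; ring
  rcases le_total 0 ((x - z m) / b) with h0 | h0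
  · have := h.deriv_eq hl (fun m => (h.hST_eq_zero hb m).1) (fun m => (h.hST_eq_zero hb m).2)
      hpde m h0
    rwa [hb, ← hx] at this
  · obtain ⟨e1, e2, e3⟩ := h.frame_add_pi α
    have := h.deriv_eq hl (α := α + Real.pi) (φ := φ)
      (fun m => by rw [e1]; exact (h.hST_eq_zero hb m).1)
      (fun m => by rw [e2]; exact (h.hST_eq_zero hb m).2)
      (fun m => by
        rw [e3, dirE_add_pi, dirF_add_pi, dirD_neg, dirD_neg, neg_sq, neg_sq]
        exact hpde m) m (T := -((x - z m) / b)) (by linarith)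
    rwa [dirE_add_pi, dirD_neg, hb, neg_mul_neg, ← hx] at this

/-- The surface is a graph over the direction `dirF α`, sheared along `dirE α`; `q` is the
slope of the profile. -/
lemma HasRankOneHessian.exists_profile {φ : ℝ ≃ₘ^∞⟮𝓘(ℝ, ℝ), 𝓘(ℝ, ℝ)⟯ ℝ} (hφ : StrictMono φ)
    (h : HasRankOneHessian κ e z) {α b : ℝ} (hb : ∀ m, dirD κ e (dirE α) z m = b)
    (hpde : ∀ m, (1 + dirD κ e (dirE α) z m ^ 2) * dirD κ e (dirF α) (dirD κ e (dirF α) z) m =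
      deriv φ (z m) * (1 + dirD κ e (dirF α) z m ^ 2 + dirD κ e (dirE α) z m ^ 2))
    (hconst : b ≠ 0 → ∀ m x, deriv φ x = deriv φ (z m)) :
    ∃ C a, ∀ m, ∃ q, dirD κ e (dirF α) z m = √(1 + b ^ 2) * q ∧
      inner ℝ (dirF α) (κ m) / √(1 + b ^ 2) - a = slopeAbscissa φ C q ∧
      z m = b * inner ℝ (dirE α) (κ m) + (1 + b ^ 2) * slopeHeight φ C q := by
  obtain ⟨m₀⟩ := (inferInstance : Nonempty M)
  have hpos : 0 < 1 + b ^ 2 := by positivity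
  set μ := √(1 + b ^ 2) with hμ
  have hμ0 : 0 < μ := Real.sqrt_pos.2 hpos
  have hμ2 : 1 + b ^ 2 = μ ^ 2 := (Real.sq_sqrt hpos.le).symm
  have sp := h.smooth.dirD h.etale (dirF α)
  set p := dirD κ e (dirF α) z with hp
  set q : M → ℝ := fun m => μ⁻¹ * p m with hq
  have sq : EtaleSmoothOn κ e univ q := sp.const_mul _
  have hpq : ∀ m, p m = μ * q m := fun m => by simp only [hq]; field_simp
  have sE : EtaleSmoothOn κ e univ fun m => innerSL ℝ (dirE α) (κ m) :=
    etaleSmoothOn_coord h.etale _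
  have sF : EtaleSmoothOn κ e univ fun m => innerSL ℝ (dirF α) (κ m) :=
    etaleSmoothOn_coord h.etale _
  -- `U` and `q` are the height and slope of the profile once the shear `b` is removed and lengths
  -- are rescaled. The scaling is chosen so that `U` has derivative `q` and `q` has derivative
  -- `φ'(U) (1 + q²)` in the abscissa `⟨dirF α, κ⟩ / μ`.
  set U : M → ℝ := fun m => (μ ^ 2)⁻¹ * (z m - b * innerSL ℝ (dirE α) (κ m)) with hU
  have sU : EtaleSmoothOn κ e univ U := (h.smooth.sub (sE.const_mul b)).const_mul _
  have dU : ∀ v m, dirD κ e v U m =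
      (μ ^ 2)⁻¹ * (dirD κ e v z m - b * inner ℝ (dirE α) v) := fun v m => by
    rw [hU, dirD_const_mul h.etale _ (h.smooth.sub (sE.const_mul b)) (mem_univ m),
      dirD_sub h.smooth (sE.const_mul b) (mem_univ m),
      dirD_const_mul h.etale _ sE (mem_univ m), dirD_coord h.etale _ (mem_univ m)]
    rfl
  have dUE : ∀ m, dirD κ e (dirE α) U m = 0 := fun m => by
    rw [dU, hb, inner_dirE_dirE]; ring
  have dUF : ∀ m, dirD κ e (dirF α) U m = q m / μ := fun m => by
    rw [dU, inner_dirE_dirF, ← hp, hpq]; field_simp; ring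
  have dqE : ∀ m, dirD κ e (dirE α) q m = 0 := fun m => by
    rw [hq, dirD_const_mul h.etale _ sp (mem_univ m), hp, (h.hST_eq_zero hb m).1, mul_zero]
  -- For `b = 0` the two heights coincide; otherwise `φ'` is constant.
  have hφU : ∀ m, deriv φ (z m) = deriv φ (U m) := fun m => by
    by_cases hb0 : b = 0
    · have : U m = z m := by simp [hU, hb0, ← hμ2]
      rw [this]
    · exact (hconst hb0 m _).symm
  have dqF : ∀ m, dirD κ e (dirF α) q m = deriv φ (U m) * (1 + q m ^ 2) / μ := fun m => by
    have h1 := hpde m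
    rw [hb, hμ2, hφU, hpq] at h1
    rw [hq, dirD_const_mul h.etale _ sp (mem_univ m)]
    have h2 : μ ^ 2 * dirD κ e (dirF α) p m = μ ^ 2 * (deriv φ (U m) * (1 + q m ^ 2)) := by
      rw [h1]; linear_combination (deriv φ (U m)) * hμ2
    rw [mul_left_cancel₀ (by positivity) h2]; ring
  have sG : EtaleSmoothOn κ e univ fun m => φ (U m) - Real.log (1 + q m ^ 2) / 2 :=
    (sU.comp (contDiff_diffeo φ)).sub (sq.comp contDiff_log_one_add_sq)
  have dG : ∀ v m, dirD κ e v (fun m => φ (U m) - Real.log (1 + q m ^ 2) / 2) m =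
      deriv φ (U m) * dirD κ e v U m - q m / (1 + q m ^ 2) * dirD κ e v q m := fun v m => by
    rw [dirD_sub (sU.comp (contDiff_diffeo φ)) (sq.comp contDiff_log_one_add_sq) (mem_univ m),
      dirD_comp h.etale sU (mem_univ m) (hasDerivAt_diffeo φ _),
      dirD_comp h.etale sq (mem_univ m) (hasDerivAt_log_one_add_sq _)]
  have hG := eq_of_dirE_dirF_eq_zero h.etale sG (fun m => by rw [dG, dUE, dqE]; ring)
    (fun m => by rw [dG, dUF, dqF]; field_simp; ring)
  set C := φ (U m₀) - Real.log (1 + q m₀ ^ 2) / 2 with hC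
  have hUs : ∀ m, slopeHeight φ C (q m) = U m := fun m => by
    have h1 := hG m m₀
    apply hφ.injective
    rw [apply_slopeHeight]
    linarith
  have sX := contDiff_slopeAbscissa hφ C
  have dH : ∀ v m, dirD κ e v
      (fun m => μ⁻¹ * innerSL ℝ (dirF α) (κ m) - slopeAbscissa φ C (q m)) m =
      μ⁻¹ * inner ℝ (dirF α) v - (deriv φ (U m) * (1 + q m ^ 2))⁻¹ * dirD κ e v q m := fun v m => by
    rw [dirD_sub (sF.const_mul _) (sq.comp sX) (mem_univ m),
      dirD_const_mul h.etale _ sF (mem_univ m), dirD_coord h.etale _ (mem_univ m),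
      dirD_comp h.etale sq (mem_univ m) (hasStrictDerivAt_slopeAbscissa hφ C _).hasDerivAt, hUs]
    rfl
  -- The difference between the true abscissa and the one computed from the slope is constant; its
  -- value is the horizontal translation `a`.
  have hH := eq_of_dirE_dirF_eq_zero h.etale ((sF.const_mul _).sub (sq.comp sX))
    (fun m => by rw [dH, dqE, inner_dirF_dirE]; ring)
    (fun m => by
      have := deriv_diffeo_pos hφ (U m)
      rw [dH, dqF, inner_dirF_dirF]; field_simp; ring)
  refine ⟨C, μ⁻¹ * innerSL ℝ (dirF α) (κ m₀) - slopeAbscissa φ C (q m₀), fun m =>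
    ⟨q m, hpq m, ?_, ?_⟩⟩
  · have h1 := hH m m₀
    simp only [innerSL_apply_apply] at h1 ⊢
    rw [div_eq_inv_mul]
    linarith
  · rw [hUs, hμ2]
    simp only [hU, innerSL_apply_apply]
    field_simp
    ring

end Classification

/-! ### From the profile to the complete surface -/

section Graph

variable {M : Type*} [TopologicalSpace M] [ChartedSpace E2 M] [IsManifold (𝓡 2) ∞ M]
  [T2Space M] [ConnectedSpace M] {ψ : M → E3} {φ : ℝ ≃ₘ^∞⟮𝓘(ℝ, ℝ), 𝓘(ℝ, ℝ)⟯ ℝ}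

lemma convex_strip (α μ a : ℝ) {I : Set ℝ} (hI : I.OrdConnected) :
    Convex ℝ {k : E2 | inner ℝ (dirF α) k / μ - a ∈ I} := by
  intro x hx y hy s t hs ht hst
  have := hI.convex hx hy hs ht hst
  simp only [mem_ofPred_eq, inner_add_right, inner_smul_right]
  convert this using 1
  simp only [smul_eq_mul]
  linear_combination a * hst

lemma tilt_zero (q : E3) : tilt 0 q = q := by
  ext i; fin_cases i <;> simp [tilt, rotateX]

/-- An immersion that is nowhere vertical is a catenary cylinder, possibly tilted. -/
lemma isCatenaryCylinder_of_injective (hφ : StrictMono φ)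
    (hψ : ContMDiff (𝓡 2) 𝓘(ℝ, E3) ∞ ψ) (hc : IsCompleteSurface ψ) (hflat : IsFlat ψ)
    (hmin : IsPhiMinimal φ ψ) (hinj : ∀ p v, horProj (dMap ψ p v) = 0 → v = 0) :
    IsEmbedding ψ ∧
      (IsCatenaryCylinder φ (range ψ) ∨ IsTiltedCatenaryCylinder φ (range ψ)) := by
  obtain ⟨e, he⟩ := exists_isEtaleOn hψ horProj
  rw [show {p | ∀ v, horProj (dMap ψ p v) = 0 → v = 0} = univ from
    eq_univ_of_forall hinj] at he
  have hH := hasRankOneHessian hψ (deriv_diffeo_pos hφ) hflat hmin rfl he hinj rfl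
  have hl := fun α m hS hT => exists_lift_kernel (α := α) (m := m) hψ hc hH hS hT
  obtain ⟨α, b, hb0, hb⟩ := hH.exists_ruling hl
  have hpde := fun m => (graph_pde hψ hflat hmin rfl he hinj rfl α m).2
  simp only [fun m => (hH.hST_eq_zero hb m).1, fun m => (hH.hST_eq_zero hb m).2, mul_zero,
    sub_zero, add_zero] at hpde
  obtain ⟨C, a, hprof⟩ := hH.exists_profile hφ hb hpde
    fun h0 m x => hH.deriv_eq_deriv hl h0 hb hpde m x
  set μ := √(1 + b ^ 2) with hμ
  set κ : M → E2 := fun m => horProj (ψ m) with hκ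
  set R := range (slopeAbscissa φ C) with hR
  set D : Set E2 := {k | inner ℝ (dirF α) k / μ - a ∈ R} with hD
  have hκD : ∀ m, κ m ∈ D := fun m => by
    obtain ⟨q, -, h2, -⟩ := hprof m
    exact ⟨q, h2.symm⟩
  have hslope : ∀ m, dirD κ e (dirF α) (fun m => ψ m 2) m =
      μ * catSlope φ C (inner ℝ (dirF α) (κ m) / μ - a) := fun m => by
    obtain ⟨q, h1, h2, -⟩ := hprof m
    rw [h2, catSlope_slopeAbscissa hφ, h1]
  obtain ⟨hi, hrange⟩ : Function.Injective κ ∧ range κ = D := by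
    refine injective_and_range_eq hψ hc (norm_frameProj_le _) he hκD fun o ho w hw => ?_
    set v := w - o with hv
    set s := Real.cos α * v 1 - Real.sin α * v 0 with hs
    set t := Real.cos α * v 0 + Real.sin α * v 1 with ht
    -- The derivative of `ψ` along `v` depends on `m` only through `κ m`, by a function that is
    -- continuous over the strip `D`. Compactness of the segment gives the bound required for
    -- lifting, even though the slope may be unbounded on `D`.
    have hcont : ContinuousOn (fun k : E2 => (!₂[v 0, v 1, s * b] : E3) +
        (t * (μ * catSlope φ C (inner ℝ (dirF α) k / μ - a))) • (!₂[0, 0, 1] : E3))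
        (segment ℝ o w) := by
      have h1 : ContinuousOn (catSlope φ C) R := by
        rintro _ ⟨q, rfl⟩
        exact (hasDerivAt_catSlope hφ C q).continuousAt.continuousWithinAt
      have h2 : ContinuousOn (fun k : E2 => catSlope φ C (inner ℝ (dirF α) k / μ - a))
          (segment ℝ o w) := h1.comp (by fun_prop) fun k hk =>
        (convex_strip α μ a (ordConnected_range_slopeAbscissa hφ C)).segment_subset ho hw hk
      fun_prop
    have hcomp : IsCompact (segment ℝ o w) := by
      rw [segment_eq_image']
      exact isCompact_Icc.image (by fun_prop)
    obtain ⟨B, hB⟩ := hcomp.exists_bound_of_continuousOn hcont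
    refine ⟨B, fun m hm => ?_⟩
    change ‖dirD κ e v ψ m‖ ≤ B
    refine le_of_eq_of_le (congrArg _ ?_) (hB (κ m) hm)
    rw [dirD_eq_of_height hψ he]
    have h3 : dirD κ e v (fun m => ψ m 2) m =
        s * b + t * (μ * catSlope φ C (inner ℝ (dirF α) (κ m) / μ - a)) := by
      rw [eq_dirE_dirF α v, dirD_add_smul, hb, hslope]
      rfl
    ext i; fin_cases i
    · simp
    · simp
    · simpa using h3
  refine ⟨isEmbedding_of_injective hψ.continuous he hi, ?_⟩
  have hS : range ψ = horizontalMotion α (μ * a * Real.cos α) (μ * a * Real.sin α) ''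
      (tilt (Real.arctan b) '' graphCylinder R (catHeight φ C)) := by
    have hmem : ∀ m, ψ m 2 = b * inner ℝ (dirE α) (κ m) +
        (1 + b ^ 2) * catHeight φ C (inner ℝ (dirF α) (κ m) / μ - a) := fun m => by
      obtain ⟨q, -, h2, h3⟩ := hprof m
      rw [h2, catHeight_slopeAbscissa hφ, h3]
    ext q
    rw [mem_motion_tilt_iff]
    constructor
    · rintro ⟨m, rfl⟩
      exact ⟨hκD m, hmem m⟩
    · rintro ⟨h1, h2⟩
      obtain ⟨m, hm⟩ : horProj q ∈ range κ := by rw [hrange]; exact h1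
      refine ⟨m, ext_horProj hm ?_⟩
      rw [h2, hmem, hm]
  have hmax := isMaximalCatenarySolution_catHeight hφ C
  rcases hb0.eq_or_lt with h0 | h0
  · left
    refine ⟨_, _, _, α, μ * a * Real.cos α, μ * a * Real.sin α, hmax, ?_⟩
    rw [hS, ← h0, Real.arctan_zero, funext tilt_zero, image_id']
  · right
    exact ⟨_, _, _, _, _, _, _, hmax, ⟨Real.arctan_pos.2 h0, Real.arctan_lt_pi_div_two b⟩, hS⟩

end Graph

end PhiMinimal

end

theorem mainTheorem6 (φ : ℝ ≃ₘ^∞⟮𝓘(ℝ, ℝ), 𝓘(ℝ, ℝ)⟯ ℝ) (hφ : StrictMono φ)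
    {M : Type*} [TopologicalSpace M] [ChartedSpace PhiMinimal.E2 M] [IsManifold (𝓡 2) ∞ M]
    [T2Space M] [SecondCountableTopology M] [ConnectedSpace M]
    (ψ : M → PhiMinimal.E3)
    (hψ : PhiMinimal.IsSmoothImmersion ψ)
    (hcomplete : PhiMinimal.IsCompleteSurface ψ)
    (hflat : PhiMinimal.IsFlat ψ)
    (hminimal : PhiMinimal.IsPhiMinimal φ ψ) :
    IsEmbedding ψ ∧
      (PhiMinimal.IsVerticalPlane (range ψ) ∨
        PhiMinimal.IsCatenaryCylinder φ (range ψ) ∨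
        PhiMinimal.IsTiltedCatenaryCylinder φ (range ψ)) := by
  have hi : ∀ p, Function.Injective (PhiMinimal.dMap ψ p) := fun p => by
    have h1 := hψ.2 p
    rwa [PhiMinimal.mfderiv_eq_dMap (hψ.1.mdifferentiable (by simp) p)] at h1
  -- A single vertical tangent plane forces a vertical plane; without one, the horizontal projection
  -- is immersive everywhere.
  by_cases hv : ∃ p α, PhiMinimal.IsVertAt ψ α p
  · obtain ⟨p, α, hα⟩ := hv
    obtain ⟨h1, h2⟩ := PhiMinimal.isVerticalPlane_of_isVertAt hψ.1 hcomplete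
      (PhiMinimal.continuous_deriv_diffeo φ) hflat hminimal hi hα
    exact ⟨h1, Or.inl h2⟩
  · obtain ⟨h1, h2⟩ := PhiMinimal.isCatenaryCylinder_of_injective hφ hψ.1 hcomplete hflat
      hminimal fun p => by
        by_contra h
        exact hv ⟨p, PhiMinimal.exists_isVertAt (hi p) h⟩
    exact ⟨h1, Or.inr h2⟩
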